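/- Let $p\ge q\ge 1$ be integers, let $M(p,q)$ be the space of real $p\times q$ matrices, and $P^+(q)$ the set of symmetric positive-definite real $q\times q$ matrices. On $P^+(q)$ put $\mu(\mathrm dS)=(\det S)^{-(q+1)/2}\prod_{i\le j}\mathrm dS_{ij}$, let $\Gamma_q(a)=\int_{P^+(q)}e^{-\operatorname{tr}S}(\det S)^{a}\,\mu(\mathrm dS)$ be the multivariate Gamma function, and for $U\in P^+(p)$ put $$\nu_U(\mathrm dx)=\frac{\Gamma_q(p/2)}{\pi^{pq/2}}\,\frac{(\det U)^{-q/2}}{\det(x^\top U^{-1}x)^{p/2}}\,\mathrm{Leb}(\mathrm dx)\quad\text{on } M(p,q).$$ For $\rho\in[0,1)$ let $Q_\rho(x,\cdot)$ be the law of $y=\rho^{1/2}x+(1-\rho)^{1/2}w$, where, given $x$ of full rank, $V$ has the inverse-Wishart law $W_q^{-1}(p,x^\top U^{-1}x)$, with density $\frac{\det(T)^{p/2}\exp(-\operatorname{tr}[TV^{-1}]/2)}{2^{pq/2}\det(V)^{p/2}\,\Gamma_q(p/2)}$ with respect to $\mu(\mathrm dV)$, $T=x^\top U^{-1}x$, and,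 given $V$, $w$ has the matrix-normal law $N_{p,q}(0,U,V)$, with Lebesgue density $\frac{\exp(-\operatorname{tr}[V^{-1}w^\top U^{-1}w]/2)}{(2\pi)^{pq/2}\det(U)^{q/2}\det(V)^{p/2}}$. For a proposal $Q$ and a nonnegative measurable density $\pi$, the Metropolis--Hastings kernel is $$P(x,A)=\int_A\alpha(x,y)\,Q(x,\mathrm dy)+\Big(1-\int\alpha(x,y)\,Q(x,\mathrm dy)\Big)\delta_x(A),\qquad \alpha(x,y)=\min\{1,\pi(y)/\pi(x)\}.$$ (The values of the kernels on the null sets of rank-deficient $x$ and of $x$ with $\pi(x)=0$ are immaterial; there the chain is taken not to move.) *MpCN kernel on $M(p,q)$.* For a probability measure $\Pi(\mathrm dx)=\pi(x)\nu_U(\mathrm dx)$ on $M(p,q)$, $P_\rho$ is the Metropolis--Hastings kernel with proposal $Q_\rho$ and density $\pi$. *MpCN kernel on $P^+(q)$.* For a probability measure $\tilde\Pi(\mathrm dS)=\tilde\pi(S)\mu(\mathrm dS)$ on $P^+(q)$, $\tilde P_\rho$ is the Metropolis--Hastings kernel with density $\tilde\pi$ and proposal $\tilde Q_\rho(S,\cdot)$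 equal to the law of $S^{1/2}\epsilon S^{1/2}$, where $\epsilon$ has the law of $y^\top y$ for $y\sim Q_\rho(x,\cdot)$ with $U=I_p$ and $x\in M(p,q)$ the matrix with first $q$ rows $I_q$ and remaining rows $0$ (so that $x^\top x=I_q$). *Spectral gap.* A Markov kernel $P$ acting as a bounded self-adjoint operator $(Pf)(x)=\int f(y)P(x,\mathrm dy)$ on real $L^2(\Pi)$, $\Pi$ a probability measure, has a spectral gap if $1-|\sup\operatorname{spec}(P)|>0$, where $\operatorname{spec}(P)$ is the spectrum of the restriction of $P$ to $\{f\in L^2(\Pi):\Pi(f)=0\}$. **Proposition.** (i) For every $U\in P^+(p)$ and every $\Pi=\pi\,\nu_U$ as above: if $P_0$ has a spectral gap on $L^2(\Pi)$, then so does $P_\rho$ for every $\rho\in[0,1)$. (ii) For every $\tilde\Pi=\tilde\pi\,\mu$ as above: if $\tilde P_0$ has a spectral gap on $L^2(\tilde\Pi)$, then so does $\tilde P_\rho$ for every $\rho\in[0,1)$. (In both parts the target is the same for $\rho=0$ and for general $\rho$.) -/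

import Mathlib

open MeasureTheory ProbabilityTheory
open scoped ENNReal

namespace MpCN

/-- `M(p,q)`: real `p × q` matrices. -/
abbrev Mat (p q : ℕ) : Type := Matrix (Fin p) (Fin q) ℝ

/-- The Borel (= product) σ-algebra on `M(p,q)`. -/
instance instMeasurableSpaceMat (p q : ℕ) : MeasurableSpace (Mat p q) :=
  inferInstanceAs (MeasurableSpace (Fin p → Fin q → ℝ))

/-- `P⁺(q)`: symmetric positive-definite real `q × q` matrices, with the trace σ-algebra. -/
abbrev PosMat (q : ℕ) : Type := {S : Mat q q // S.PosDef}

noncomputable section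

/-! ### Reference measures -/

/-- Lebesgue measure `∏ dX_ij` on `M(p,q)`. -/
def leb (p q : ℕ) : Measure (Mat p q) :=
  (Measure.pi fun _ : Fin p => Measure.pi fun _ : Fin q => (volume : Measure ℝ))

/-- The symmetric matrix with prescribed entries on and above the diagonal. -/
def symOfUpper {q : ℕ} (v : {ij : Fin q × Fin q // ij.1 ≤ ij.2} → ℝ) : Mat q q :=
  fun i j => v ⟨(min i j, max i j), min_le_max⟩

/-- Lebesgue measure `∏_{i ≤ j} dS_ij` on `P⁺(q)`. -/
def lebPos (q : ℕ) : Measure (PosMat q) :=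
  Measure.comap Subtype.val
    ((volume : Measure ({ij : Fin q × Fin q // ij.1 ≤ ij.2} → ℝ)).map symOfUpper)

/-- `μ(dS) = (det S)^{-(q+1)/2} ∏_{i ≤ j} dS_ij` on `P⁺(q)`. -/
def mu (q : ℕ) : Measure (PosMat q) :=
  (lebPos q).withDensity fun S => ENNReal.ofReal (S.1.det ^ (-((q : ℝ) + 1) / 2))

/-- The multivariate Gamma function `Γ_q(a) = ∫_{P⁺(q)} e^{-tr S} (det S)^a μ(dS)`. -/
def multiGamma (q : ℕ) (a : ℝ) : ℝ :=
  ∫ S : PosMat q, Real.exp (-S.1.trace) * S.1.det ^ a ∂(mu q)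

/-- `ν_U(dX) = Γ_q(p/2) π^{-pq/2} (det U)^{-q/2} det(Xᵀ U⁻¹ X)^{-p/2} Leb(dX)` on `M(p,q)`. -/
def nu {p : ℕ} (q : ℕ) (U : Mat p p) : Measure (Mat p q) :=
  (leb p q).withDensity fun X => ENNReal.ofReal
    (multiGamma q ((p : ℝ) / 2) / Real.pi ^ ((p : ℝ) * q / 2) *
      (U.det ^ (-(q : ℝ) / 2) / (X.transpose * U⁻¹ * X).det ^ ((p : ℝ) / 2)))

/-! ### Matrix distributions -/

/-- The Matrix-Normal law `N_{p,q}(M, Σ, T)`. -/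
def matrixNormal {p q : ℕ} (M : Mat p q) (Sg : Mat p p) (T : Mat q q) : Measure (Mat p q) :=
  (leb p q).withDensity fun X => ENNReal.ofReal
    (Real.exp (-(T⁻¹ * (X - M).transpose * Sg⁻¹ * (X - M)).trace / 2) /
      ((2 * Real.pi) ^ ((p : ℝ) * q / 2) * Sg.det ^ ((q : ℝ) / 2) * T.det ^ ((p : ℝ) / 2)))

/-- The Inverse-Wishart law `W_q⁻¹(r, T)`, `T` positive definite, `r > q - 1`.
For singular `T` (and `r > 0`) the formula gives the zero measure. -/
def invWishart {q : ℕ} (r : ℝ) (T : Mat q q) : Measure (PosMat q) :=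
  (mu q).withDensity fun S => ENNReal.ofReal
    (T.det ^ (r / 2) * Real.exp (-(T * S.1⁻¹).trace / 2) /
      (2 ^ (r * q / 2) * S.1.det ^ (r / 2) * multiGamma q (r / 2)))

/-! ### Metropolis–Hastings kernels -/

/-- The Metropolis–Hastings transition law with proposal `Q` and target density `f` (with respect
to a measure for which `Q` is reversible):
`P(x,A) = ∫_A α(x,y) Q(x,dy) + (1 - ∫ α(x,y) Q(x,dy)) δ_x(A)`, `α(x,y) = min{1, f(y)/f(x)}`. -/
def metropolis {E : Type} [MeasurableSpace E] (f : E → ℝ) (Q : E → Measure E) (x : E) :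
    Measure E :=
  (Q x).withDensity (fun y => ENNReal.ofReal (min 1 (f y / f x))) +
    (1 - ∫⁻ y, ENNReal.ofReal (min 1 (f y / f x)) ∂(Q x)) • Measure.dirac x

/-! ### MpCN on `M(p,q)` -/

/-- The MpCN proposal on `M(p,q)`: `y = ρ^{1/2} x + (1-ρ)^{1/2} w`, `w ∼ N_{p,q}(0, U, V)`,
`V ∼ W_q⁻¹(p, xᵀ U⁻¹ x)`. At the (null set of) rank-deficient `x` this is the zero measure, so
that the Metropolis–Hastings chain does not move there. -/
def proposal {p q : ℕ} (U : Mat p p) (ρ : ℝ) (x : Mat p q) : Measure (Mat p q) :=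
  (invWishart p (x.transpose * U⁻¹ * x)).bind fun V : PosMat q =>
    (matrixNormal 0 U V.1).map fun w => Real.sqrt ρ • x + Real.sqrt (1 - ρ) • w

/-- The MpCN kernel `P_ρ` on `M(p,q)` whose target has density `f` with respect to `ν_U`. -/
def kernel {p q : ℕ} (U : Mat p p) (f : Mat p q → ℝ) (ρ : ℝ) : Mat p q → Measure (Mat p q) :=
  metropolis f (proposal U ρ)

/-! ### MpCN on `P⁺(q)` -/

open scoped MatrixOrder in
/-- `A ∘ B = B^{1/2} A B^{1/2}` on `P⁺(q)`. -/
def circ {q : ℕ} (A B : PosMat q) : PosMat q :=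
  ⟨CFC.sqrt B.1 * A.1 * CFC.sqrt B.1, by
    have h : (CFC.sqrt B.1).PosDef :=
      Matrix.isStrictlyPositive_iff_posDef.1
        (Matrix.isStrictlyPositive_iff_posDef.2 B.2).sqrt
    have h2 := A.2.conjTranspose_mul_mul_same (B := CFC.sqrt B.1)
      (Matrix.mulVec_injective_of_isUnit h.isUnit)
    rwa [h.1] at h2⟩

/-- The `p × q` matrix whose first `q` rows are `I_q` and whose other rows vanish. -/
def frame (p q : ℕ) : Mat p q := fun i j => if (i : ℕ) = j then 1 else 0

/-- The law `𝓛` on `P⁺(q)` of the multiplicative noise `ε`: the law of `yᵀ y` when `y` is the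
MpCN proposal (with `U = I_p`) made from an `x` with `xᵀ x = I_q`. -/
def noise (p q : ℕ) (ρ : ℝ) : Measure (PosMat q) :=
  Measure.comap Subtype.val
    ((proposal (1 : Mat p p) ρ (frame p q)).map fun y : Mat p q => (y.transpose * y : Mat q q))

/-- The induced proposal on `P⁺(q)`: `Q̃_ρ(S, ·)` is the law of `ε ∘ S`, `ε ∼ 𝓛`. -/
def proposalPos (p : ℕ) {q : ℕ} (ρ : ℝ) (S : PosMat q) : Measure (PosMat q) :=
  (noise p q ρ).map fun e => circ e S

/-- The MpCN kernel `P̃_ρ` on `P⁺(q)` whose target has density `f` with respect to `μ`. -/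
def kernelPos (p : ℕ) {q : ℕ} (f : PosMat q → ℝ) (ρ : ℝ) : PosMat q → Measure (PosMat q) :=
  metropolis f (proposalPos p ρ)

/-! ### Spectral gap -/

/-- `{f ∈ L²(Π) : Π(f) = 0}`, the orthogonal complement of the constants in real `L²(Π)`. -/
abbrev meanZero {E : Type} [MeasurableSpace E] (m : Measure E) [IsFiniteMeasure m] :
    Submodule ℝ (Lp ℝ 2 m) :=
  (Submodule.span ℝ {Lp.const 2 m (1 : ℝ)})ᗮ

/-- `P` is a Markov kernel, acting by `(Pf)(x) = ∫ f(y) P(x,dy)` as a bounded self-adjoint operator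
`T` on real `L²(Π)` which preserves the orthogonal complement of the constants, and the spectrum of
its restriction `T₀` to that complement satisfies `1 - |sup spec T₀| > 0`. -/
def HasSpectralGap {E : Type} [MeasurableSpace E] (P : E → Measure E) (m : Measure E)
    [IsFiniteMeasure m] : Prop :=
  ∃ κ : Kernel E E, IsMarkovKernel κ ∧ (∀ x, κ x = P x) ∧
    ∃ T : Lp ℝ 2 m →L[ℝ] Lp ℝ 2 m,
      (∀ f : Lp ℝ 2 m, (T f : E → ℝ) =ᵐ[m] fun x => ∫ y, f y ∂(κ x)) ∧
      IsSelfAdjoint T ∧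
      ∃ T₀ : meanZero m →L[ℝ] meanZero m,
        (∀ f : meanZero m, (T₀ f : Lp ℝ 2 m) = T f) ∧
        0 < 1 - |sSup (spectrum ℝ T₀)|

end

end MpCN

/-!
The gap passes from `P_0` to `P_ρ` by a comparison of Dirichlet forms.

*Gap and Dirichlet form.* Let `P` be a Markov kernel reversible with respect to a probability
measure `m`, and `T` its operator on `L²(m)`. A bound `⟪T f, f⟫ ≤ (1 - λ) ‖f‖²` on mean-zero `f`
with `λ > 0` is a bound on the Dirichlet form `½ ∫∫ (f x - f y)² P(x, dy) m(dx)` from below by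
`λ ‖f‖²`. If `P(x, dy) ≥ c P₀(x, dy)` off the diagonal, the Dirichlet forms compare with the
constant `c`, so the supremum of the spectrum for `P` is less than `1` whenever that for `P₀` is
(`hasSpectralGap_of_dirichlet_le`). For Metropolis–Hastings kernels with a common target density the
acceptance probabilities are the same, so it is enough to compare proposals: `Q ≥ c Q₀`
(`hasSpectralGap_metropolis_of_smul_le`). A spectral gap is defined through the *absolute value* of
the supremum of the spectrum, so one also needs `sup spec > -1`; a mean-zero step function built
on a set of measure in `(0, 1/2)` supplies this, and there are such sets because the targets have no
atoms.

*Comparison of the proposals.* Integrating the Gaussian increment against the inverse Wishart law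
shows that `Q_ρ(x, ·)` has the Lebesgue density
`C_ρ (det xᵀ U⁻¹ x)^{p/2} ψ((1 - ρ)⁻¹ Z_ρ(x, y))`, where
`Z_ρ(x, y) = xᵀ U⁻¹ x + yᵀ U⁻¹ y - √ρ (xᵀ U⁻¹ y + yᵀ U⁻¹ x)` is symmetric in `x` and `y`, and
`ψ(Z)` is the Wishart integral `mixture p Z`, antitone for the Loewner order and homogeneous
(`proposal_eq_withDensity`, `mixture_anti`, `mixture_smul`). Symmetry of `Z_ρ` gives reversibility
with respect to `ν_U` (`proposal_reversible`). Since
`(1 + √ρ) Z_0 - Z_ρ = √ρ (x + y)ᵀ U⁻¹ (x + y)` is positive semidefinite, `Q_ρ ≥ c Q_0` with `c > 0`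
independent of `x` (`exists_smul_proposal_le`).

*Normalising constants.* These densities have mass one, and `μ` is the image of `ν_I`, because an
invariant measure on `P⁺(q)` is unique up to a constant (`lintegral_mul_lintegral_haarGL`); the same
fact reduces the convergence of the integral `Γ_q(p/2)` to a Gaussian integral on `M(q,q)`
(`multiGamma_ne_zero`).

*Positive-definite matrices.* The density of `Q_ρ` with `U = I` is equivariant under
`x ↦ O x B` for `O ∈ O(p)` and invertible `B`, and `O(p)` acts transitively on the fibres of the
Gram map `x ↦ xᵀ x`. Hence `Q̃_ρ(S, ·)` is the image of `Q_ρ(x, ·)` for every `x` with `xᵀ x = S`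
(`proposalPos_eq_map_gram`), and `μ` is the image of `ν_I` (`lintegral_nu_gram`). Reversibility and
the comparison `Q̃_ρ ≥ c Q̃_0` descend, and the same argument applies.
-/

namespace MpCN

open Matrix

/-! ### Self-adjoint operators: quadratic forms and the top of the spectrum -/

section Spectrum
open scoped NNReal
open ContinuousLinearMap

variable {H : Type*} [NormedAddCommGroup H] [InnerProductSpace ℝ H]

theorem norm_sq_le_of_inner_nonneg (B : H →L[ℝ] H)
    (hsymm : ∀ x y, inner ℝ (B x) y = inner ℝ x (B y)) (hpos : ∀ x, 0 ≤ inner ℝ (B x) x) (x : H) :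
    ‖B x‖ ^ 2 ≤ ‖B‖ * inner ℝ (B x) x := by
  -- the discriminant of `t ↦ ⟪B (t x + B x), t x + B x⟫` is nonpositive
  have key : ∀ t : ℝ, 0 ≤ inner ℝ (B x) x * (t * t) + (2 * ‖B x‖ ^ 2) * t
      + inner ℝ (B (B x)) (B x) := by
    intro t
    have h := hpos (t • x + B x)
    have h1 : inner ℝ (B (B x)) x = ‖B x‖ ^ 2 := by
      rw [hsymm, real_inner_self_eq_norm_sq]
    simp only [map_add, map_smul, inner_add_left, inner_add_right, real_inner_smul_left,
      real_inner_smul_right, real_inner_self_eq_norm_sq, h1] at h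
    linarith
  have hd := discrim_le_zero key
  rw [discrim] at hd
  have h2 : inner ℝ (B (B x)) (B x) ≤ ‖B‖ * ‖B x‖ ^ 2 := by
    calc inner ℝ (B (B x)) (B x) ≤ ‖B (B x)‖ * ‖B x‖ := real_inner_le_norm _ _
      _ ≤ (‖B‖ * ‖B x‖) * ‖B x‖ := by gcongr; exact B.le_opNorm _
      _ = _ := by ring
  rcases eq_or_lt_of_le (sq_nonneg ‖B x‖) with h0 | h0
  · rw [← h0]; exact mul_nonneg (norm_nonneg _) (hpos x)
  · have h3 := mul_le_mul_of_nonneg_left h2 (hpos x)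
    nlinarith

variable [CompleteSpace H]

/-- The numerical range of a symmetric operator lies below the supremum of its spectrum: the
supremum `m` of the Rayleigh quotient is itself spectral, since `m - A` is nonnegative but not
bounded below. -/
theorem inner_map_self_le_sSup_spectrum (A : H →L[ℝ] H)
    (hsymm : ∀ x y, inner ℝ (A x) y = inner ℝ x (A y)) (x : H) :
    inner ℝ (A x) x ≤ sSup (spectrum ℝ A) * ‖x‖ ^ 2 := by
  by_contra! hx
  have hx0 : x ≠ 0 := by
    rintro rfl
    simp at hx
  have hnx : 0 < ‖x‖ ^ 2 := by positivity
  set S : Set ℝ := Set.range fun y : {y : H // y ≠ 0} => inner ℝ (A y) y / ‖(y : H)‖ ^ 2 with hS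
  have hbdd : BddAbove S := by
    refine ⟨‖A‖, ?_⟩
    rintro _ ⟨⟨y, hy⟩, rfl⟩
    have : 0 < ‖y‖ ^ 2 := by positivity
    simp only
    rw [div_le_iff₀ this]
    calc inner ℝ (A y) y ≤ ‖A y‖ * ‖y‖ := real_inner_le_norm _ _
      _ ≤ (‖A‖ * ‖y‖) * ‖y‖ := by gcongr; exact A.le_opNorm _
      _ = _ := by ring
  have hne : S.Nonempty := ⟨_, ⟨⟨x, hx0⟩, rfl⟩⟩
  set m := sSup S with hm
  have hle : ∀ y, inner ℝ (A y) y ≤ m * ‖y‖ ^ 2 := by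
    intro y
    by_cases hy : y = 0
    · simp [hy]
    · have : 0 < ‖y‖ ^ 2 := by positivity
      rw [← div_le_iff₀ this]
      exact le_csSup hbdd ⟨⟨y, hy⟩, rfl⟩
  have hsm : sSup (spectrum ℝ A) < m := by
    refine lt_of_lt_of_le ?_ (le_csSup hbdd ⟨⟨x, hx0⟩, rfl⟩)
    simp only
    rwa [lt_div_iff₀ hnx]
  have hspec : m ∉ spectrum ℝ A := fun h =>
    absurd (le_csSup (spectrum.isBounded A).bddAbove h) (not_le.2 hsm)
  have hunit : IsUnit (algebraMap ℝ (H →L[ℝ] H) m - A) := by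
    simpa [spectrum.mem_iff] using hspec
  obtain ⟨u, hu⟩ := hunit
  set B : H →L[ℝ] H := algebraMap ℝ (H →L[ℝ] H) m - A with hB
  have hBx : ∀ y, B y = m • y - A y := by intro y; simp [hB, Algebra.algebraMap_eq_smul_one]
  have hBin : ∀ y, inner ℝ (B y) y = m * ‖y‖ ^ 2 - inner ℝ (A y) y := by
    intro y
    rw [hBx, inner_sub_left, real_inner_smul_left, real_inner_self_eq_norm_sq]
  have hBpos : ∀ y, 0 ≤ inner ℝ (B y) y := by
    intro y; rw [hBin]; linarith [hle y]
  have hBsymm : ∀ y z, inner ℝ (B y) z = inner ℝ y (B z) := by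
    intro y z
    simp only [hBx, inner_sub_left, inner_sub_right, real_inner_smul_left, real_inner_smul_right,
      hsymm]
  set C : H →L[ℝ] H := ((u⁻¹ : (H →L[ℝ] H)ˣ) : H →L[ℝ] H) with hC
  have hCB : ∀ y, C (B y) = y := by
    intro y
    have : C * B = 1 := by rw [← hu, hC, Units.inv_mul]
    simpa using congrArg (fun L : H →L[ℝ] H => L y) this
  have hlow : ∀ y, ‖y‖ ^ 2 ≤ (‖C‖ ^ 2 * ‖B‖) * (m * ‖y‖ ^ 2 - inner ℝ (A y) y) := by
    intro y
    have h1 : ‖y‖ ≤ ‖C‖ * ‖B y‖ := by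
      conv_lhs => rw [← hCB y]
      exact C.le_opNorm _
    have h2 := norm_sq_le_of_inner_nonneg B hBsymm hBpos y
    rw [hBin] at h2
    calc ‖y‖ ^ 2 ≤ (‖C‖ * ‖B y‖) ^ 2 := by gcongr
      _ = ‖C‖ ^ 2 * ‖B y‖ ^ 2 := by ring
      _ ≤ ‖C‖ ^ 2 * (‖B‖ * (m * ‖y‖ ^ 2 - inner ℝ (A y) y)) := by gcongr
      _ = _ := by ring
  set K := ‖C‖ ^ 2 * ‖B‖ with hK
  have hKpos : 0 < K := by
    have h0 : 0 ≤ K := by positivity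
    rcases h0.eq_or_lt with h | h
    · have := hlow x
      rw [← h] at this
      linarith
    · exact h
  have : m ≤ m - K⁻¹ := by
    refine csSup_le hne ?_
    rintro _ ⟨⟨y, hy⟩, rfl⟩
    have hy2 : 0 < ‖y‖ ^ 2 := by positivity
    simp only
    rw [div_le_iff₀ hy2]
    have h3 := hlow y
    have h4 : K⁻¹ * ‖y‖ ^ 2 ≤ m * ‖y‖ ^ 2 - inner ℝ (A y) y := by
      rw [inv_mul_le_iff₀ hKpos]; exact h3
    linarith
  have := inv_pos.2 hKpos
  linarith

theorem le_of_mem_spectrum_of_inner_map_self_le (A : H →L[ℝ] H) {s : ℝ}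
    (hs : ∀ x, inner ℝ (A x) x ≤ s * ‖x‖ ^ 2) {t : ℝ} (ht : t ∈ spectrum ℝ A) : t ≤ s := by
  by_contra! hlt
  rw [spectrum.mem_iff] at ht
  refine ht (isUnit_of_forall_le_norm_inner_map _ (c := ⟨t - s, by linarith⟩)
    (show (0 : ℝ) < t - s by linarith) fun x => ?_)
  refine le_trans ?_ (le_abs_self _)
  have : (algebraMap ℝ (H →L[ℝ] H) t - A) x = t • x - A x := by
    simp [Algebra.algebraMap_eq_smul_one]
  rw [this, inner_sub_left, real_inner_smul_left, real_inner_self_eq_norm_sq]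
  have := hs x
  show ‖x‖ ^ 2 * (t - s) ≤ _
  linarith

end Spectrum

/-! ### Reversible Markov kernels on `L²` and their Dirichlet forms -/

section MarkovOperator

theorem integral_comp_of_measurePreserving {E F : Type*} [MeasurableSpace E] [MeasurableSpace F]
    {m : Measure E} {μ : Measure F} {π : F → E} (hπ : MeasurePreserving π μ m) {g : E → ℝ}
    (hg : AEStronglyMeasurable g m) :
    ∫ z, g (π z) ∂μ = ∫ x, g x ∂m := by
  have hg' : AEStronglyMeasurable g (μ.map π) := by rwa [hπ.map_eq]
  rw [← integral_map hπ.measurable.aemeasurable hg', hπ.map_eq]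

variable {E : Type} [MeasurableSpace E] {m : Measure E} [IsProbabilityMeasure m]
  {κ : Kernel E E} [IsMarkovKernel κ]

theorem measurePreserving_fst_compProd : MeasurePreserving Prod.fst (m ⊗ₘ κ) m :=
  ⟨measurable_fst, Measure.fst_compProd m κ⟩

theorem measurePreserving_snd_of_reversible
    (hrev : (m ⊗ₘ κ).map Prod.swap = m ⊗ₘ κ) : MeasurePreserving Prod.snd (m ⊗ₘ κ) m := by
  refine ⟨measurable_snd, ?_⟩
  rw [← hrev, Measure.map_map measurable_snd measurable_swap]
  exact Measure.fst_compProd m κ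

theorem memLp_comp_fst (f : Lp ℝ 2 m) : MemLp (fun z : E × E => f z.1) 2 (m ⊗ₘ κ) :=
  (Lp.memLp f).comp_measurePreserving measurePreserving_fst_compProd

theorem memLp_comp_snd (hrev : (m ⊗ₘ κ).map Prod.swap = m ⊗ₘ κ) (f : Lp ℝ 2 m) :
    MemLp (fun z : E × E => f z.2) 2 (m ⊗ₘ κ) :=
  (Lp.memLp f).comp_measurePreserving (measurePreserving_snd_of_reversible hrev)

theorem integrable_mul_compProd (hrev : (m ⊗ₘ κ).map Prod.swap = m ⊗ₘ κ) (f g : Lp ℝ 2 m) :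
    Integrable (fun z : E × E => f z.2 * g z.1) (m ⊗ₘ κ) :=
  (memLp_comp_snd hrev f).integrable_mul (memLp_comp_fst g)

/-- Any operator acting as `(Tf)(x) = ∫ f(y) κ(x,dy)` has the joint law of one step of the chain as
its bilinear form. -/
theorem inner_eq_integral_compProd (hrev : (m ⊗ₘ κ).map Prod.swap = m ⊗ₘ κ)
    {f Tf : Lp ℝ 2 m} (hT : (Tf : E → ℝ) =ᵐ[m] fun x => ∫ y, f y ∂(κ x)) (g : Lp ℝ 2 m) :
    inner ℝ Tf g = ∫ z, f z.2 * g z.1 ∂(m ⊗ₘ κ) := by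
  rw [L2.inner_def, Measure.integral_compProd (integrable_mul_compProd hrev f g)]
  refine integral_congr_ae ?_
  filter_upwards [hT] with x hx
  rw [hx, integral_mul_const]
  simp [mul_comm]

theorem exists_markovOperator (hrev : (m ⊗ₘ κ).map Prod.swap = m ⊗ₘ κ) :
    ∃ T : Lp ℝ 2 m →L[ℝ] Lp ℝ 2 m,
      ∀ f : Lp ℝ 2 m, (T f : E → ℝ) =ᵐ[m] fun x => ∫ y, f y ∂(κ x) := by
  set ι₁ := (Lp.compMeasurePreservingₗᵢ (E := ℝ) (p := 2) ℝ Prod.fst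
    (measurePreserving_fst_compProd (m := m) (κ := κ))).toContinuousLinearMap with h₁
  set ι₂ := (Lp.compMeasurePreservingₗᵢ (E := ℝ) (p := 2) ℝ Prod.snd
    (measurePreserving_snd_of_reversible hrev)).toContinuousLinearMap with h₂
  have e₁ : ∀ f : Lp ℝ 2 m, (ι₁ f : E × E → ℝ) =ᵐ[m ⊗ₘ κ] fun z => f z.1 := fun f =>
    Lp.coeFn_compMeasurePreserving f _
  have e₂ : ∀ f : Lp ℝ 2 m, (ι₂ f : E × E → ℝ) =ᵐ[m ⊗ₘ κ] fun z => f z.2 := fun f =>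
    Lp.coeFn_compMeasurePreserving f _
  refine ⟨(ContinuousLinearMap.adjoint ι₁) ∘L ι₂, fun f => ?_⟩
  set Tf : Lp ℝ 2 m := ((ContinuousLinearMap.adjoint ι₁) ∘L ι₂) f with hTf
  have hfint : Integrable (fun z : E × E => f z.2) (m ⊗ₘ κ) :=
    (memLp_comp_snd hrev f).integrable (by norm_num)
  have hκint : Integrable (fun x => ∫ y, f y ∂(κ x)) m := by
    simpa using Integrable.integral_compProd (κ := Kernel.const Unit m)
      (η := Kernel.prodMkLeft Unit κ) (a := ()) hfint
  refine Integrable.ae_eq_of_forall_setIntegral_eq _ _ ((Lp.memLp Tf).integrable (by norm_num))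
    hκint fun s hs _ => ?_
  -- test against the indicator of `s`
  set g : Lp ℝ 2 m := indicatorConstLp 2 hs (measure_ne_top m s) (1 : ℝ) with hg
  have hgae : (g : E → ℝ) =ᵐ[m] s.indicator fun _ => (1 : ℝ) := indicatorConstLp_coeFn
  have hgae' : (fun z : E × E => g z.1) =ᵐ[m ⊗ₘ κ] fun z => s.indicator (fun _ => (1 : ℝ)) z.1 :=
    (measurePreserving_fst_compProd (m := m) (κ := κ)).quasiMeasurePreserving.ae_eq_comp hgae
  have hinner : inner ℝ Tf g = ∫ x in s, Tf x ∂m := by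
    rw [real_inner_comm, hg, L2.inner_indicatorConstLp_one]
  rw [← hinner, hTf, ContinuousLinearMap.comp_apply, ContinuousLinearMap.adjoint_inner_left,
    L2.inner_def]
  have : ∫ z, inner ℝ (ι₂ f z) (ι₁ g z) ∂(m ⊗ₘ κ) =
      ∫ z, (s ×ˢ Set.univ).indicator (fun z : E × E => f z.2) z ∂(m ⊗ₘ κ) := by
    refine integral_congr_ae ?_
    filter_upwards [e₁ g, e₂ f, hgae'] with z h1 h2 h3
    rw [h1, h2, h3]
    by_cases hz : z.1 ∈ s <;> simp [hz]
  rw [this, integral_indicator (hs.prod MeasurableSet.univ),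
    Measure.setIntegral_compProd hs MeasurableSet.univ hfint.integrableOn]
  simp

theorem integrable_sub_sq_compProd (hrev : (m ⊗ₘ κ).map Prod.swap = m ⊗ₘ κ) (f : Lp ℝ 2 m) :
    Integrable (fun z : E × E => (f z.1 - f z.2) ^ 2) (m ⊗ₘ κ) :=
  ((memLp_comp_fst f).sub (memLp_comp_snd hrev f)).integrable_sq

/-- The Dirichlet form of a reversible Markov operator. -/
theorem integral_sub_sq_compProd (hrev : (m ⊗ₘ κ).map Prod.swap = m ⊗ₘ κ)
    {f Tf : Lp ℝ 2 m} (hT : (Tf : E → ℝ) =ᵐ[m] fun x => ∫ y, f y ∂(κ x)) :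
    ∫ z, (f z.1 - f z.2) ^ 2 ∂(m ⊗ₘ κ) = 2 * (‖f‖ ^ 2 - inner ℝ Tf f) := by
  have i1 : Integrable (fun z : E × E => f z.1 ^ 2) (m ⊗ₘ κ) :=
    (memLp_comp_fst f).integrable_sq
  have i2 : Integrable (fun z : E × E => f z.2 ^ 2) (m ⊗ₘ κ) :=
    (memLp_comp_snd hrev f).integrable_sq
  have i12 : Integrable (fun z : E × E => f z.1 ^ 2 + f z.2 ^ 2) (m ⊗ₘ κ) := i1.add i2
  have i3 := integrable_mul_compProd hrev f f
  have hn : ∫ x, f x ^ 2 ∂m = ‖f‖ ^ 2 := by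
    rw [← real_inner_self_eq_norm_sq, L2.inner_def]
    simp [sq]
  have hcomp : ∀ {π : E × E → E}, MeasurePreserving π (m ⊗ₘ κ) m →
      ∫ z, f (π z) ^ 2 ∂(m ⊗ₘ κ) = ‖f‖ ^ 2 := fun {π} hπ => by
    rw [← hn]
    exact integral_comp_of_measurePreserving hπ (Lp.memLp f).integrable_sq.aestronglyMeasurable
  have v1 := hcomp (measurePreserving_fst_compProd (m := m) (κ := κ))
  have v2 := hcomp (measurePreserving_snd_of_reversible hrev)
  have hexp : (fun z : E × E => (f z.1 - f z.2) ^ 2) =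
      fun z => (f z.1 ^ 2 + f z.2 ^ 2) - 2 * (f z.2 * f z.1) := by
    ext z; ring
  rw [hexp, integral_sub i12 (i3.const_mul 2), integral_add i1 i2, v1, v2, integral_const_mul,
    inner_eq_integral_compProd hrev hT]
  ring

theorem lintegral_sub_sq_compProd (hrev : (m ⊗ₘ κ).map Prod.swap = m ⊗ₘ κ)
    {f Tf : Lp ℝ 2 m} (hT : (Tf : E → ℝ) =ᵐ[m] fun x => ∫ y, f y ∂(κ x)) :
    ∫⁻ z, ENNReal.ofReal ((f z.1 - f z.2) ^ 2) ∂(m ⊗ₘ κ) =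
      ENNReal.ofReal (2 * (‖f‖ ^ 2 - inner ℝ Tf f)) := by
  rw [← integral_sub_sq_compProd hrev hT, ofReal_integral_eq_lintegral_ofReal
    (integrable_sub_sq_compProd hrev f) (Filter.Eventually.of_forall fun z => sq_nonneg _)]

theorem isSelfAdjoint_of_reversible (hrev : (m ⊗ₘ κ).map Prod.swap = m ⊗ₘ κ)
    {T : Lp ℝ 2 m →L[ℝ] Lp ℝ 2 m}
    (hT : ∀ f : Lp ℝ 2 m, (T f : E → ℝ) =ᵐ[m] fun x => ∫ y, f y ∂(κ x)) : IsSelfAdjoint T := by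
  rw [ContinuousLinearMap.isSelfAdjoint_iff_isSymmetric]
  intro f g
  show inner ℝ (T f) g = inner ℝ f (T g)
  rw [real_inner_comm (T g), inner_eq_integral_compProd hrev (hT f),
    inner_eq_integral_compProd hrev (hT g)]
  have h : ∫ z, f z.2 * g z.1 ∂(m ⊗ₘ κ) = ∫ z, f z.2 * g z.1 ∂((m ⊗ₘ κ).map Prod.swap) := by
    rw [hrev]
  rw [h, integral_map measurable_swap.aemeasurable]
  · simp [mul_comm]
  · rw [hrev]; exact (integrable_mul_compProd hrev f g).aestronglyMeasurable

theorem apply_const_one {T : Lp ℝ 2 m →L[ℝ] Lp ℝ 2 m} (hrev : (m ⊗ₘ κ).map Prod.swap = m ⊗ₘ κ)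
    (hT : ∀ f : Lp ℝ 2 m, (T f : E → ℝ) =ᵐ[m] fun x => ∫ y, f y ∂(κ x)) :
    T (Lp.const 2 m (1 : ℝ)) = Lp.const 2 m (1 : ℝ) := by
  have h1 : (Lp.const 2 m (1 : ℝ) : E → ℝ) =ᵐ[m] fun _ => 1 := Lp.coeFn_const 2 m 1
  have h2 : ∀ᵐ x ∂m, ∀ᵐ y ∂(κ x), (Lp.const 2 m (1 : ℝ) : E → ℝ) y = 1 := by
    refine Measure.ae_ae_of_ae_compProd
      (p := fun z : E × E => (Lp.const 2 m (1 : ℝ) : E → ℝ) z.2 = 1) ?_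
    exact (measurePreserving_snd_of_reversible hrev).quasiMeasurePreserving.ae_eq_comp h1
  refine Lp.ext ?_
  filter_upwards [hT (Lp.const 2 m (1 : ℝ)), h1, h2] with x a b c
  rw [a, b, integral_congr_ae c]
  simp

/-- The spectral gap passes from a reversible kernel to any reversible kernel whose Dirichlet form
is at least `c` times as large. The set `A` of mass `a ∈ (0, 1/2)` keeps the supremum of the
spectrum above `-1`: as `⟪P 1_A, 1_A⟫ ≥ 0`, the Rayleigh quotient at `1_A - a` is at least
`-a² / (a - a²) > -1`. -/
theorem hasSpectralGap_of_dirichlet_le {P₀ P : E → Measure E} {κ₀ κ : Kernel E E}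
    [IsMarkovKernel κ₀] [IsMarkovKernel κ] (h₀ : ∀ x, κ₀ x = P₀ x) (h : ∀ x, κ x = P x)
    (hrev₀ : (m ⊗ₘ κ₀).map Prod.swap = m ⊗ₘ κ₀) (hrev : (m ⊗ₘ κ).map Prod.swap = m ⊗ₘ κ)
    {c : ℝ} (hc : 0 < c)
    (hD : ∀ f : E → ℝ, Measurable f →
      ENNReal.ofReal c * ∫⁻ z, ENNReal.ofReal ((f z.1 - f z.2) ^ 2) ∂(m ⊗ₘ κ₀) ≤
        ∫⁻ z, ENNReal.ofReal ((f z.1 - f z.2) ^ 2) ∂(m ⊗ₘ κ))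
    {A : Set E} (hA : MeasurableSet A) (hA0 : 0 < m.real A) (hA1 : m.real A < 1 / 2)
    (hgap : HasSpectralGap P₀ m) : HasSpectralGap P m := by
  obtain ⟨κ', _, hκ', T₀, hT₀, -, R₀, hR₀, hs⟩ := hgap
  obtain rfl : κ' = κ₀ := Kernel.ext fun x => by rw [h₀, hκ']
  obtain ⟨T, hT⟩ := exists_markovOperator hrev
  have hsa := isSelfAdjoint_of_reversible hrev hT
  have hsymm : ∀ f g, inner ℝ (T f) g = inner ℝ f (T g) :=
    (ContinuousLinearMap.isSelfAdjoint_iff_isSymmetric.1 hsa)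
  have hsymm₀ : ∀ f g, inner ℝ (T₀ f) g = inner ℝ f (T₀ g) :=
    (ContinuousLinearMap.isSelfAdjoint_iff_isSymmetric.1 (isSelfAdjoint_of_reversible hrev₀ hT₀))
  have hinv : ∀ f ∈ meanZero m, T f ∈ meanZero m := by
    intro f hf
    rw [Submodule.mem_orthogonal_singleton_iff_inner_right] at hf ⊢
    rw [← hsymm, apply_const_one hrev hT, hf]
  set R : meanZero m →L[ℝ] meanZero m :=
    (T ∘L (meanZero m).subtypeL).codRestrict (meanZero m) fun f => hinv f f.2 with hR
  have hRT : ∀ f : meanZero m, (R f : Lp ℝ 2 m) = T f := fun f => rfl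
  refine ⟨κ, inferInstance, h, T, hT, hsa, R, hRT, ?_⟩
  set s := sSup (spectrum ℝ R₀) with hs_def
  have hcompl : CompleteSpace (meanZero m) := inferInstance
  -- the quadratic forms of the two operators on mean-zero functions
  have hquad₀ : ∀ f : meanZero m, inner ℝ (T₀ f) (f : Lp ℝ 2 m) ≤ s * ‖f‖ ^ 2 := by
    intro f
    have := inner_map_self_le_sSup_spectrum R₀ (fun x y => by
      simp only [Submodule.coe_inner, hR₀]; exact hsymm₀ _ _) f
    rwa [Submodule.coe_inner, hR₀] at this
  have hdir : ∀ f : Lp ℝ 2 m,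
      c * (‖f‖ ^ 2 - inner ℝ (T₀ f) f) ≤ ‖f‖ ^ 2 - inner ℝ (T f) f := by
    intro f
    have h1 := hD f (Lp.stronglyMeasurable f).measurable
    rw [lintegral_sub_sq_compProd hrev₀ (hT₀ f), lintegral_sub_sq_compProd hrev (hT f),
      ← ENNReal.ofReal_mul hc.le] at h1
    have hnn : 0 ≤ 2 * (‖f‖ ^ 2 - inner ℝ (T f) f) := by
      rw [← integral_sub_sq_compProd hrev (hT f)]
      exact integral_nonneg fun z => sq_nonneg _
    have h2 := (ENNReal.ofReal_le_ofReal_iff hnn).1 h1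
    linarith
  have hs1 : s < 1 := by
    have := abs_lt.1 (show |s| < 1 by linarith)
    exact this.2
  have hquad : ∀ f : meanZero m, inner ℝ (R f) f ≤ (1 - c * (1 - s)) * ‖f‖ ^ 2 := by
    intro f
    have h1 := hdir f
    have h2 := mul_le_mul_of_nonneg_left (hquad₀ f) hc.le
    rw [Submodule.coe_inner, hRT]
    have h3 : ‖(f : Lp ℝ 2 m)‖ = ‖f‖ := rfl
    rw [h3] at h1
    linarith
  have hRsymm : ∀ f g, inner ℝ (R f) g = inner ℝ f (R g) := fun f g => by
    simp only [Submodule.coe_inner, hRT]; exact hsymm _ _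
  have hcs : 0 < c * (1 - s) := mul_pos hc (by linarith)
  have hlt : sSup (spectrum ℝ R) < 1 := by
    rcases (spectrum ℝ R).eq_empty_or_nonempty with he | hne
    · simp [he]
    · exact lt_of_le_of_lt
        (csSup_le hne fun t ht => le_of_mem_spectrum_of_inner_map_self_le R hquad ht) (by linarith)
  have hgt : -1 < sSup (spectrum ℝ R) := by
    set a := m.real A with ha
    set e : Lp ℝ 2 m := Lp.const 2 m (1 : ℝ) with he
    set χ : Lp ℝ 2 m := indicatorConstLp 2 hA (measure_ne_top m A) (1 : ℝ) with hχ
    have hχae : (χ : E → ℝ) =ᵐ[m] A.indicator fun _ => (1 : ℝ) := indicatorConstLp_coeFn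
    have hχχ : inner ℝ χ χ = a := by
      rw [hχ, L2.inner_indicatorConstLp_one, ← hχ]
      rw [setIntegral_congr_ae (g := fun _ => (1 : ℝ)) hA]
      · simp [ha]
      · filter_upwards [hχae] with x hx hxA
        rw [hx]; simp [hxA]
    have hχe : inner ℝ χ e = a := by
      rw [hχ, L2.inner_indicatorConstLp_one]
      rw [setIntegral_congr_ae (g := fun _ => (1 : ℝ)) hA]
      · simp [ha]
      · filter_upwards [Lp.coeFn_const 2 m (1 : ℝ)] with x hx _
        rw [he, hx]; rfl
    have hee : inner ℝ e e = (1 : ℝ) := by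
      rw [L2.inner_def, integral_congr_ae (g := fun _ => (1 : ℝ))]
      · simp
      · filter_upwards [Lp.coeFn_const 2 m (1 : ℝ)] with x hx
        rw [he, hx]; simp
    have hTe : T e = e := apply_const_one hrev hT
    have hTχ : 0 ≤ inner ℝ (T χ) χ := by
      rw [inner_eq_integral_compProd hrev (hT χ)]
      refine integral_nonneg_of_ae ?_
      have h1 := (measurePreserving_fst_compProd (m := m) (κ := κ)).quasiMeasurePreserving
        |>.ae_eq_comp hχae
      have h2 := (measurePreserving_snd_of_reversible hrev).quasiMeasurePreserving.ae_eq_comp hχae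
      filter_upwards [h1, h2] with z h1 h2
      simp only [Function.comp] at h1 h2
      rw [h1, h2]
      exact mul_nonneg (Set.indicator_nonneg (fun _ _ => zero_le_one) _)
        (Set.indicator_nonneg (fun _ _ => zero_le_one) _)
    have hmem : χ - a • e ∈ meanZero m := by
      rw [Submodule.mem_orthogonal_singleton_iff_inner_right, inner_sub_right,
        real_inner_smul_right, real_inner_comm, hχe, hee]
      simp
    set f : meanZero m := ⟨χ - a • e, hmem⟩ with hf
    have h1 := inner_map_self_le_sSup_spectrum R hRsymm f
    have h2 : inner ℝ (R f) f = inner ℝ (T χ) χ - a ^ 2 := by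
      have hTχe : inner ℝ (T χ) e = a := by rw [hsymm, hTe, hχe]
      rw [Submodule.coe_inner, hRT]
      simp only [hf, map_sub, map_smul, inner_sub_left, inner_sub_right, real_inner_smul_left,
        real_inner_smul_right, hTe, hTχe, hee, real_inner_comm χ e, hχe]
      ring
    have h3 : ‖f‖ ^ 2 = a - a ^ 2 := by
      rw [← real_inner_self_eq_norm_sq, Submodule.coe_inner]
      simp only [hf, inner_sub_left, inner_sub_right, real_inner_smul_left,
        real_inner_smul_right, hee, hχχ, hχe]
      rw [real_inner_comm, hχe]
      ring
    rw [h2, h3] at h1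
    have h4 : 0 < a - a ^ 2 := by nlinarith
    by_contra! hle
    nlinarith
  linarith [abs_lt.2 ⟨hgt, hlt⟩]

end MarkovOperator

/-! ### Metropolis–Hastings kernels and comparison of proposals -/

section Metropolis

variable {E : Type}

/-- The acceptance probability `α(x,y) = min{1, f(y)/f(x)}`. -/
noncomputable def acceptance (f : E → ℝ) (x y : E) : ℝ≥0∞ := ENNReal.ofReal (min 1 (f y / f x))

theorem acceptance_le_one (f : E → ℝ) (x y : E) : acceptance f x y ≤ 1 := by
  unfold acceptance
  exact ENNReal.ofReal_le_one.2 (min_le_left _ _)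

/-- `f(x) α(x,y)` is symmetric in `x` and `y`. -/
theorem ofReal_mul_acceptance {f : E → ℝ} (hf : ∀ x, 0 ≤ f x) (x y : E) :
    ENNReal.ofReal (f x) * acceptance f x y = ENNReal.ofReal (min (f x) (f y)) := by
  unfold acceptance
  rw [← ENNReal.ofReal_mul (hf x)]
  congr 1
  rcases (hf x).eq_or_lt with h | h
  · rw [← h, zero_mul, min_eq_left (hf y)]
  · rw [mul_min_of_nonneg _ _ h.le, mul_one, mul_div_cancel₀ _ h.ne']

variable [MeasurableSpace E]

theorem measurable_acceptance {f : E → ℝ} (hf : Measurable f) :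
    Measurable (Function.uncurry (acceptance f)) := by
  unfold acceptance Function.uncurry
  fun_prop

theorem lintegral_acceptance_le_one (f : E → ℝ) {Q : Kernel E E} (hQ : ∀ x, Q x Set.univ ≤ 1)
    (x : E) : ∫⁻ y, acceptance f x y ∂(Q x) ≤ 1 :=
  calc ∫⁻ y, acceptance f x y ∂(Q x) ≤ ∫⁻ _, 1 ∂(Q x) :=
        lintegral_mono fun y => acceptance_le_one f x y
    _ ≤ 1 := by simpa using hQ x

theorem metropolis_eq (f : E → ℝ) (Q : E → Measure E) (x : E) :
    metropolis f Q x = (Q x).withDensity (acceptance f x) +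
      (1 - ∫⁻ y, acceptance f x y ∂(Q x)) • Measure.dirac x := rfl

theorem lintegral_metropolis {f : E → ℝ} (hf : Measurable f) (Q : E → Measure E) (x : E)
    {g : E → ℝ≥0∞} (hg : Measurable g) :
    ∫⁻ y, g y ∂(metropolis f Q x) = ∫⁻ y, acceptance f x y * g y ∂(Q x) +
      (1 - ∫⁻ y, acceptance f x y ∂(Q x)) * g x := by
  have hα : Measurable (acceptance f x) := (measurable_acceptance hf).comp measurable_prodMk_left
  rw [metropolis_eq, lintegral_add_measure, lintegral_smul_measure, lintegral_dirac' _ hg,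
    lintegral_withDensity_eq_lintegral_mul _ hα hg]
  simp

/-- The Metropolis–Hastings law as a kernel. -/
noncomputable def metropolisKernel {f : E → ℝ} (hf : Measurable f) (Q : Kernel E E)
    [IsSFiniteKernel Q] : Kernel E E where
  toFun := metropolis f Q
  measurable' := by
    have hm : Measurable fun x => ∫⁻ y, acceptance f x y ∂(Q x) :=
      (measurable_acceptance hf).lintegral_kernel_prod_right
    refine Measure.measurable_of_measurable_coe _ fun s hs => ?_
    have : ∀ x, metropolis f Q x s = ∫⁻ y in s, acceptance f x y ∂(Q x) +
        (1 - ∫⁻ y, acceptance f x y ∂(Q x)) * s.indicator 1 x := by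
      intro x
      rw [metropolis_eq, Measure.add_apply, withDensity_apply _ hs, Measure.smul_apply,
        Measure.dirac_apply' _ hs, smul_eq_mul]
    simp only [this]
    exact ((measurable_acceptance hf).setLIntegral_kernel_prod_right hs).add
      ((measurable_const.sub hm).mul (measurable_one.indicator hs))

variable {f : E → ℝ}

theorem isMarkovKernel_metropolisKernel (hf : Measurable f) (Q : Kernel E E) [IsSFiniteKernel Q]
    (hQ : ∀ x, Q x Set.univ ≤ 1) : IsMarkovKernel (metropolisKernel hf Q) := by
  refine ⟨fun x => ⟨?_⟩⟩
  show metropolis f Q x Set.univ = 1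
  rw [metropolis_eq, Measure.add_apply, withDensity_apply _ MeasurableSet.univ, Measure.smul_apply]
  simp only [Measure.restrict_univ, measure_univ, smul_eq_mul, mul_one]
  exact add_tsub_cancel_of_le (lintegral_acceptance_le_one f hQ x)

theorem lintegral_compProd_metropolisKernel (hf : Measurable f) (Q : Kernel E E) [IsSFiniteKernel Q]
    (hQ : ∀ x, Q x Set.univ ≤ 1) (m : Measure E) [SFinite m]
    {g : E × E → ℝ≥0∞} (hg : Measurable g) :
    ∫⁻ z, g z ∂(m ⊗ₘ metropolisKernel hf Q) =
      ∫⁻ x, ∫⁻ y, acceptance f x y * g (x, y) ∂(Q x) ∂m +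
        ∫⁻ x, (1 - ∫⁻ y, acceptance f x y ∂(Q x)) * g (x, x) ∂m := by
  have := isMarkovKernel_metropolisKernel hf Q hQ
  rw [Measure.lintegral_compProd hg, ← lintegral_add_left]
  · exact lintegral_congr fun x =>
      lintegral_metropolis hf Q x (hg.comp measurable_prodMk_left)
  · exact Measurable.lintegral_kernel_prod_right
      (f := fun x y => acceptance f x y * g (x, y)) ((measurable_acceptance hf).mul hg)

/-- The accepted part of the joint law has the density `min (f x) (f y)` with respect to
`ν(dx) Q(x,dy)`. -/
theorem lintegral_acceptance_withDensity (hf : Measurable f) (hf0 : ∀ x, 0 ≤ f x)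
    (Q : Kernel E E) [IsSFiniteKernel Q]
    (ν : Measure E) {g : E × E → ℝ≥0∞} (hg : Measurable g) :
    ∫⁻ x, ∫⁻ y, acceptance f x y * g (x, y) ∂(Q x)
        ∂(ν.withDensity fun x => ENNReal.ofReal (f x)) =
      ∫⁻ x, ∫⁻ y, ENNReal.ofReal (min (f x) (f y)) * g (x, y) ∂(Q x) ∂ν := by
  rw [lintegral_withDensity_eq_lintegral_mul _ (by fun_prop)]
  · refine lintegral_congr fun x => ?_
    rw [Pi.mul_apply, ← lintegral_const_mul]
    · simp only [← mul_assoc, ofReal_mul_acceptance hf0]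
    · exact ((measurable_acceptance hf).comp measurable_prodMk_left).mul
        (hg.comp measurable_prodMk_left)
  · exact Measurable.lintegral_kernel_prod_right
      (f := fun x y => acceptance f x y * g (x, y)) ((measurable_acceptance hf).mul hg)

theorem metropolisKernel_reversible (hf : Measurable f) (hf0 : ∀ x, 0 ≤ f x)
    (Q : Kernel E E) [IsSFiniteKernel Q]
    (hQ : ∀ x, Q x Set.univ ≤ 1) {ν : Measure E}
    (hrev : ∀ g : E × E → ℝ≥0∞, Measurable g →
      ∫⁻ x, ∫⁻ y, g (x, y) ∂(Q x) ∂ν = ∫⁻ x, ∫⁻ y, g (y, x) ∂(Q x) ∂ν)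
    {m : Measure E} [SFinite m] (hm : m = ν.withDensity fun x => ENNReal.ofReal (f x)) :
    (m ⊗ₘ metropolisKernel hf Q).map Prod.swap = m ⊗ₘ metropolisKernel hf Q := by
  refine Measure.ext_of_lintegral _ fun g hg => ?_
  rw [lintegral_map hg measurable_swap,
    lintegral_compProd_metropolisKernel hf Q hQ m (g := fun z => g z.swap)
      (hg.comp measurable_swap),
    lintegral_compProd_metropolisKernel hf Q hQ m hg]
  congr 1
  rw [hm, lintegral_acceptance_withDensity hf hf0 Q ν (g := fun z => g z.swap)
      (hg.comp measurable_swap),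
    lintegral_acceptance_withDensity hf hf0 Q ν hg,
    hrev (fun z => ENNReal.ofReal (min (f z.1) (f z.2)) * g z)
      (Measurable.mul (by fun_prop) hg)]
  simp [min_comm]

/-- A minorization `Q ≥ c Q₀` of the proposals transfers the spectral gap of the
Metropolis–Hastings chain. -/
theorem hasSpectralGap_metropolis_of_smul_le (hf : Measurable f)
    (hf0 : ∀ x, 0 ≤ f x) (Q₀ Q : Kernel E E)
    [IsSFiniteKernel Q₀] [IsSFiniteKernel Q]
    (hQ₀ : ∀ x, Q₀ x Set.univ ≤ 1) (hQ : ∀ x, Q x Set.univ ≤ 1) {ν : Measure E}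
    (hrev₀ : ∀ g : E × E → ℝ≥0∞, Measurable g →
      ∫⁻ x, ∫⁻ y, g (x, y) ∂(Q₀ x) ∂ν = ∫⁻ x, ∫⁻ y, g (y, x) ∂(Q₀ x) ∂ν)
    (hrev : ∀ g : E × E → ℝ≥0∞, Measurable g →
      ∫⁻ x, ∫⁻ y, g (x, y) ∂(Q x) ∂ν = ∫⁻ x, ∫⁻ y, g (y, x) ∂(Q x) ∂ν)
    {m : Measure E} [IsProbabilityMeasure m]
    (hm : m = ν.withDensity fun x => ENNReal.ofReal (f x))
    {c : ℝ} (hc : 0 < c) (hle : ∀ x, ENNReal.ofReal c • Q₀ x ≤ Q x)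
    {A : Set E} (hA : MeasurableSet A) (hA0 : 0 < m.real A) (hA1 : m.real A < 1 / 2)
    (hgap : HasSpectralGap (metropolis f Q₀) m) : HasSpectralGap (metropolis f Q) m := by
  have := isMarkovKernel_metropolisKernel hf Q₀ hQ₀
  have := isMarkovKernel_metropolisKernel hf Q hQ
  refine hasSpectralGap_of_dirichlet_le (κ₀ := metropolisKernel hf Q₀) (κ := metropolisKernel hf Q)
    (fun _ => rfl) (fun _ => rfl) (metropolisKernel_reversible hf hf0 Q₀ hQ₀ hrev₀ hm)
    (metropolisKernel_reversible hf hf0 Q hQ hrev hm) hc (fun h hh => ?_) hA hA0 hA1 hgap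
  have hg : Measurable fun z : E × E => ENNReal.ofReal ((h z.1 - h z.2) ^ 2) := by fun_prop
  -- the diagonal part of the kernel does not contribute
  rw [lintegral_compProd_metropolisKernel hf Q₀ hQ₀ m hg,
    lintegral_compProd_metropolisKernel hf Q hQ m hg]
  simp only [sub_self, ne_eq, OfNat.ofNat_ne_zero, not_false_eq_true, zero_pow,
    ENNReal.ofReal_zero, mul_zero, lintegral_zero, add_zero]
  rw [← lintegral_const_mul]
  · refine lintegral_mono fun x => ?_
    rw [← smul_eq_mul, ← lintegral_smul_measure]
    exact lintegral_mono' (hle x) le_rfl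
  · exact Measurable.lintegral_kernel_prod_right
      (f := fun x y => acceptance f x y * ENNReal.ofReal ((h x - h y) ^ 2))
      ((measurable_acceptance hf).mul hg)

end Metropolis

section Atoms

theorem exists_measurableSet_measure_lt_half {E : Type*} [MeasurableSpace E] [TopologicalSpace E]
    [OpensMeasurableSpace E] [SecondCountableTopology E] [TopologicalSpace.PseudoMetrizableSpace E]
    [T1Space E] (m : Measure E) [IsProbabilityMeasure m] [NullSingletonClass m] :
    ∃ A, MeasurableSet A ∧ 0 < m.real A ∧ m.real A < 1 / 2 := by
  let _ := TopologicalSpace.pseudoMetrizableSpacePseudoMetric E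
  have huniv : m Set.univ ≠ 0 := by simp
  obtain ⟨x, -, hx⟩ := exists_mem_forall_mem_nhdsWithin_pos_measure huniv
  -- shrinking balls around a point of the support
  have ht : Filter.Tendsto (fun n : ℕ => m (Metric.ball x (1 / ((n : ℝ) + 1)))) Filter.atTop
      (nhds (m (⋂ n : ℕ, Metric.ball x (1 / ((n : ℝ) + 1))))) := by
    refine tendsto_measure_iInter_atTop
      (fun n => Metric.isOpen_ball.measurableSet.nullMeasurableSet)
      (fun a b hab => Metric.ball_subset_ball (Nat.one_div_le_one_div hab)) ⟨0, measure_ne_top _ _⟩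
  have hinter : (⋂ n : ℕ, Metric.ball x (1 / ((n : ℝ) + 1))) = {x} := by
    ext y
    simp only [Set.mem_iInter, Metric.mem_ball, Set.mem_singleton_iff]
    constructor
    · intro h
      have h0 : dist y x ≤ 0 := by
        by_contra! hpos
        obtain ⟨n, hn⟩ := exists_nat_one_div_lt hpos
        exact absurd (h n) (not_lt.2 hn.le)
      have := Metric.inseparable_iff.2 (le_antisymm h0 dist_nonneg)
      exact this.eq
    · rintro rfl n
      rw [dist_self]; positivity
  rw [hinter, measure_singleton] at ht
  obtain ⟨n, hn⟩ := (ht.eventually (gt_mem_nhds (show (0 : ℝ≥0∞) < 1 / 2 by simp))).exists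
  refine ⟨_, (Metric.isOpen_ball (x := x) (ε := 1 / ((n : ℝ) + 1))).measurableSet, ?_, ?_⟩
  · refine ENNReal.toReal_pos (hx _ ?_).ne' (measure_ne_top _ _)
    rw [nhdsWithin_univ]
    exact Metric.ball_mem_nhds x (by positivity)
  · have := ENNReal.toReal_strict_mono (by simp) hn
    simpa [Measure.real] using this

end Atoms

/-! ### Determinants of linear maps on spaces of matrices -/

section Determinants

/-- A multiplicative function on matrices is a power of the determinant as soon as it is so on
diagonal matrices: transvections are killed because `t(2c) = t(c)²` is conjugate to `t(c)`. -/
theorem monoidHom_eq_det_pow {q : ℕ} (δ : Mat q q →* ℝ) (k : ℕ)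
    (hdiag : ∀ d : Fin q → ℝ, δ (diagonal d) = (∏ i, d i) ^ k) (A : Mat q q) :
    δ A = A.det ^ k := by
  refine diagonal_transvection_induction (fun A => δ A = A.det ^ k) A ?_ ?_ ?_
  · intro D _
    rw [hdiag, det_diagonal]
  · rintro ⟨i, j, hij, c⟩
    simp only [TransvectionStruct.toMatrix_mk, det_transvection_of_ne i j hij, one_pow]
    set d : Fin q → ℝ := Function.update 1 i 2 with hd
    have hdi : d i = 2 := by simp [hd]
    have hdj : d j = 1 := by simp [hd, hij.symm]
    have hconj : diagonal d * transvection i j c = transvection i j (c + c) * diagonal d := by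
      simp only [transvection, Matrix.mul_add, Matrix.add_mul, Matrix.mul_one, Matrix.one_mul]
      congr 1
      ext a b
      rw [diagonal_mul, mul_diagonal, Matrix.single_apply, Matrix.single_apply]
      split_ifs with h
      · rw [← h.1, ← h.2, hdi, hdj]; ring
      · simp
    have hd0 : δ (diagonal d) ≠ 0 := by
      rw [hdiag]
      refine pow_ne_zero _ (Finset.prod_ne_zero_iff.2 fun a _ => ?_)
      by_cases ha : a = i
      · rw [ha, hdi]; norm_num
      · simp [hd, ha]
    have h1 := congrArg δ hconj
    rw [← transvection_mul_transvection_same i j hij, map_mul, map_mul, map_mul, mul_comm] at h1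
    have h2 := mul_right_cancel₀ hd0 h1
    have h3 : δ (transvection i j c) ≠ 0 := by
      intro h0
      have h4 : δ (transvection i j c * transvection i j (-c)) = 1 := by
        rw [transvection_mul_transvection_same i j hij, add_neg_cancel, transvection_zero, map_one]
      rw [map_mul, h0, zero_mul] at h4
      exact zero_ne_one h4
    exact (mul_right_cancel₀ h3 (by rw [one_mul]; exact h2)).symm
  · intro A B hA hB
    rw [map_mul, hA, hB, det_mul, mul_pow]

theorem linearMap_det_of_apply_basis {ι M : Type*} [Fintype ι] [DecidableEq ι] [AddCommGroup M]
    [Module ℝ M] (b : Module.Basis ι ℝ M) (L : M →ₗ[ℝ] M) (d : ι → ℝ)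
    (h : ∀ i, L (b i) = d i • b i) : LinearMap.det L = ∏ i, d i := by
  rw [← LinearMap.det_toMatrix b, ← det_diagonal]
  congr 1
  ext i j
  rw [LinearMap.toMatrix_apply, h, map_smul, Finsupp.smul_apply, b.repr_self, diagonal_apply]
  by_cases hij : i = j
  · simp [hij]
  · simp [hij]

variable {p q : ℕ}

/-- `X ↦ A X` on `M(p,q)`, as a multiplicative function of `A`. -/
noncomputable def leftMul (p q : ℕ) : Mat p p →* (Mat p q →ₗ[ℝ] Mat p q) where
  toFun A :=
    { toFun := fun X => A * X
      map_add' := fun X Y => Matrix.mul_add A X Y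
      map_smul' := fun c X => Matrix.mul_smul A c X }
  map_one' := by ext1 X; exact Matrix.one_mul X
  map_mul' A B := by ext1 X; exact Matrix.mul_assoc A B X

/-- `X ↦ X Bᵀ` on `M(p,q)`, as a multiplicative function of `B`. -/
noncomputable def rightMul (p q : ℕ) : Mat q q →* (Mat p q →ₗ[ℝ] Mat p q) where
  toFun B :=
    { toFun := fun X => X * Bᵀ
      map_add' := fun X Y => Matrix.add_mul X Y Bᵀ
      map_smul' := fun c X => Matrix.smul_mul c X Bᵀ }
  map_one' := by ext1 X; simp
  map_mul' A B := by ext1 X; simp [Matrix.mul_assoc]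

@[simp] theorem leftMul_apply (A : Mat p p) (X : Mat p q) : leftMul p q A X = A * X := rfl

@[simp] theorem rightMul_apply (B : Mat q q) (X : Mat p q) : rightMul p q B X = X * Bᵀ := rfl

theorem det_leftMul (A : Mat p p) : LinearMap.det (leftMul p q A) = A.det ^ q := by
  refine monoidHom_eq_det_pow ((LinearMap.det (M := Mat p q)).comp (leftMul p q)) q (fun d => ?_) A
  rw [MonoidHom.comp_apply, linearMap_det_of_apply_basis (Matrix.stdBasis ℝ (Fin p) (Fin q)) _
    (fun ij => d ij.1)]
  · rw [Fintype.prod_prod_type, ← Finset.prod_pow]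
    simp
  · rintro ⟨i, j⟩
    ext a b
    simp only [Matrix.stdBasis_eq_single, leftMul_apply, diagonal_mul, Matrix.smul_apply,
      smul_eq_mul, Matrix.single_apply]
    split_ifs with h
    · rw [h.1]
    · simp

theorem det_rightMul (B : Mat q q) : LinearMap.det (rightMul p q B) = B.det ^ p := by
  refine monoidHom_eq_det_pow ((LinearMap.det (M := Mat p q)).comp (rightMul p q)) p (fun d => ?_) B
  rw [MonoidHom.comp_apply, linearMap_det_of_apply_basis (Matrix.stdBasis ℝ (Fin p) (Fin q)) _
    (fun ij => d ij.2)]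
  · rw [Fintype.prod_prod_type]
    simp
  · rintro ⟨i, j⟩
    ext a b
    simp only [Matrix.stdBasis_eq_single, rightMul_apply, diagonal_transpose, mul_diagonal,
      Matrix.smul_apply, smul_eq_mul, Matrix.single_apply]
    split_ifs with h
    · rw [h.2]; ring
    · simp

/-- The index set of the entries on and above the diagonal. -/
abbrev Upper (q : ℕ) : Type := {ij : Fin q × Fin q // ij.1 ≤ ij.2}

/-- The entries on and above the diagonal. -/
def upperOf {q : ℕ} (X : Mat q q) : Upper q → ℝ := fun ij => X ij.1.1 ij.1.2

theorem upperOf_symOfUpper (v : Upper q → ℝ) : upperOf (symOfUpper v) = v := by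
  funext ⟨⟨i, j⟩, hij⟩
  simp only [upperOf, symOfUpper]
  congr 1
  simp only [Subtype.mk.injEq, Prod.mk.injEq]
  exact ⟨min_eq_left hij, max_eq_right hij⟩

theorem symOfUpper_upperOf {X : Mat q q} (hX : Xᵀ = X) : symOfUpper (upperOf X) = X := by
  ext i j
  simp only [upperOf, symOfUpper]
  rcases le_total i j with h | h
  · rw [min_eq_left h, max_eq_right h]
  · rw [min_eq_right h, max_eq_left h, ← transpose_apply X, hX]

theorem transpose_symOfUpper (v : Upper q → ℝ) : (symOfUpper v)ᵀ = symOfUpper v := by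
  ext i j
  simp only [symOfUpper, transpose_apply, min_comm, max_comm]

/-- `X ↦ A X Aᵀ` on symmetric matrices, in the coordinates on and above the diagonal. -/
noncomputable def congrUpper (q : ℕ) : Mat q q →* ((Upper q → ℝ) →ₗ[ℝ] (Upper q → ℝ)) where
  toFun A :=
    { toFun := fun v => upperOf (A * symOfUpper v * Aᵀ)
      map_add' := fun v w => by
        have : symOfUpper (v + w) = symOfUpper v + symOfUpper w := rfl
        rw [this, Matrix.mul_add, Matrix.add_mul]; rfl
      map_smul' := fun c v => by
        have : symOfUpper (c • v) = c • symOfUpper v := rfl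
        rw [this, Matrix.mul_smul, Matrix.smul_mul]; rfl }
  map_one' := by
    refine LinearMap.ext fun v => ?_
    simp only [LinearMap.coe_mk, AddHom.coe_mk, transpose_one, Matrix.one_mul, Matrix.mul_one]
    exact upperOf_symOfUpper v
  map_mul' A B := by
    refine LinearMap.ext fun v => ?_
    simp only [LinearMap.coe_mk, AddHom.coe_mk, Module.End.mul_apply]
    rw [symOfUpper_upperOf]
    · simp only [transpose_mul, Matrix.mul_assoc]
    · simp only [transpose_mul, transpose_transpose, transpose_symOfUpper, Matrix.mul_assoc]

theorem symOfUpper_congrUpper (A : Mat q q) (v : Upper q → ℝ) :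
    symOfUpper (congrUpper q A v) = A * symOfUpper v * Aᵀ := by
  have h : (A * symOfUpper v * Aᵀ)ᵀ = A * symOfUpper v * Aᵀ := by
    simp only [transpose_mul, transpose_transpose, transpose_symOfUpper, Matrix.mul_assoc]
  exact symOfUpper_upperOf h

theorem prod_upper_mul (d : Fin q → ℝ) :
    ∏ ij : Upper q, (d ij.1.1 * d ij.1.2) = (∏ i, d i) ^ (q + 1) := by
  have h1 : ∀ f : Fin q × Fin q → ℝ, ∏ ij : Upper q, f ij.1 =
      ∏ i, ∏ j, if i ≤ j then f (i, j) else 1 := by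
    intro f
    rw [← Finset.prod_subtype (Finset.univ.filter fun ij : Fin q × Fin q => ij.1 ≤ ij.2)
      (by simp) f,
      Finset.prod_filter, Fintype.prod_prod_type]
  rw [Finset.prod_mul_distrib, h1 fun ij => d ij.1, h1 fun ij => d ij.2]
  have h2 : (∏ i, ∏ j, if i ≤ j then d j else 1) = ∏ i, ∏ j, if j ≤ i then d i else 1 :=
    Finset.prod_comm
  rw [h2, ← Finset.prod_mul_distrib, ← Finset.prod_pow]
  refine Finset.prod_congr rfl fun i _ => ?_
  rw [← Finset.prod_mul_distrib, pow_succ]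
  have h3 : ∀ j, ((if i ≤ j then d i else 1) * if j ≤ i then d i else 1) =
      d i * if i = j then d i else 1 := by
    intro j
    rcases lt_trichotomy i j with h | h | h
    · simp [h.le, h.not_ge, h.ne]
    · simp [h]
    · simp [h.le, h.not_ge, h.ne']
  simp only [h3, Finset.prod_mul_distrib, Finset.prod_ite_eq]
  simp

theorem det_congrUpper (A : Mat q q) : LinearMap.det (congrUpper q A) = A.det ^ (q + 1) := by
  refine monoidHom_eq_det_pow ((LinearMap.det (M := Upper q → ℝ)).comp (congrUpper q)) (q + 1)
    (fun d => ?_) A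
  rw [MonoidHom.comp_apply, linearMap_det_of_apply_basis (Pi.basisFun ℝ (Upper q)) _
    (fun ij => d ij.1.1 * d ij.1.2), prod_upper_mul]
  intro ij
  funext ab
  show (diagonal d * symOfUpper (Pi.basisFun ℝ (Upper q) ij) * (diagonal d)ᵀ : Mat q q)
    ab.1.1 ab.1.2 = _
  rw [diagonal_transpose, mul_diagonal, diagonal_mul]
  have h := congrFun (upperOf_symOfUpper (Pi.basisFun ℝ (Upper q) ij)) ab
  simp only [upperOf] at h
  rw [h, Pi.smul_apply, Pi.basisFun_apply, Pi.single_apply, smul_eq_mul]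
  split_ifs with h
  · rw [h]; ring
  · simp

end Determinants

/-! ### Lebesgue measure on matrices -/

section Measurability

variable {p q : ℕ}

instance instBorelSpaceMat : BorelSpace (Mat p q) :=
  inferInstanceAs (BorelSpace (Fin p → Fin q → ℝ))

instance instPolishSpaceMat : PolishSpace (Mat p q) :=
  inferInstanceAs (PolishSpace (Fin p → Fin q → ℝ))

theorem isAddHaarMeasure_volume_pi_pi (p q : ℕ) :
    (volume : Measure (Fin p → Fin q → ℝ)).IsAddHaarMeasure :=
  Measure.pi.isAddHaarMeasure (fun _ : Fin p => (volume : Measure (Fin q → ℝ)))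

instance instIsAddHaarMeasureLeb : (leb p q).IsAddHaarMeasure := isAddHaarMeasure_volume_pi_pi p q

instance instSigmaFiniteLeb : SigmaFinite (leb p q) :=
  inferInstanceAs (SigmaFinite (volume : Measure (Fin p → Fin q → ℝ)))

theorem measurable_inv_mat : Measurable fun A : Mat q q => A⁻¹ := by
  have h : (fun A : Mat q q => A⁻¹) = fun A => (A.det)⁻¹ • A.adjugate := by
    funext A
    rw [Matrix.inv_def, Ring.inverse_eq_inv']
  rw [h]
  exact (Continuous.matrix_det continuous_id).measurable.inv.smul
    (Continuous.matrix_adjugate continuous_id).measurable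

theorem measurableSet_posDef : MeasurableSet {S : Mat q q | S.PosDef} := by
  have h : {S : Mat q q | S.PosDef} = ({S | Sᵀ = S} ∩ ⋂ v : Fin q → ℝ, {S | 0 ≤ v ⬝ᵥ (S *ᵥ v)}) ∩
      {S | S.det ≠ 0} := by
    ext S
    simp only [Set.mem_ofPred_eq, Set.mem_inter_iff, Set.mem_iInter]
    constructor
    · intro hS
      exact ⟨⟨hS.1, fun v => by simpa using hS.posSemidef.dotProduct_mulVec_nonneg v⟩,
        hS.det_pos.ne'⟩
    · rintro ⟨⟨h1, h2⟩, h3⟩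
      have : S.PosSemidef := Matrix.PosSemidef.of_dotProduct_mulVec_nonneg h1 (by simpa using h2)
      exact (this.posDef_iff_det_ne_zero).2 h3
  rw [h]
  refine ((IsClosed.inter ?_ (isClosed_iInter fun v => ?_)).measurableSet).inter ?_
  · exact isClosed_eq (Continuous.matrix_transpose continuous_id) continuous_id
  · exact isClosed_le continuous_const
      (continuous_const.dotProduct (continuous_id.matrix_mulVec continuous_const))
  · exact (isOpen_ne_fun (Continuous.matrix_det continuous_id) continuous_const).measurableSet

theorem measurableEmbedding_posMat : MeasurableEmbedding (Subtype.val : PosMat q → Mat q q) :=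
  MeasurableEmbedding.subtype_coe measurableSet_posDef

theorem continuous_symOfUpper : Continuous (symOfUpper : (Upper q → ℝ) → Mat q q) :=
  continuous_pi fun _ => continuous_pi fun _ => continuous_apply _

theorem measurable_symOfUpper : Measurable (symOfUpper : (Upper q → ℝ) → Mat q q) :=
  continuous_symOfUpper.measurable

end Measurability

section Lebesgue

variable {p q : ℕ}

theorem lintegral_leb_linearMap {L : Mat p q →ₗ[ℝ] Mat p q} (hL : LinearMap.det L ≠ 0)
    {F : Mat p q → ℝ≥0∞} (hF : Measurable F) :
    ENNReal.ofReal |LinearMap.det L| * ∫⁻ x, F (L x) ∂(leb p q) = ∫⁻ x, F x ∂(leb p q) := by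
  -- the underlying linear map on `Fin p → Fin q → ℝ`
  set e : (Fin p → Fin q → ℝ) ≃ₗ[ℝ] Mat p q := Matrix.ofLinearEquiv ℝ with he
  set L' : (Fin p → Fin q → ℝ) →ₗ[ℝ] (Fin p → Fin q → ℝ) :=
    (e.symm : Mat p q →ₗ[ℝ] (Fin p → Fin q → ℝ)) ∘ₗ L ∘ₗ
      (e : (Fin p → Fin q → ℝ) →ₗ[ℝ] Mat p q) with hL'
  have hdet : LinearMap.det L' = LinearMap.det L := LinearMap.det_conj L e.symm
  have hmeas : Measurable L := (LinearMap.continuous_of_finiteDimensional L').measurable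
  have h : (leb p q).map L = ENNReal.ofReal |(LinearMap.det L)⁻¹| • leb p q := by
    rw [← hdet]
    exact Measure.map_linearMap_addHaar_eq_smul_addHaar (E := Fin p → Fin q → ℝ) volume
      (f := L') (by rwa [hdet])
  rw [← lintegral_map hF hmeas, h, lintegral_smul_measure, smul_eq_mul, ← mul_assoc,
    ← ENNReal.ofReal_mul (abs_nonneg _), ← abs_mul, mul_inv_cancel₀ hL]
  simp

theorem lintegral_leb_mul_left {A : Mat p p} (hA : A.det ≠ 0) {F : Mat p q → ℝ≥0∞}
    (hF : Measurable F) :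
    ENNReal.ofReal (|A.det| ^ q) * ∫⁻ x, F (A * x) ∂(leb p q) = ∫⁻ x, F x ∂(leb p q) := by
  have h := det_leftMul (q := q) A
  have := lintegral_leb_linearMap (L := leftMul p q A) (by rw [h]; exact pow_ne_zero _ hA) hF
  rwa [h, abs_pow] at this

theorem lintegral_leb_mul_right {B : Mat q q} (hB : B.det ≠ 0) {F : Mat p q → ℝ≥0∞}
    (hF : Measurable F) :
    ENNReal.ofReal (|B.det| ^ p) * ∫⁻ x, F (x * B) ∂(leb p q) = ∫⁻ x, F x ∂(leb p q) := by
  have h := det_rightMul (p := p) Bᵀ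
  rw [det_transpose] at h
  have := lintegral_leb_linearMap (L := rightMul p q Bᵀ) (by rw [h]; exact pow_ne_zero _ hB) hF
  rw [h, abs_pow] at this
  simpa using this

/-- Matrices with linearly dependent columns are negligible: along each line `x + t · frame` the
leading minor is a characteristic polynomial, hence has finitely many zeros. -/
theorem ae_det_gram_ne_zero (hpq : q ≤ p) : ∀ᵐ x ∂(leb p q), (xᵀ * x).det ≠ 0 := by
  set top : Mat p q → Mat q q := fun x => x.submatrix (Fin.castLE hpq) id with htop
  have htopc : Continuous top := continuous_id.matrix_submatrix _ _
  set Z : Set (Mat p q) := {x | (top x).det = 0} with hZ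
  have hZm : MeasurableSet Z := (isClosed_eq htopc.matrix_det continuous_const).measurableSet
  have hframe : ∀ (x : Mat p q) (t : ℝ),
      top (x + t • frame p q) = -(scalar (Fin q) (-t) - top x) := by
    intro x t
    ext i j
    simp [htop, frame, Fin.ext_iff, diagonal_apply]
    split_ifs <;> simp
  have hnull : leb p q Z = 0 := by
    have h1 : ∫⁻ _ : ℝ, leb p q Z = 0 := by
      calc ∫⁻ _ : ℝ, leb p q Z
          = ∫⁻ t : ℝ, ∫⁻ x : Mat p q, Z.indicator 1 (x + t • frame p q) ∂(leb p q) := by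
            refine lintegral_congr fun t => ?_
            rw [lintegral_add_right_eq_self (μ := leb p q) (fun y => Z.indicator 1 y),
              lintegral_indicator_one hZm]
        _ = ∫⁻ x : Mat p q, (∫⁻ t : ℝ, Z.indicator 1 (x + t • frame p q)) ∂(leb p q) := by
            refine lintegral_lintegral_swap (Measurable.aemeasurable ?_)
            refine (measurable_one.indicator hZm).comp ?_
            exact Continuous.measurable (by fun_prop)
        _ = ∫⁻ x, 0 ∂(leb p q) := by
            refine lintegral_congr fun x => ?_
            have hm : Measurable fun t : ℝ =>
                Z.indicator (1 : Mat p q → ℝ≥0∞) (x + t • frame p q) :=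
              (measurable_one.indicator hZm).comp (Continuous.measurable (by fun_prop))
            rw [lintegral_eq_zero_iff hm]
            have hfin : {t : ℝ | (scalar (Fin q) (-t) - top x).det = 0}.Finite := by
              refine (((top x).charpoly.roots.toFinset.finite_toSet).preimage
                neg_injective.injOn).subset fun t ht => ?_
              simp only [Set.mem_preimage, Finset.mem_coe, Multiset.mem_toFinset]
              rw [Polynomial.mem_roots (charpoly_monic _).ne_zero, Polynomial.IsRoot,
                Matrix.eval_charpoly]
              exact ht
            have := hfin.measure_zero (volume : Measure ℝ)
            filter_upwards [compl_mem_ae_iff.2 this] with t ht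
            have : x + t • frame p q ∉ Z := by
              intro hmem
              have hmem' : (top (x + t • frame p q)).det = 0 := hmem
              rw [hframe, det_neg] at hmem'
              exact ht ((mul_eq_zero.1 hmem').resolve_left (pow_ne_zero _ (by norm_num)))
            simp [this]
        _ = 0 := by simp
    rw [lintegral_const] at h1
    simpa using h1
  filter_upwards [compl_mem_ae_iff.2 hnull] with x hx hdet
  refine hx ?_
  obtain ⟨v, hv, hxv⟩ := exists_mulVec_eq_zero_iff.2 hdet
  have h0 : x *ᵥ v = 0 := (conjTranspose_mul_self_mulVec_eq_zero x v).1 (by simpa using hxv)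
  refine exists_mulVec_eq_zero_iff.1 ⟨v, hv, ?_⟩
  ext i
  exact congrFun h0 (Fin.castLE hpq i)

/-- The total mass of the Gaussian weight on `M(p,q)`. -/
theorem lintegral_gaussian_leb (p q : ℕ) :
    ∫⁻ x, ENNReal.ofReal (Real.exp (-(xᵀ * x).trace / 2)) ∂(leb p q) =
      ENNReal.ofReal ((2 * Real.pi) ^ ((p : ℝ) * q / 2)) := by
  have hg : Integrable (fun t : ℝ => Real.exp (-(1 / 2) * t ^ 2)) :=
    integrable_exp_neg_mul_sq (by norm_num)
  have hprod : ∀ x : Mat p q, Real.exp (-(xᵀ * x).trace / 2) =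
      ∏ i, ∏ j, Real.exp (-(1 / 2) * x i j ^ 2) := by
    intro x
    simp only [← Real.exp_sum]
    congr 1
    rw [Matrix.trace, Finset.sum_comm]
    simp only [diag_apply, mul_apply, transpose_apply, neg_div, Finset.sum_div]
    rw [← Finset.sum_neg_distrib]
    refine Finset.sum_congr rfl fun j _ => ?_
    rw [← Finset.sum_neg_distrib]
    refine Finset.sum_congr rfl fun i _ => ?_
    ring
  have hrow : Integrable (fun r : Fin q → ℝ => ∏ j, Real.exp (-(1 / 2) * r j ^ 2)) :=
    Integrable.fintype_prod (f := fun _ t => Real.exp (-(1 / 2) * t ^ 2)) fun _ => hg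
  have hint : Integrable (fun x : Mat p q => ∏ i, ∏ j, Real.exp (-(1 / 2) * x i j ^ 2))
      (leb p q) :=
    Integrable.fintype_prod (f := fun (_ : Fin p) (r : Fin q → ℝ) =>
      ∏ j, Real.exp (-(1 / 2) * r j ^ 2)) fun _ => hrow
  simp only [hprod]
  rw [← ofReal_integral_eq_lintegral_ofReal hint
    (Filter.Eventually.of_forall fun x => Finset.prod_nonneg fun i _ =>
      Finset.prod_nonneg fun j _ => (Real.exp_pos _).le)]
  congr 1
  have h1 : ∫ x, ∏ i, ∏ j, Real.exp (-(1 / 2) * x i j ^ 2) ∂(leb p q) =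
      ∏ _i : Fin p, ∫ r : Fin q → ℝ, ∏ j, Real.exp (-(1 / 2) * r j ^ 2) :=
    integral_fintype_prod_eq_prod (fun (_ : Fin p) (r : Fin q → ℝ) =>
      ∏ j, Real.exp (-(1 / 2) * r j ^ 2))
  rw [h1, integral_fintype_prod_volume_eq_prod (fun (_ : Fin q) (t : ℝ) =>
      Real.exp (-(1 / 2) * t ^ 2)), integral_gaussian]
  simp only [Finset.prod_const, Finset.card_univ, Fintype.card_fin]
  have h2 : Real.pi / (1 / 2) = 2 * Real.pi := by ring
  rw [h2, Real.sqrt_eq_rpow, ← pow_mul, ← Real.rpow_natCast, ← Real.rpow_mul (by positivity)]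
  congr 1
  push_cast
  ring

end Lebesgue

/-! ### The invariant measure on positive-definite matrices -/

section InvariantMeasure

variable {q : ℕ}

open Classical in
/-- A measurable retraction of `M(q,q)` onto `P⁺(q)`. -/
noncomputable def toPosMat (S : Mat q q) : PosMat q :=
  ⟨if S.PosDef then S else 1, by split_ifs with h; exacts [h, PosDef.one]⟩

theorem coe_toPosMat {S : Mat q q} (hS : S.PosDef) : (toPosMat S : Mat q q) = S := by
  simp [toPosMat, hS]

@[simp] theorem toPosMat_coe (S : PosMat q) : toPosMat (S : Mat q q) = S :=
  Subtype.ext (coe_toPosMat S.2)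

theorem measurable_toPosMat : Measurable (toPosMat : Mat q q → PosMat q) :=
  Measurable.subtype_mk (Measurable.ite measurableSet_posDef measurable_id measurable_const)

theorem transpose_posMat (S : PosMat q) : S.1ᵀ = S.1 := by
  have := S.2.1
  rwa [IsHermitian, conjTranspose_eq_transpose_of_trivial] at this

theorem det_posMat_pos (S : PosMat q) : 0 < S.1.det := S.2.det_pos

theorem lintegral_lebPos {F : Mat q q → ℝ≥0∞} (hF : Measurable F) :
    ∫⁻ S, F S.1 ∂(lebPos q) =
      ∫⁻ v, {S : Mat q q | S.PosDef}.indicator F (symOfUpper v) := by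
  have h := lintegral_subtype_comap (measurableSet_posDef (q := q)) F
    (μ := (volume : Measure (Upper q → ℝ)).map symOfUpper)
  rw [← lintegral_indicator measurableSet_posDef,
    lintegral_map (hF.indicator measurableSet_posDef) measurable_symOfUpper] at h
  exact h

instance instSFiniteLebPos : SFinite (lebPos q) := by
  have h : lebPos q = ((volume : Measure (Upper q → ℝ)).restrict
      {v | (symOfUpper v).PosDef}).map fun v => toPosMat (symOfUpper v) := by
    have hm : MeasurableSet {v : Upper q → ℝ | (symOfUpper v).PosDef} :=
      measurable_symOfUpper measurableSet_posDef
    refine Measure.ext_of_lintegral _ fun G hG => ?_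
    have h1 : ∫⁻ S, G S ∂(lebPos q) = ∫⁻ S, (G ∘ toPosMat) S.1 ∂(lebPos q) := by simp
    rw [h1, lintegral_lebPos (hG.comp measurable_toPosMat),
      lintegral_map (g := fun v => toPosMat (symOfUpper v)) hG
        (measurable_toPosMat.comp measurable_symOfUpper), ← lintegral_indicator hm]
    rfl
  rw [h]
  infer_instance

instance instSFiniteMu : SFinite (mu q) := by
  unfold mu; infer_instance

/-- The density of `μ` in the coordinates on and above the diagonal. -/
noncomputable def muDensity (S : Mat q q) : ℝ≥0∞ :=
  {S : Mat q q | S.PosDef}.indicator (fun S => ENNReal.ofReal (S.det ^ (-((q : ℝ) + 1) / 2))) S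

theorem measurable_det : Measurable (det : Mat q q → ℝ) :=
  (Continuous.matrix_det continuous_id).measurable

theorem measurable_muDensity : Measurable (muDensity : Mat q q → ℝ≥0∞) :=
  Measurable.indicator (by have := measurable_det (q := q); fun_prop) measurableSet_posDef

theorem lintegral_mu {F : Mat q q → ℝ≥0∞} (hF : Measurable F) :
    ∫⁻ S, F S.1 ∂(mu q) = ∫⁻ v, muDensity (symOfUpper v) * F (symOfUpper v) := by
  have hd := measurable_det (q := q)
  rw [mu, lintegral_withDensity_eq_lintegral_mul _ (by fun_prop) (by fun_prop)]
  have := lintegral_lebPos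
    (F := fun S => ENNReal.ofReal (S.det ^ (-((q : ℝ) + 1) / 2)) * F S) (by fun_prop)
  simp only [Pi.mul_apply]
  rw [this]
  refine lintegral_congr fun v => ?_
  by_cases h : (symOfUpper v).PosDef <;> simp [muDensity, h]

theorem posDef_congr_iff {A : Mat q q} (hA : A.det ≠ 0) (S : Mat q q) :
    (A * S * Aᵀ).PosDef ↔ S.PosDef := by
  have hu : IsUnit A := (isUnit_iff_isUnit_det A).2 hA.isUnit
  have := hu.posDef_star_right_conjugate_iff (x := S)
  rwa [star_eq_conjTranspose, conjTranspose_eq_transpose_of_trivial] at this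

theorem muDensity_congr {A : Mat q q} (hA : A.det ≠ 0) (S : Mat q q) :
    muDensity S = ENNReal.ofReal (|A.det| ^ (q + 1)) * muDensity (A * S * Aᵀ) := by
  by_cases h : S.PosDef
  · have h' := (posDef_congr_iff hA S).2 h
    have hA' : 0 < |A.det| := abs_pos.2 hA
    simp only [muDensity, Set.indicator_of_mem (s := {S : Mat q q | S.PosDef}) h,
      Set.indicator_of_mem (s := {S : Mat q q | S.PosDef}) h']
    rw [← ENNReal.ofReal_mul (by positivity)]
    congr 1
    rw [det_mul, det_mul, det_transpose, mul_right_comm, ← sq, ← sq_abs,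
      Real.mul_rpow (by positivity) h.det_pos.le, ← mul_assoc, ← Real.rpow_natCast,
      ← Real.rpow_natCast, ← Real.rpow_mul hA'.le, ← Real.rpow_add hA']
    have : ((q + 1 : ℕ) : ℝ) + ((2 : ℕ) : ℝ) * (-((q : ℝ) + 1) / 2) = 0 := by push_cast; ring
    rw [this, Real.rpow_zero, one_mul]
  · have h' : ¬ (A * S * Aᵀ).PosDef := fun h' => h ((posDef_congr_iff hA S).1 h')
    simp [muDensity, h, h']

/-- `μ` is invariant under `S ↦ A S Aᵀ`. -/
theorem lintegral_mu_congr {A : Mat q q} (hA : A.det ≠ 0) {F : Mat q q → ℝ≥0∞}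
    (hF : Measurable F) : ∫⁻ S, F (A * S.1 * Aᵀ) ∂(mu q) = ∫⁻ S, F S.1 ∂(mu q) := by
  have hdet := det_congrUpper A
  have hdet0 : LinearMap.det (congrUpper q A) ≠ 0 := by rw [hdet]; exact pow_ne_zero _ hA
  have hc : Measurable fun S : Mat q q => A * S * Aᵀ := Continuous.measurable (by fun_prop)
  have hL : Measurable (congrUpper q A) :=
    (LinearMap.continuous_of_finiteDimensional _).measurable
  set H : (Upper q → ℝ) → ℝ≥0∞ := fun v => muDensity (symOfUpper v) * F (symOfUpper v) with hH
  have hHm : Measurable H :=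
    (measurable_muDensity.comp measurable_symOfUpper).mul (hF.comp measurable_symOfUpper)
  have hmap := Measure.map_linearMap_addHaar_eq_smul_addHaar
    (volume : Measure (Upper q → ℝ)) hdet0
  rw [lintegral_mu (F := fun S => F (A * S * Aᵀ)) (hF.comp hc), lintegral_mu hF]
  calc ∫⁻ v, muDensity (symOfUpper v) * F (A * symOfUpper v * Aᵀ)
      = ∫⁻ v, ENNReal.ofReal (|A.det| ^ (q + 1)) * H (congrUpper q A v) := by
        refine lintegral_congr fun v => ?_
        rw [hH]
        simp only [symOfUpper_congrUpper]
        rw [muDensity_congr hA, mul_assoc]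
    _ = ENNReal.ofReal (|A.det| ^ (q + 1)) * ∫⁻ v, H v ∂(volume.map (congrUpper q A)) := by
        rw [lintegral_const_mul (f := fun v => H (congrUpper q A v)) _ (hHm.comp hL),
          lintegral_map hHm hL]
    _ = ∫⁻ v, H v := by
        rw [hmap, lintegral_smul_measure, smul_eq_mul, ← mul_assoc,
          ← ENNReal.ofReal_mul (by positivity), hdet, ← abs_pow, ← abs_mul,
          mul_inv_cancel₀ (pow_ne_zero _ hA)]
        simp

open scoped MatrixOrder in
/-- The positive square root used in `circ`. -/
noncomputable def sqrtMat (S : PosMat q) : Mat q q := CFC.sqrt S.1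

open scoped MatrixOrder in
theorem posDef_sqrtMat (S : PosMat q) : (sqrtMat S).PosDef :=
  Matrix.isStrictlyPositive_iff_posDef.1 (Matrix.isStrictlyPositive_iff_posDef.2 S.2).sqrt

theorem transpose_sqrtMat (S : PosMat q) : (sqrtMat S)ᵀ = sqrtMat S :=
  transpose_posMat ⟨sqrtMat S, posDef_sqrtMat S⟩

theorem det_sqrtMat_pos (S : PosMat q) : 0 < (sqrtMat S).det := (posDef_sqrtMat S).det_pos

open scoped MatrixOrder in
theorem sqrtMat_mul_self (S : PosMat q) : sqrtMat S * sqrtMat S = S.1 :=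
  CFC.sqrt_mul_sqrt_self S.1 S.2.posSemidef.nonneg

theorem circ_coe (A B : PosMat q) : (circ A B).1 = sqrtMat B * A.1 * sqrtMat B := rfl

theorem sqrtMat_mul_inv_mul_sqrtMat (S : PosMat q) : sqrtMat S * (S.1)⁻¹ * sqrtMat S = 1 := by
  have hu : IsUnit (sqrtMat S).det := (det_sqrtMat_pos S).ne'.isUnit
  rw [← sqrtMat_mul_self S, Matrix.mul_inv_rev, ← Matrix.mul_assoc, Matrix.mul_nonsing_inv _ hu,
    Matrix.one_mul, Matrix.nonsing_inv_mul _ hu]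

/-- The measure `|det A|^{-q} dA` on `M(q,q)`, a Haar measure of `GL(q)`. -/
noncomputable def haarGL (q : ℕ) : Measure (Mat q q) :=
  (leb q q).withDensity fun A => ENNReal.ofReal ((|A.det| ^ q)⁻¹)

instance instSFiniteHaarGL : SFinite (haarGL q) := by
  unfold haarGL; infer_instance

theorem lintegral_haarGL {F : Mat q q → ℝ≥0∞} (hF : Measurable F) :
    ∫⁻ A, F A ∂(haarGL q) = ∫⁻ A, ENNReal.ofReal ((|A.det| ^ q)⁻¹) * F A ∂(leb q q) := by
  have hd := measurable_det (q := q)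
  rw [haarGL, lintegral_withDensity_eq_lintegral_mul _ (by fun_prop) hF]
  rfl

theorem ae_haarGL_det_ne_zero : ∀ᵐ A ∂(haarGL q), A.det ≠ 0 := by
  have h := ae_det_gram_ne_zero (le_refl q)
  have h' : ∀ᵐ A ∂(leb q q), A.det ≠ 0 := by
    filter_upwards [h] with A hA h0
    simp [h0] at hA
  exact (withDensity_absolutelyContinuous _ _).ae_le h'

theorem lintegral_haarGL_mul_left {B : Mat q q} (hB : B.det ≠ 0) {F : Mat q q → ℝ≥0∞}
    (hF : Measurable F) : ∫⁻ A, F (B * A) ∂(haarGL q) = ∫⁻ A, F A ∂(haarGL q) := by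
  have hd := measurable_det (q := q)
  have hc : Measurable fun A : Mat q q => B * A := Continuous.measurable (by fun_prop)
  have hB' : 0 < |B.det| := abs_pos.2 hB
  rw [lintegral_haarGL hF, lintegral_haarGL (F := fun A => F (B * A)) (hF.comp hc),
    ← lintegral_leb_mul_left hB (F := fun A => ENNReal.ofReal ((|A.det| ^ q)⁻¹) * F A)
      (by fun_prop), ← lintegral_const_mul]
  · refine lintegral_congr fun A => ?_
    rw [← mul_assoc, ← ENNReal.ofReal_mul (by positivity)]
    congr 2
    rw [det_mul, abs_mul, mul_pow, mul_inv, ← mul_assoc, mul_inv_cancel₀ (by positivity), one_mul]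
  · exact Measurable.mul (by fun_prop) (hF.comp hc)

/-- Two ways of integrating `f(Aᵀ S A) G(Aᵀ A)` against `N(dS) dA`. This identity contains both the
uniqueness up to a constant of the invariant measure on `P⁺(q)` and its invariance under
`S ↦ S⁻¹`. -/
theorem lintegral_mul_lintegral_haarGL (N : Measure (PosMat q)) [SFinite N]
    (hN : ∀ A : Mat q q, A.det ≠ 0 → ∀ F : Mat q q → ℝ≥0∞, Measurable F →
      ∫⁻ S, F (A * S.1 * Aᵀ) ∂N = ∫⁻ S, F S.1 ∂N)
    {f G : Mat q q → ℝ≥0∞} (hf : Measurable f) (hG : Measurable G) :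
    (∫⁻ S, f S.1 ∂N) * ∫⁻ A, G (Aᵀ * A) ∂(haarGL q) =
      (∫⁻ S, G (S.1)⁻¹ ∂N) * ∫⁻ A, f (Aᵀ * A) ∂(haarGL q) := by
  have hgram : Measurable fun A : Mat q q => Aᵀ * A := Continuous.measurable (by fun_prop)
  have hinv := measurable_inv_mat (q := q)
  have h3 : Measurable fun z : Mat q q × Mat q q => z.1ᵀ * z.2 * z.1 :=
    Continuous.measurable (by fun_prop)
  have hp : Measurable fun z : Mat q q × PosMat q => (z.1, z.2.1) := by fun_prop
  have hpinv : Measurable fun z : Mat q q × PosMat q => (z.1, (z.2.1)⁻¹) :=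
    measurable_fst.prodMk (hinv.comp (measurable_subtype_coe.comp measurable_snd))
  have h3S := h3.comp hp
  have h3Sinv := h3.comp hpinv
  have hS : Measurable fun z : Mat q q × PosMat q => f (z.1ᵀ * z.2.1 * z.1) := hf.comp h3S
  have hSinv : Measurable fun z : Mat q q × PosMat q => G (z.1ᵀ * (z.2.1)⁻¹ * z.1) := hG.comp h3Sinv
  have hfg : Measurable fun A : Mat q q => f (Aᵀ * A) := hf.comp hgram
  have hGg : Measurable fun A : Mat q q => G (Aᵀ * A) := hG.comp hgram
  have hSA : ∀ A : Mat q q, Measurable fun S : PosMat q => f (Aᵀ * S.1 * A) := fun A =>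
    Measurable.comp (f := fun S : PosMat q => (A, S)) hS measurable_prodMk_left
  have hSinvA : ∀ S : PosMat q, Measurable fun A : Mat q q => G (Aᵀ * (S.1)⁻¹ * A) := fun S =>
    Measurable.comp (f := fun A : Mat q q => (A, S)) hSinv measurable_prodMk_right
  have k1 : Measurable (Function.uncurry fun (A : Mat q q) (S : PosMat q) =>
      f (Aᵀ * S.1 * A) * G (Aᵀ * A)) := hS.mul (hGg.comp measurable_fst)
  have k2 : Measurable (Function.uncurry fun (A : Mat q q) (S : PosMat q) =>
      f (Aᵀ * A) * G (Aᵀ * (S.1)⁻¹ * A)) := (hfg.comp measurable_fst).mul hSinv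
  calc (∫⁻ S, f S.1 ∂N) * ∫⁻ A, G (Aᵀ * A) ∂(haarGL q)
      = ∫⁻ A, (∫⁻ S, f S.1 ∂N) * G (Aᵀ * A) ∂(haarGL q) :=
        (lintegral_const_mul _ hGg).symm
    _ = ∫⁻ A, ∫⁻ S, f (Aᵀ * S.1 * A) * G (Aᵀ * A) ∂N ∂(haarGL q) := by
        refine lintegral_congr_ae (ae_haarGL_det_ne_zero.mono fun A hA => ?_)
        beta_reduce
        have := hN Aᵀ (by rwa [det_transpose]) f hf
        rw [transpose_transpose] at this
        rw [lintegral_mul_const _ (hSA A), this]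
    _ = ∫⁻ S, ∫⁻ A, f (Aᵀ * S.1 * A) * G (Aᵀ * A) ∂(haarGL q) ∂N := by
        exact lintegral_lintegral_swap k1.aemeasurable
    _ = ∫⁻ S, ∫⁻ A, f (Aᵀ * A) * G (Aᵀ * (S.1)⁻¹ * A) ∂(haarGL q) ∂N := by
        refine lintegral_congr fun S => ?_
        have hFm : Measurable fun A : Mat q q => f (Aᵀ * A) * G (Aᵀ * (S.1)⁻¹ * A) :=
          hfg.mul (hSinvA S)
        refine Eq.trans ?_ (lintegral_haarGL_mul_left (det_sqrtMat_pos S).ne' hFm)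
        · refine lintegral_congr fun A => ?_
          have e1 : (sqrtMat S * A)ᵀ * (sqrtMat S * A) = Aᵀ * S.1 * A := by
            rw [← sqrtMat_mul_self S, transpose_mul, transpose_sqrtMat]
            simp only [Matrix.mul_assoc]
          have e2 : (sqrtMat S * A)ᵀ * (S.1)⁻¹ * (sqrtMat S * A) = Aᵀ * A := by
            rw [transpose_mul, transpose_sqrtMat]
            calc Aᵀ * sqrtMat S * (S.1)⁻¹ * (sqrtMat S * A)
                = Aᵀ * (sqrtMat S * (S.1)⁻¹ * sqrtMat S) * A := by simp only [Matrix.mul_assoc]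
              _ = Aᵀ * A := by rw [sqrtMat_mul_inv_mul_sqrtMat, Matrix.mul_one]
          rw [e1, e2]
    _ = ∫⁻ A, ∫⁻ S, f (Aᵀ * A) * G (Aᵀ * (S.1)⁻¹ * A) ∂N ∂(haarGL q) := by
        symm
        exact lintegral_lintegral_swap k2.aemeasurable
    _ = ∫⁻ A, (∫⁻ S, G (S.1)⁻¹ ∂N) * f (Aᵀ * A) ∂(haarGL q) := by
        refine lintegral_congr_ae (ae_haarGL_det_ne_zero.mono fun A hA => ?_)
        beta_reduce
        have hAu : IsUnit A.det := hA.isUnit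
        have hAu' : IsUnit Aᵀ.det := by rwa [det_transpose]
        have hp' : Measurable fun S : Mat q q => (A, S⁻¹) :=
          Measurable.prodMk (f := fun _ : Mat q q => A) measurable_const hinv
        have hm := h3.comp hp'
        have hGm : Measurable fun S : Mat q q => G (Aᵀ * S⁻¹ * A) := hG.comp hm
        have hGS : Measurable fun S : PosMat q => G (Aᵀ * (S.1)⁻¹ * A) :=
          Measurable.comp (g := fun S : Mat q q => G (Aᵀ * S⁻¹ * A)) hGm measurable_subtype_coe
        have := hN A hA (fun S => G (Aᵀ * S⁻¹ * A)) hGm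
        rw [lintegral_const_mul _ hGS, ← this, mul_comm]
        congr 1
        refine lintegral_congr fun S => ?_
        congr 1
        rw [Matrix.mul_inv_rev, Matrix.mul_inv_rev, ← Matrix.mul_assoc, ← Matrix.mul_assoc,
          Matrix.mul_nonsing_inv _ hAu', Matrix.one_mul, Matrix.mul_assoc,
          Matrix.nonsing_inv_mul _ hAu, Matrix.mul_one]
    _ = (∫⁻ S, G (S.1)⁻¹ ∂N) * ∫⁻ A, f (Aᵀ * A) ∂(haarGL q) :=
        lintegral_const_mul _ hfg

end InvariantMeasure

/-! ### Wishart integrals -/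

section Wishart

variable {p q : ℕ}

/-- The Wishart weight `exp(-tr S / 2) (det S)^a`. -/
noncomputable def wishartWeight (a : ℝ) (S : Mat q q) : ℝ≥0∞ :=
  ENNReal.ofReal (Real.exp (-S.trace / 2) * S.det ^ a)

theorem measurable_trace : Measurable (trace : Mat q q → ℝ) :=
  (Continuous.matrix_trace continuous_id).measurable

theorem measurable_wishartWeight (a : ℝ) : Measurable (wishartWeight a : Mat q q → ℝ≥0∞) := by
  have := measurable_det (q := q)
  have := measurable_trace (q := q)
  unfold wishartWeight
  fun_prop

theorem measurable_gram : Measurable fun x : Mat p q => xᵀ * x :=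
  Continuous.measurable (by fun_prop)

theorem lintegral_wishartWeight_haarGL_half :
    ∫⁻ A, wishartWeight ((q : ℝ) / 2) (Aᵀ * A) ∂(haarGL q) =
      ENNReal.ofReal ((2 * Real.pi) ^ ((q : ℝ) * q / 2)) := by
  rw [← lintegral_gaussian_leb q q, lintegral_haarGL
    (F := fun A => wishartWeight ((q : ℝ) / 2) (Aᵀ * A))
    ((measurable_wishartWeight _).comp measurable_gram)]
  refine lintegral_congr_ae ?_
  filter_upwards [ae_det_gram_ne_zero (le_refl q)] with A hA
  have hA' : 0 < |A.det| := abs_pos.2 fun h => hA (by simp [h])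
  rw [wishartWeight, ← ENNReal.ofReal_mul (by positivity)]
  congr 1
  rw [det_mul, det_transpose, ← sq, ← sq_abs, ← Real.rpow_natCast (|A.det|) 2,
    ← Real.rpow_mul hA'.le, mul_left_comm]
  have : ((2 : ℕ) : ℝ) * ((q : ℝ) / 2) = (q : ℝ) := by push_cast; ring
  rw [this, Real.rpow_natCast, inv_mul_cancel₀ (by positivity), mul_one]

theorem lintegral_wishartWeight_haarGL_ne_zero (a : ℝ) :
    ∫⁻ A, wishartWeight a (Aᵀ * A) ∂(haarGL q) ≠ 0 := by
  intro h
  have hm : Measurable fun A : Mat q q => wishartWeight a (Aᵀ * A) :=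
    (measurable_wishartWeight a).comp measurable_gram
  rw [lintegral_eq_zero_iff hm] at h
  have hf : ∀ᵐ A ∂(haarGL q), False := by
    filter_upwards [h, ae_haarGL_det_ne_zero] with A h1 h2
    have h3 : 0 < (Aᵀ * A).det := by rw [det_mul, det_transpose]; exact mul_self_pos.2 h2
    have h4 : 0 < wishartWeight a (Aᵀ * A) := by
      unfold wishartWeight
      exact ENNReal.ofReal_pos.2 (by positivity)
    exact h4.ne' h1
  have h0 : haarGL q = 0 := by
    rw [← Measure.measure_univ_eq_zero]
    simpa [ae_iff] using hf
  have h1 := lintegral_wishartWeight_haarGL_half (q := q)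
  rw [h0, lintegral_zero_measure] at h1
  exact absurd h1.symm (ENNReal.ofReal_pos.2 (by positivity)).ne'

theorem multiGamma_nonneg (q : ℕ) (a : ℝ) : 0 ≤ multiGamma q a :=
  integral_nonneg fun S => mul_nonneg (Real.exp_pos _).le (Real.rpow_nonneg (det_posMat_pos S).le _)

theorem lintegral_exp_mul_det_rpow {a : ℝ} (h : multiGamma q a ≠ 0) :
    ∫⁻ S, ENNReal.ofReal (Real.exp (-S.1.trace) * S.1.det ^ a) ∂(mu q) =
      ENNReal.ofReal (multiGamma q a) := by
  have hint : Integrable (fun S : PosMat q => Real.exp (-S.1.trace) * S.1.det ^ a) (mu q) := by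
    by_contra hn
    exact h (integral_undef hn)
  rw [multiGamma, ofReal_integral_eq_lintegral_ofReal hint]
  exact Filter.Eventually.of_forall fun S =>
    mul_nonneg (Real.exp_pos _).le (Real.rpow_nonneg (det_posMat_pos S).le _)

theorem lintegral_mu_smul {t : ℝ} (ht : 0 < t) {F : Mat q q → ℝ≥0∞} (hF : Measurable F) :
    ∫⁻ S, F (t • S.1) ∂(mu q) = ∫⁻ S, F S.1 ∂(mu q) := by
  have hdet : (Real.sqrt t • (1 : Mat q q)).det ≠ 0 := by
    rw [det_smul, det_one, mul_one]
    exact pow_ne_zero _ (Real.sqrt_pos.2 ht).ne'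
  rw [← lintegral_mu_congr hdet hF]
  refine lintegral_congr fun S => ?_
  congr 1
  rw [transpose_smul, transpose_one, Matrix.smul_mul, Matrix.one_mul, Matrix.mul_smul,
    Matrix.mul_one, smul_smul, Real.mul_self_sqrt ht.le]

theorem lintegral_wishartWeight_mu (h : multiGamma q ((p : ℝ) / 2) ≠ 0) :
    ∫⁻ S, wishartWeight ((p : ℝ) / 2) S.1 ∂(mu q) =
      ENNReal.ofReal (2 ^ ((p : ℝ) * q / 2) * multiGamma q ((p : ℝ) / 2)) := by
  have h2 : (0 : ℝ) < 2 := by norm_num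
  rw [← lintegral_mu_smul h2 (measurable_wishartWeight _), ENNReal.ofReal_mul (by positivity),
    ← lintegral_exp_mul_det_rpow h, ← lintegral_const_mul']
  · refine lintegral_congr fun S => ?_
    rw [wishartWeight, ← ENNReal.ofReal_mul (by positivity)]
    congr 1
    rw [trace_smul, det_smul, Fintype.card_fin, Real.mul_rpow (by positivity)
      (det_posMat_pos S).le, ← Real.rpow_natCast, ← Real.rpow_mul h2.le, smul_eq_mul]
    have e1 : (q : ℝ) * ((p : ℝ) / 2) = (p : ℝ) * q / 2 := by ring
    have e2 : -(2 * S.1.trace) / 2 = -S.1.trace := by ring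
    rw [e1, e2]
    ring
  · exact ENNReal.ofReal_ne_top

theorem wishartConst_pos (h : multiGamma q ((p : ℝ) / 2) ≠ 0) :
    0 < 2 ^ ((p : ℝ) * q / 2) * multiGamma q ((p : ℝ) / 2) :=
  mul_pos (by positivity) (lt_of_le_of_ne (multiGamma_nonneg q _) h.symm)

theorem lintegral_wishartWeight_haarGL_ne_top (h : multiGamma q ((p : ℝ) / 2) ≠ 0) :
    ∫⁻ A, wishartWeight ((p : ℝ) / 2) (Aᵀ * A) ∂(haarGL q) ≠ ∞ := by
  intro htop
  have key := lintegral_mul_lintegral_haarGL (mu q) (fun A hA F hF => lintegral_mu_congr hA hF)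
    (measurable_wishartWeight ((p : ℝ) / 2)) (measurable_wishartWeight ((q : ℝ) / 2))
  rw [lintegral_wishartWeight_mu h, lintegral_wishartWeight_haarGL_half, htop,
    ← ENNReal.ofReal_mul (wishartConst_pos h).le] at key
  have hpos : 0 < 2 ^ ((p : ℝ) * q / 2) * multiGamma q ((p : ℝ) / 2) *
      (2 * Real.pi) ^ ((q : ℝ) * q / 2) := mul_pos (wishartConst_pos h) (by positivity)
  by_cases h0 : ∫⁻ S, wishartWeight ((q : ℝ) / 2) (S.1)⁻¹ ∂(mu q) = 0
  · rw [h0, zero_mul] at key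
    exact (ENNReal.ofReal_pos.2 hpos).ne' key
  · rw [ENNReal.mul_top h0] at key
    exact ENNReal.ofReal_ne_top key

/-- Invariance under `S ↦ S⁻¹`, in the single instance that is needed. -/
theorem lintegral_wishartWeight_inv (h : multiGamma q ((p : ℝ) / 2) ≠ 0)
    (N : Measure (PosMat q)) [SFinite N]
    (hN : ∀ A : Mat q q, A.det ≠ 0 → ∀ F : Mat q q → ℝ≥0∞, Measurable F →
      ∫⁻ S, F (A * S.1 * Aᵀ) ∂N = ∫⁻ S, F S.1 ∂N) :
    ∫⁻ S, wishartWeight ((p : ℝ) / 2) (S.1)⁻¹ ∂N = ∫⁻ S, wishartWeight ((p : ℝ) / 2) S.1 ∂N :=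
  ((ENNReal.mul_left_inj (lintegral_wishartWeight_haarGL_ne_zero _)
    (lintegral_wishartWeight_haarGL_ne_top h)).1
    (lintegral_mul_lintegral_haarGL N hN (measurable_wishartWeight _)
      (measurable_wishartWeight _))).symm

/-- An invariant measure on `P⁺(q)` is determined by its value on one Wishart weight. -/
theorem lintegral_eq_lintegral_mu (h : multiGamma q ((p : ℝ) / 2) ≠ 0)
    (N : Measure (PosMat q)) [SFinite N]
    (hN : ∀ A : Mat q q, A.det ≠ 0 → ∀ F : Mat q q → ℝ≥0∞, Measurable F →
      ∫⁻ S, F (A * S.1 * Aᵀ) ∂N = ∫⁻ S, F S.1 ∂N)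
    (hw : ∫⁻ S, wishartWeight ((p : ℝ) / 2) S.1 ∂N = ∫⁻ S, wishartWeight ((p : ℝ) / 2) S.1 ∂(mu q))
    {F : Mat q q → ℝ≥0∞} (hF : Measurable F) : ∫⁻ S, F S.1 ∂N = ∫⁻ S, F S.1 ∂(mu q) := by
  have hμ : ∀ A : Mat q q, A.det ≠ 0 → ∀ F : Mat q q → ℝ≥0∞, Measurable F →
      ∫⁻ S, F (A * S.1 * Aᵀ) ∂(mu q) = ∫⁻ S, F S.1 ∂(mu q) :=
    fun A hA F hF => lintegral_mu_congr hA hF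
  refine (ENNReal.mul_left_inj (lintegral_wishartWeight_haarGL_ne_zero ((p : ℝ) / 2))
    (lintegral_wishartWeight_haarGL_ne_top h)).1 ?_
  rw [lintegral_mul_lintegral_haarGL N hN hF (measurable_wishartWeight _),
    lintegral_mul_lintegral_haarGL (mu q) hμ hF (measurable_wishartWeight _),
    lintegral_wishartWeight_inv h N hN, lintegral_wishartWeight_inv h (mu q) hμ, hw]

/-- The density of the inverse Wishart law. -/
noncomputable def invWishartDensity (p : ℕ) (T S : Mat q q) : ℝ≥0∞ :=
  ENNReal.ofReal (T.det ^ ((p : ℝ) / 2) * Real.exp (-(T * S⁻¹).trace / 2) /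
      (2 ^ ((p : ℝ) * q / 2) * S.det ^ ((p : ℝ) / 2) * multiGamma q ((p : ℝ) / 2)))

theorem invWishart_eq (T : Mat q q) :
    invWishart (p : ℝ) T = (mu q).withDensity fun S => invWishartDensity p T S.1 := rfl

theorem invWishart_univ (h : multiGamma q ((p : ℝ) / 2) ≠ 0) (T : PosMat q) :
    invWishart (p : ℝ) T.1 Set.univ = 1 := by
  set R := sqrtMat T with hR
  have hRu : IsUnit R.det := (det_sqrtMat_pos T).ne'.isUnit
  have hRt : Rᵀ = R := transpose_sqrtMat T
  have hc := wishartConst_pos h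
  set c := 2 ^ ((p : ℝ) * q / 2) * multiGamma q ((p : ℝ) / 2) with hcdef
  have hRinv : (R⁻¹).det ≠ 0 := (isUnit_nonsing_inv_det R hRu).ne_zero
  rw [invWishart_eq, withDensity_apply _ MeasurableSet.univ, Measure.restrict_univ]
  calc ∫⁻ S, invWishartDensity p T.1 S.1 ∂(mu q)
      = ∫⁻ S, ENNReal.ofReal c⁻¹ *
          wishartWeight ((p : ℝ) / 2) (R⁻¹ * S.1 * (R⁻¹)ᵀ)⁻¹ ∂(mu q) := by
        refine lintegral_congr fun S => ?_
        have e : (R⁻¹ * S.1 * (R⁻¹)ᵀ)⁻¹ = R * (S.1)⁻¹ * R := by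
          rw [Matrix.mul_inv_rev, Matrix.mul_inv_rev, transpose_nonsing_inv, hRt,
            Matrix.nonsing_inv_nonsing_inv _ hRu, Matrix.mul_assoc]
        have hS := det_posMat_pos S
        have hT := det_posMat_pos T
        rw [e, wishartWeight, invWishartDensity, ← ENNReal.ofReal_mul (by positivity)]
        congr 1
        rw [trace_mul_cycle, hR, sqrtMat_mul_self, det_mul_right_comm, det_mul, sqrtMat_mul_self,
          det_nonsing_inv, Ring.inverse_eq_inv', Real.mul_rpow hT.le (by positivity),
          Real.inv_rpow hS.le, hcdef]
        have hc1 : (2 : ℝ) ^ ((p : ℝ) * q / 2) ≠ 0 := by positivity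
        have hc2 : S.1.det ^ ((p : ℝ) / 2) ≠ 0 := by positivity
        field_simp
    _ = ENNReal.ofReal c⁻¹ *
          ∫⁻ S, wishartWeight ((p : ℝ) / 2) (R⁻¹ * S.1 * (R⁻¹)ᵀ)⁻¹ ∂(mu q) :=
        lintegral_const_mul' _ _ ENNReal.ofReal_ne_top
    _ = ENNReal.ofReal c⁻¹ * ENNReal.ofReal c := by
        have hm : Measurable fun S : Mat q q => wishartWeight ((p : ℝ) / 2) S⁻¹ :=
          (measurable_wishartWeight _).comp measurable_inv_mat
        rw [lintegral_mu_congr hRinv hm, lintegral_wishartWeight_inv h (mu q)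
          (fun A hA F hF => lintegral_mu_congr hA hF), lintegral_wishartWeight_mu h]
    _ = 1 := by
        rw [← ENNReal.ofReal_mul (by positivity), inv_mul_cancel₀ hc.ne', ENNReal.ofReal_one]

end Wishart

/-! ### Convergence of the integral `Γ_q(p/2)` -/

section Gamma

variable {p q : ℕ}

theorem det_le_trace_pow {S : Mat q q} (hS : S.PosSemidef) : S.det ≤ S.trace ^ q := by
  rw [hS.1.det_eq_prod_eigenvalues, hS.1.trace_eq_sum_eigenvalues]
  simp only [RCLike.ofReal_real_eq_id, id]
  calc ∏ i, hS.1.eigenvalues i ≤ ∏ _i : Fin q, ∑ j, hS.1.eigenvalues j :=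
        Finset.prod_le_prod (fun i _ => hS.eigenvalues_nonneg i) fun i _ =>
          Finset.single_le_sum (fun j _ => hS.eigenvalues_nonneg j) (Finset.mem_univ i)
    _ = _ := by simp

/-- Powers of the determinant are dominated by the exponential of the trace. -/
theorem exists_det_rpow_le_exp_trace (q : ℕ) {b : ℝ} (hb : 0 ≤ b) :
    ∃ C : ℝ, 0 ≤ C ∧ ∀ S : PosMat q, S.1.det ^ b ≤ C * Real.exp (S.1.trace / 2) := by
  set s : ℝ := q * b with hs
  have hs0 : 0 ≤ s := by positivity
  set ε : ℝ := (2 * (s + 1))⁻¹ with hε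
  have hεpos : 0 < ε := by positivity
  refine ⟨(ε⁻¹) ^ s, by positivity, fun S => ?_⟩
  have ht : 0 ≤ S.1.trace := S.2.posSemidef.trace_nonneg
  set t := S.1.trace with htdef
  have h1 : t ≤ ε⁻¹ * Real.exp (ε * t) := by
    rw [← div_eq_inv_mul, le_div_iff₀ hεpos]
    linarith [Real.add_one_le_exp (ε * t)]
  have h2 : ε * s ≤ 1 / 2 := by
    rw [hε, inv_mul_le_iff₀ (by positivity)]
    linarith
  calc S.1.det ^ b ≤ (t ^ q) ^ b :=
        Real.rpow_le_rpow (det_posMat_pos S).le (det_le_trace_pow S.2.posSemidef) hb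
    _ = t ^ s := by rw [← Real.rpow_natCast, ← Real.rpow_mul ht]
    _ ≤ (ε⁻¹ * Real.exp (ε * t)) ^ s := Real.rpow_le_rpow ht h1 hs0
    _ = (ε⁻¹) ^ s * Real.exp (ε * t * s) := by
        rw [Real.mul_rpow (by positivity) (Real.exp_pos _).le, ← Real.exp_mul]
    _ ≤ (ε⁻¹) ^ s * Real.exp (t / 2) := by
        gcongr
        nlinarith

theorem posDef_symOfUpper_of_abs_sub_le {v : Upper q → ℝ}
    (hv : ∀ i j, |symOfUpper v i j - (1 : Mat q q) i j| ≤ ((q : ℝ) + 1)⁻¹) :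
    (symOfUpper v).PosDef := by
  refine PosDef.of_dotProduct_mulVec_pos ?_ fun x hx => ?_
  · rw [IsHermitian, conjTranspose_eq_transpose_of_trivial, transpose_symOfUpper]
  set D : Mat q q := symOfUpper v - 1 with hD
  have e : symOfUpper v = 1 + D := by rw [hD]; abel
  have hx2 : 0 < ∑ i, x i ^ 2 := by
    obtain ⟨i, hi⟩ := Function.ne_iff.1 hx
    exact Finset.sum_pos' (fun _ _ => sq_nonneg _) ⟨i, Finset.mem_univ i, by
      have : x i ≠ 0 := hi
      positivity⟩
  have h1 : x ⬝ᵥ (symOfUpper v *ᵥ x) = ∑ i, x i ^ 2 + ∑ i, ∑ j, x i * (D i j * x j) := by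
    rw [e, Matrix.add_mulVec, one_mulVec, dotProduct_add]
    congr 1
    · exact Finset.sum_congr rfl fun i _ => (sq (x i)).symm
    · simp only [dotProduct, mulVec, Finset.mul_sum]
  have h2 : |∑ i, ∑ j, x i * (D i j * x j)| ≤ ((q : ℝ) + 1)⁻¹ * (∑ i, |x i|) ^ 2 := by
    rw [sq, Finset.sum_mul_sum, Finset.mul_sum]
    refine (Finset.abs_sum_le_sum_abs _ _).trans (Finset.sum_le_sum fun i _ => ?_)
    rw [Finset.mul_sum]
    refine (Finset.abs_sum_le_sum_abs _ _).trans (Finset.sum_le_sum fun j _ => ?_)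
    rw [abs_mul, abs_mul]
    have := mul_le_mul_of_nonneg_right (hv i j) (mul_nonneg (abs_nonneg (x i)) (abs_nonneg (x j)))
    calc |x i| * (|D i j| * |x j|) = |D i j| * (|x i| * |x j|) := by ring
      _ ≤ _ := this
  have h3 : (∑ i, |x i|) ^ 2 ≤ q * ∑ i, x i ^ 2 := by
    have := sq_sum_le_card_mul_sum_sq (s := Finset.univ) (f := fun i => |x i|)
    simpa using this
  have h4 : ((q : ℝ) + 1)⁻¹ * (∑ i, |x i|) ^ 2 < ∑ i, x i ^ 2 := by
    rw [inv_mul_lt_iff₀ (by positivity)]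
    linarith
  have h5 := neg_le_of_abs_le h2
  show 0 < x ⬝ᵥ (symOfUpper v *ᵥ x)
  rw [h1]
  linarith

theorem mu_ne_zero (q : ℕ) : mu q ≠ 0 := by
  intro h0
  have h1 := lintegral_mu (q := q) (F := fun _ => 1) measurable_const
  have hm : Measurable fun v : Upper q → ℝ => muDensity (symOfUpper v) :=
    measurable_muDensity.comp measurable_symOfUpper
  simp only [mul_one] at h1
  rw [h0, lintegral_zero_measure, eq_comm, lintegral_eq_zero_iff hm] at h1
  have hone : symOfUpper (upperOf (1 : Mat q q)) = 1 := symOfUpper_upperOf transpose_one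
  -- a neighbourhood of the identity consists of positive-definite matrices
  have hnhds : {v : Upper q → ℝ | ¬ muDensity (symOfUpper v) = 0} ∈
      nhds (upperOf (1 : Mat q q)) := by
    have hε : (0 : ℝ) < ((q : ℝ) + 1)⁻¹ := by positivity
    have : ∀ᶠ v in nhds (upperOf (1 : Mat q q)),
        ∀ i j, |symOfUpper v i j - (1 : Mat q q) i j| < ((q : ℝ) + 1)⁻¹ := by
      refine Filter.eventually_all.2 fun i => Filter.eventually_all.2 fun j => ?_
      have hc : Continuous fun v : Upper q → ℝ => |symOfUpper v i j - (1 : Mat q q) i j| :=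
        (((continuous_apply_apply i j).comp continuous_symOfUpper).sub continuous_const).abs
      refine hc.continuousAt.eventually_lt continuousAt_const ?_
      rw [hone, sub_self, abs_zero]
      exact hε
    filter_upwards [this] with v hv
    have hpd := posDef_symOfUpper_of_abs_sub_le fun i j => (hv i j).le
    have hdet := hpd.det_pos
    have : 0 < muDensity (symOfUpper v) := by
      rw [muDensity, Set.indicator_of_mem (s := {S : Mat q q | S.PosDef}) hpd]
      exact ENNReal.ofReal_pos.2 (by positivity)
    exact this.ne'
  exact (Measure.measure_pos_of_mem_nhds volume hnhds).ne' (ae_iff.1 h1)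

/-- `{S : |S_ij| ≤ 2, det S ≥ 1/2}`, a set of finite `μ`-measure. -/
def detBox (q : ℕ) : Set (Mat q q) := {S | (∀ i j, |S i j| ≤ 2) ∧ 1 / 2 ≤ S.det}

theorem measurableSet_detBox (q : ℕ) : MeasurableSet (detBox q) := by
  have h1 : IsClosed {S : Mat q q | ∀ i j, |S i j| ≤ 2} := by
    simp only [Set.ofPred_forall]
    exact isClosed_iInter fun i => isClosed_iInter fun j =>
      isClosed_le (continuous_id.matrix_elem i j).abs continuous_const
  have h2 : IsClosed {S : Mat q q | 1 / 2 ≤ S.det} :=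
    isClosed_le continuous_const (Continuous.matrix_det continuous_id)
  exact (h1.inter h2).measurableSet

theorem lintegral_detBox_mu_ne_top (q : ℕ) :
    ∫⁻ S, (detBox q).indicator 1 S.1 ∂(mu q) ≠ ∞ := by
  have hm : Measurable ((detBox q).indicator (1 : Mat q q → ℝ≥0∞)) :=
    measurable_one.indicator (measurableSet_detBox q)
  rw [lintegral_mu hm]
  set c : ℝ≥0∞ := ENNReal.ofReal ((1 / 2 : ℝ) ^ (-((q : ℝ) + 1) / 2)) with hc
  set B : Set (Upper q → ℝ) := Set.Icc (fun _ => -2) (fun _ => 2) with hB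
  have hle : ∀ v : Upper q → ℝ, muDensity (symOfUpper v) *
      (detBox q).indicator 1 (symOfUpper v) ≤ B.indicator (fun _ => c) v := by
    intro v
    by_cases hv : symOfUpper v ∈ detBox q
    · have hvB : v ∈ B := by
        have h : ∀ ij : Upper q, |v ij| ≤ 2 := fun ij => by
          have := hv.1 ij.1.1 ij.1.2
          have e := congrFun (upperOf_symOfUpper v) ij
          rwa [← e]
        exact ⟨fun ij => (abs_le.1 (h ij)).1, fun ij => (abs_le.1 (h ij)).2⟩
      rw [Set.indicator_of_mem hv, Set.indicator_of_mem hvB, Pi.one_apply, mul_one, muDensity]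
      refine Set.indicator_apply_le' (fun _ => ?_) (fun _ => bot_le)
      refine ENNReal.ofReal_le_ofReal
        (Real.rpow_le_rpow_of_nonpos (by norm_num) hv.2 ?_)
      have : (0 : ℝ) ≤ q := Nat.cast_nonneg q
      linarith
    · rw [Set.indicator_of_notMem hv, mul_zero]
      exact bot_le
  refine ((lintegral_mono hle).trans_lt ?_).ne
  rw [lintegral_indicator_const measurableSet_Icc]
  exact ENNReal.mul_lt_top ENNReal.ofReal_lt_top isCompact_Icc.measure_lt_top

theorem lintegral_detBox_haarGL_ne_zero (q : ℕ) :
    ∫⁻ A, (detBox q).indicator 1 (Aᵀ * A)⁻¹ ∂(haarGL q) ≠ 0 := by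
  have hm : Measurable fun S : Mat q q => (detBox q).indicator (1 : Mat q q → ℝ≥0∞) S⁻¹ :=
    (measurable_one.indicator (measurableSet_detBox q)).comp measurable_inv_mat
  have hmg : Measurable fun A : Mat q q =>
      (detBox q).indicator (1 : Mat q q → ℝ≥0∞) (Aᵀ * A)⁻¹ := hm.comp measurable_gram
  have hd := measurable_det (q := q)
  intro h0
  rw [lintegral_haarGL hmg, lintegral_eq_zero_iff (by fun_prop)] at h0
  refine (Measure.measure_pos_of_mem_nhds (leb q q) (x := (1 : Mat q q)) ?_).ne' (ae_iff.1 h0)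
  -- the gram matrices of matrices close to the identity have their inverses in the box
  set g : Mat q q → Mat q q := fun A => ((Aᵀ * A).det)⁻¹ • (Aᵀ * A).adjugate with hg
  have hginv : ∀ A, g A = (Aᵀ * A)⁻¹ := fun A => by
    rw [Matrix.inv_def, Ring.inverse_eq_inv']
  have hgram : Continuous fun A : Mat q q => Aᵀ * A := by fun_prop
  have hg1 : g 1 = 1 := by rw [hginv, transpose_one, Matrix.one_mul, inv_one]
  have hgc : ContinuousAt g 1 :=
    (hgram.matrix_det.continuousAt.inv₀ (by simp)).smul hgram.matrix_adjugate.continuousAt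
  have e1 : ∀ᶠ A in nhds (1 : Mat q q), A.det ≠ 0 :=
    (Continuous.matrix_det continuous_id).continuousAt.eventually_ne (by simp)
  have e2 : ∀ᶠ A in nhds (1 : Mat q q), 1 / 2 < (g A).det := by
    refine continuousAt_const.eventually_lt
      ((Continuous.matrix_det continuous_id).continuousAt.comp hgc) ?_
    show 1 / 2 < (g 1).det
    rw [hg1, det_one]
    norm_num
  have e3 : ∀ᶠ A in nhds (1 : Mat q q), ∀ i j, |g A i j| < 2 := by
    refine Filter.eventually_all.2 fun i => Filter.eventually_all.2 fun j => ?_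
    have hc : Continuous fun S : Mat q q => |S i j| := (continuous_id.matrix_elem i j).abs
    refine (hc.continuousAt.comp hgc).eventually_lt continuousAt_const ?_
    show |g 1 i j| < 2
    rw [hg1, one_apply]
    split_ifs <;> norm_num
  filter_upwards [e1, e2, e3] with A h1 h2 h3
  have hmem : (Aᵀ * A)⁻¹ ∈ detBox q := by
    rw [← hginv]
    exact ⟨fun i j => (h3 i j).le, h2.le⟩
  have hA : 0 < |A.det| := abs_pos.2 h1
  show ¬ ENNReal.ofReal ((|A.det| ^ q)⁻¹) * (detBox q).indicator 1 (Aᵀ * A)⁻¹ = 0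
  rw [Set.indicator_of_mem hmem, Pi.one_apply, mul_one]
  exact (ENNReal.ofReal_pos.2 (by positivity)).ne'

/-- The borderline exponent: the Wishart integral is a multiple of the Gaussian integral on
`M(q,q)`, by uniqueness of the invariant measure. -/
theorem lintegral_wishartWeight_mu_half_ne_top (q : ℕ) :
    ∫⁻ S, wishartWeight ((q : ℝ) / 2) S.1 ∂(mu q) ≠ ∞ := by
  intro htop
  have hG : Measurable fun S : Mat q q => (detBox q).indicator (1 : Mat q q → ℝ≥0∞) S⁻¹ :=
    (measurable_one.indicator (measurableSet_detBox q)).comp measurable_inv_mat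
  have key := lintegral_mul_lintegral_haarGL (mu q) (fun A hA F hF => lintegral_mu_congr hA hF)
    (measurable_wishartWeight ((q : ℝ) / 2)) hG
  have e : ∫⁻ S : PosMat q, (detBox q).indicator (1 : Mat q q → ℝ≥0∞) ((S.1)⁻¹)⁻¹ ∂(mu q) =
      ∫⁻ S : PosMat q, (detBox q).indicator 1 S.1 ∂(mu q) :=
    lintegral_congr fun S => by
      rw [Matrix.nonsing_inv_nonsing_inv _ (det_posMat_pos S).ne'.isUnit]
  rw [htop, ENNReal.top_mul (lintegral_detBox_haarGL_ne_zero q), e,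
    lintegral_wishartWeight_haarGL_half] at key
  exact ENNReal.mul_ne_top (lintegral_detBox_mu_ne_top q) ENNReal.ofReal_ne_top key.symm

/-- The integral defining `Γ_q(p/2)` converges, and its value is not zero, for `p ≥ q`. -/
theorem multiGamma_ne_zero (hpq : q ≤ p) : multiGamma q ((p : ℝ) / 2) ≠ 0 := by
  have hd := measurable_det (q := q)
  have ht := measurable_trace (q := q)
  have hm : Measurable fun S : PosMat q =>
      Real.exp (-S.1.trace) * S.1.det ^ ((p : ℝ) / 2) := by fun_prop
  have hpos : ∀ S : PosMat q, 0 < Real.exp (-S.1.trace) * S.1.det ^ ((p : ℝ) / 2) := fun S =>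
    mul_pos (Real.exp_pos _) (Real.rpow_pos_of_pos (det_posMat_pos S) _)
  rw [multiGamma, integral_eq_lintegral_of_nonneg_ae
    (Filter.Eventually.of_forall fun S => (hpos S).le) hm.aestronglyMeasurable]
  refine (ENNReal.toReal_pos ?_ ?_).ne'
  · rw [ne_eq, lintegral_eq_zero_iff hm.ennreal_ofReal]
    intro h0
    refine mu_ne_zero q (Measure.measure_univ_eq_zero.1 ?_)
    have hf : ∀ᵐ S ∂(mu q), False := by
      filter_upwards [h0] with S hS
      exact (ENNReal.ofReal_pos.2 (hpos S)).ne' hS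
    simpa [ae_iff] using hf
  · have hb : (0 : ℝ) ≤ ((p : ℝ) - q) / 2 := by
      have : (q : ℝ) ≤ p := by exact_mod_cast hpq
      linarith
    obtain ⟨C, hC, hle⟩ := exists_det_rpow_le_exp_trace q hb
    have hbound : ∀ S : PosMat q,
        ENNReal.ofReal (Real.exp (-S.1.trace) * S.1.det ^ ((p : ℝ) / 2)) ≤
          ENNReal.ofReal C * wishartWeight ((q : ℝ) / 2) S.1 := by
      intro S
      have hS := det_posMat_pos S
      rw [wishartWeight, ← ENNReal.ofReal_mul hC]
      refine ENNReal.ofReal_le_ofReal ?_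
      have e1 : S.1.det ^ ((p : ℝ) / 2) =
          S.1.det ^ (((p : ℝ) - q) / 2) * S.1.det ^ ((q : ℝ) / 2) := by
        rw [← Real.rpow_add hS]; congr 1; ring
      have e2 : Real.exp (-S.1.trace / 2) =
          Real.exp (-S.1.trace) * Real.exp (S.1.trace / 2) := by
        rw [← Real.exp_add]; congr 1; ring
      rw [e1, e2]
      calc Real.exp (-S.1.trace) *
            (S.1.det ^ (((p : ℝ) - q) / 2) * S.1.det ^ ((q : ℝ) / 2))
          ≤ Real.exp (-S.1.trace) *
            (C * Real.exp (S.1.trace / 2) * S.1.det ^ ((q : ℝ) / 2)) := by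
            gcongr
            exact hle S
        _ = _ := by ring
    refine ((lintegral_mono hbound).trans_lt ?_).ne
    rw [lintegral_const_mul' _ _ ENNReal.ofReal_ne_top]
    exact ENNReal.mul_lt_top ENNReal.ofReal_lt_top
      (lintegral_wishartWeight_mu_half_ne_top q).lt_top

end Gamma

/-! ### The measure `ν_U` and its image under the Gram map -/

section Nu

variable {p q : ℕ}

/-- The density of `ν_U` with respect to Lebesgue measure. -/
noncomputable def nuDensity (U : Mat p p) (x : Mat p q) : ℝ≥0∞ :=
  ENNReal.ofReal (multiGamma q ((p : ℝ) / 2) / Real.pi ^ ((p : ℝ) * q / 2) *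
      (U.det ^ (-(q : ℝ) / 2) / (xᵀ * U⁻¹ * x).det ^ ((p : ℝ) / 2)))

theorem nu_eq (U : Mat p p) : nu q U = (leb p q).withDensity (nuDensity U) := rfl

theorem measurable_det_form (W : Mat p p) : Measurable fun x : Mat p q => (xᵀ * W * x).det :=
  Continuous.measurable (Continuous.matrix_det (by fun_prop))

theorem measurable_nuDensity (U : Mat p p) : Measurable (nuDensity U : Mat p q → ℝ≥0∞) := by
  have := measurable_det_form (q := q) U⁻¹
  unfold nuDensity
  fun_prop

instance instSFiniteNu (U : Mat p p) : SFinite (nu q U) := by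
  rw [nu_eq]; infer_instance

theorem lintegral_nu (U : Mat p p) {F : Mat p q → ℝ≥0∞} (hF : Measurable F) :
    ∫⁻ x, F x ∂(nu q U) = ∫⁻ x, nuDensity U x * F x ∂(leb p q) := by
  rw [nu_eq, lintegral_withDensity_eq_lintegral_mul _ (measurable_nuDensity U) hF]
  rfl

theorem ae_nu_det_gram_ne_zero (hpq : q ≤ p) (U : Mat p p) :
    ∀ᵐ x ∂(nu q U), (xᵀ * x).det ≠ 0 :=
  (withDensity_absolutelyContinuous _ _).ae_le (ae_det_gram_ne_zero hpq)

theorem posSemidef_gram (x : Mat p q) : (xᵀ * x).PosSemidef := by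
  simpa using posSemidef_conjTranspose_mul_self x

theorem posSemidef_form {W : Mat p p} (hW : W.PosSemidef) (x : Mat p q) :
    (xᵀ * W * x).PosSemidef := by
  simpa using hW.conjTranspose_mul_mul_same x

theorem posDef_gram {x : Mat p q} (hx : (xᵀ * x).det ≠ 0) : (xᵀ * x).PosDef :=
  (posSemidef_gram x).posDef_iff_det_ne_zero.2 hx

/-- The Gram matrix `xᵀ x` as an element of `P⁺(q)`, with a junk value for rank-deficient `x`. -/
noncomputable def gram (x : Mat p q) : PosMat q := toPosMat (xᵀ * x)

theorem measurable_gramPos : Measurable (gram : Mat p q → PosMat q) :=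
  measurable_toPosMat.comp measurable_gram

theorem coe_gram {x : Mat p q} (hx : (xᵀ * x).det ≠ 0) : (gram x).1 = xᵀ * x :=
  coe_toPosMat (posDef_gram hx)

theorem lintegral_nu_mul_right {U : Mat p p} (hU : U.PosDef) {B : Mat q q} (hB : B.det ≠ 0)
    {F : Mat p q → ℝ≥0∞} (hF : Measurable F) :
    ∫⁻ x, F (x * B) ∂(nu q U) = ∫⁻ x, F x ∂(nu q U) := by
  have hc : Measurable fun x : Mat p q => x * B := Continuous.measurable (by fun_prop)
  have hB' : 0 < |B.det| := abs_pos.2 hB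
  have hd := measurable_nuDensity (q := q) U
  have hFc : Measurable fun x : Mat p q => F (x * B) := hF.comp hc
  have hdc : Measurable fun x : Mat p q => nuDensity U (x * B) * F (x * B) := (hd.mul hF).comp hc
  rw [lintegral_nu U hF, lintegral_nu U hFc,
    ← lintegral_leb_mul_right hB (F := fun x => nuDensity U x * F x) (hd.mul hF),
    ← lintegral_const_mul _ hdc]
  refine lintegral_congr fun x => ?_
  rw [← mul_assoc]
  congr 1
  unfold nuDensity
  rw [← ENNReal.ofReal_mul (by positivity)]
  congr 1
  have e : ((x * B)ᵀ * U⁻¹ * (x * B)).det = |B.det| ^ 2 * (xᵀ * U⁻¹ * x).det := by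
    have : (x * B)ᵀ * U⁻¹ * (x * B) = Bᵀ * (xᵀ * U⁻¹ * x) * B := by
      rw [transpose_mul]; simp only [Matrix.mul_assoc]
    rw [this, det_mul, det_mul, det_transpose, sq_abs]
    ring
  have e2 : (|B.det| ^ 2 * (xᵀ * U⁻¹ * x).det) ^ ((p : ℝ) / 2) =
      |B.det| ^ p * (xᵀ * U⁻¹ * x).det ^ ((p : ℝ) / 2) := by
    rw [Real.mul_rpow (by positivity) (posSemidef_form hU.inv.posSemidef x).det_nonneg,
      ← Real.rpow_natCast |B.det| 2, ← Real.rpow_mul hB'.le, ← Real.rpow_natCast |B.det| p]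
    congr 2
    push_cast; ring
  rw [e, e2]
  field_simp

/-- `ν_{I}` is carried to `μ` by `x ↦ xᵀ x`. -/
theorem lintegral_nu_gram (hpq : q ≤ p) (h : multiGamma q ((p : ℝ) / 2) ≠ 0)
    {F : PosMat q → ℝ≥0∞} (hF : Measurable F) :
    ∫⁻ x, F (gram x) ∂(nu q (1 : Mat p p)) = ∫⁻ S, F S ∂(mu q) := by
  set N : Measure (PosMat q) := (nu q (1 : Mat p p)).map gram with hNdef
  have hint : ∀ G : Mat q q → ℝ≥0∞, Measurable G →
      ∫⁻ S, G S.1 ∂N = ∫⁻ x, G (xᵀ * x) ∂(nu q (1 : Mat p p)) := by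
    intro G hG
    have hGv : Measurable fun S : PosMat q => G S.1 := hG.comp measurable_subtype_coe
    rw [hNdef, lintegral_map hGv measurable_gramPos]
    refine lintegral_congr_ae ((ae_nu_det_gram_ne_zero hpq 1).mono fun x hx => ?_)
    beta_reduce
    rw [coe_gram hx]
  have hN : ∀ A : Mat q q, A.det ≠ 0 → ∀ G : Mat q q → ℝ≥0∞, Measurable G →
      ∫⁻ S, G (A * S.1 * Aᵀ) ∂N = ∫⁻ S, G S.1 ∂N := by
    intro A hA G hG
    have hc : Measurable fun S : Mat q q => A * S * Aᵀ := Continuous.measurable (by fun_prop)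
    have hGg : Measurable fun x : Mat p q => G (xᵀ * x) := hG.comp measurable_gram
    rw [hint G hG, hint (fun S => G (A * S * Aᵀ)) (hG.comp hc),
      ← lintegral_nu_mul_right PosDef.one (B := Aᵀ) (by rwa [det_transpose]) hGg]
    refine lintegral_congr fun x => ?_
    congr 1
    rw [transpose_mul, transpose_transpose]
    simp only [Matrix.mul_assoc]
  have hw : ∫⁻ S, wishartWeight ((p : ℝ) / 2) S.1 ∂N =
      ∫⁻ S, wishartWeight ((p : ℝ) / 2) S.1 ∂(mu q) := by
    have hwg : Measurable fun x : Mat p q => wishartWeight ((p : ℝ) / 2) (xᵀ * x) :=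
      (measurable_wishartWeight _).comp measurable_gram
    have hΓ := multiGamma_nonneg q ((p : ℝ) / 2)
    rw [hint _ (measurable_wishartWeight _), lintegral_wishartWeight_mu h, lintegral_nu 1 hwg]
    calc ∫⁻ x : Mat p q, nuDensity 1 x * wishartWeight ((p : ℝ) / 2) (xᵀ * x) ∂(leb p q)
        = ∫⁻ x : Mat p q, ENNReal.ofReal (multiGamma q ((p : ℝ) / 2) /
            Real.pi ^ ((p : ℝ) * q / 2)) *
              ENNReal.ofReal (Real.exp (-(xᵀ * x).trace / 2)) ∂(leb p q) := by
          refine lintegral_congr_ae ((ae_det_gram_ne_zero hpq).mono fun x hx => ?_)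
          have hpos : 0 < (xᵀ * x).det := (posDef_gram hx).det_pos
          beta_reduce
          rw [nuDensity, wishartWeight, inv_one, Matrix.mul_one, det_one, Real.one_rpow,
            ← ENNReal.ofReal_mul (by positivity), ← ENNReal.ofReal_mul (by positivity)]
          congr 1
          have : (xᵀ * x).det ^ ((p : ℝ) / 2) ≠ 0 := by positivity
          field_simp
      _ = _ := by
          rw [lintegral_const_mul' _ _ ENNReal.ofReal_ne_top, lintegral_gaussian_leb,
            ← ENNReal.ofReal_mul (by positivity)]
          congr 1
          rw [Real.mul_rpow (by norm_num) Real.pi_pos.le]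
          have : Real.pi ^ ((p : ℝ) * q / 2) ≠ 0 := by positivity
          field_simp
  have hFt : Measurable fun S : Mat q q => F (toPosMat S) := hF.comp measurable_toPosMat
  have key := lintegral_eq_lintegral_mu h N hN hw hFt
  simp only [toPosMat_coe] at key
  rw [← key, hNdef, lintegral_map hF measurable_gramPos]

end Nu

section MatrixNormal

variable {p q : ℕ}

/-- The density of the centred matrix-normal law. -/
noncomputable def matrixNormalDensity (Sg : Mat p p) (T : Mat q q) (x : Mat p q) : ℝ≥0∞ :=
  ENNReal.ofReal (Real.exp (-(T⁻¹ * xᵀ * Sg⁻¹ * x).trace / 2) /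
      ((2 * Real.pi) ^ ((p : ℝ) * q / 2) * Sg.det ^ ((q : ℝ) / 2) * T.det ^ ((p : ℝ) / 2)))

theorem matrixNormal_zero_eq (Sg : Mat p p) (T : Mat q q) :
    matrixNormal 0 Sg T = (leb p q).withDensity (matrixNormalDensity Sg T) := by
  unfold matrixNormal
  simp only [sub_zero]
  rfl

theorem measurable_matrixNormalDensity (Sg : Mat p p) (T : Mat q q) :
    Measurable (matrixNormalDensity Sg T : Mat p q → ℝ≥0∞) := by
  have : Measurable fun x : Mat p q => (T⁻¹ * xᵀ * Sg⁻¹ * x).trace :=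
    Continuous.measurable (Continuous.matrix_trace (by fun_prop))
  unfold matrixNormalDensity
  fun_prop

theorem matrixNormal_univ (Sg : PosMat p) (T : PosMat q) :
    matrixNormal (0 : Mat p q) Sg.1 T.1 Set.univ = 1 := by
  have hC := det_sqrtMat_pos Sg
  have hB := det_sqrtMat_pos T
  have hm := measurable_matrixNormalDensity Sg.1 T.1
  have hc : Measurable fun x : Mat p q => sqrtMat Sg * x := Continuous.measurable (by fun_prop)
  have hmc : Measurable fun x : Mat p q => matrixNormalDensity Sg.1 T.1 (sqrtMat Sg * x) :=
    hm.comp hc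
  rw [matrixNormal_zero_eq, withDensity_apply _ MeasurableSet.univ, Measure.restrict_univ,
    ← lintegral_leb_mul_left hC.ne' hm, ← lintegral_leb_mul_right hB.ne' hmc,
    ← mul_assoc, ← ENNReal.ofReal_mul (by positivity), ← lintegral_const_mul' _ _
      ENNReal.ofReal_ne_top]
  have hT := det_posMat_pos T
  have hSg := det_posMat_pos Sg
  have d1 : Sg.1.det ^ ((q : ℝ) / 2) = (sqrtMat Sg).det ^ q := by
    rw [← sqrtMat_mul_self Sg, det_mul, ← sq, ← Real.rpow_natCast (sqrtMat Sg).det 2,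
      ← Real.rpow_mul hC.le, ← Real.rpow_natCast]
    congr 1; push_cast; ring
  have d2 : T.1.det ^ ((p : ℝ) / 2) = (sqrtMat T).det ^ p := by
    rw [← sqrtMat_mul_self T, det_mul, ← sq, ← Real.rpow_natCast (sqrtMat T).det 2,
      ← Real.rpow_mul hB.le, ← Real.rpow_natCast]
    congr 1; push_cast; ring
  calc ∫⁻ x : Mat p q, ENNReal.ofReal (|(sqrtMat Sg).det| ^ q * |(sqrtMat T).det| ^ p) *
        matrixNormalDensity Sg.1 T.1 (sqrtMat Sg * (x * sqrtMat T)) ∂(leb p q)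
      = ∫⁻ x : Mat p q, ENNReal.ofReal ((2 * Real.pi) ^ ((p : ℝ) * q / 2))⁻¹ *
          ENNReal.ofReal (Real.exp (-(xᵀ * x).trace / 2)) ∂(leb p q) := by
        refine lintegral_congr fun x => ?_
        rw [matrixNormalDensity, ← ENNReal.ofReal_mul (by positivity),
          ← ENNReal.ofReal_mul (by positivity)]
        congr 1
        have e : ((T.1)⁻¹ * (sqrtMat Sg * (x * sqrtMat T))ᵀ * (Sg.1)⁻¹ *
            (sqrtMat Sg * (x * sqrtMat T))).trace = (xᵀ * x).trace := by
          have e1 : (T.1)⁻¹ * (sqrtMat Sg * (x * sqrtMat T))ᵀ * (Sg.1)⁻¹ *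
              (sqrtMat Sg * (x * sqrtMat T)) = (T.1)⁻¹ * sqrtMat T *
                (xᵀ * (sqrtMat Sg * (Sg.1)⁻¹ * sqrtMat Sg) * x) * sqrtMat T := by
            rw [transpose_mul, transpose_mul, transpose_sqrtMat, transpose_sqrtMat]
            simp only [Matrix.mul_assoc]
          rw [e1, sqrtMat_mul_inv_mul_sqrtMat, Matrix.mul_one, trace_mul_comm, ← Matrix.mul_assoc,
            ← Matrix.mul_assoc, ← Matrix.mul_assoc, sqrtMat_mul_inv_mul_sqrtMat, Matrix.one_mul]
        rw [e, d1, d2, abs_of_pos hC, abs_of_pos hB]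
        field_simp
    _ = 1 := by
        rw [lintegral_const_mul' _ _ ENNReal.ofReal_ne_top, lintegral_gaussian_leb,
          ← ENNReal.ofReal_mul (by positivity), inv_mul_cancel₀ (by positivity),
          ENNReal.ofReal_one]

end MatrixNormal

/-! ### The density of the proposal -/

section Mixture

variable {p q : ℕ}

/-- The unnormalised inverse-Wishart mixture `∫ exp(-tr(R V⁻¹)/2) (det V)^{-p} μ(dV)`. It equals
`(det R)^{-p}` up to a constant, but only its monotonicity and its behaviour under congruence are
used. -/
noncomputable def mixture (p : ℕ) (R : Mat q q) : ℝ≥0∞ :=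
  ∫⁻ V : PosMat q, ENNReal.ofReal (Real.exp (-(R * (V.1)⁻¹).trace / 2) * (V.1.det ^ p)⁻¹) ∂(mu q)

theorem measurable_inv_posMat : Measurable fun V : PosMat q => (V.1)⁻¹ :=
  measurable_inv_mat.comp measurable_subtype_coe

theorem measurable_mixture_integrand (p : ℕ) : Measurable fun z : Mat q q × PosMat q =>
    ENNReal.ofReal (Real.exp (-(z.1 * (z.2.1)⁻¹).trace / 2) * (z.2.1.det ^ p)⁻¹) := by
  have h1 : Measurable fun z : Mat q q × Mat q q => (z.1 * z.2).trace :=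
    Continuous.measurable (Continuous.matrix_trace (by fun_prop))
  have h2 : Measurable fun z : Mat q q × PosMat q => (z.1, (z.2.1)⁻¹) :=
    Measurable.prodMk measurable_fst (measurable_inv_posMat.comp measurable_snd)
  have h3 : Measurable fun z : Mat q q × PosMat q => (z.1 * (z.2.1)⁻¹).trace := h1.comp h2
  have hd := measurable_det (q := q)
  have h4 : Measurable fun z : Mat q q × PosMat q => z.2.1.det := by fun_prop
  fun_prop

theorem measurable_mixture_integrand_right (p : ℕ) (R : Mat q q) : Measurable fun V : PosMat q =>
    ENNReal.ofReal (Real.exp (-(R * (V.1)⁻¹).trace / 2) * (V.1.det ^ p)⁻¹) :=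
  Measurable.comp (f := fun V : PosMat q => (R, V)) (measurable_mixture_integrand p)
    measurable_prodMk_left

theorem measurable_mixture (p : ℕ) : Measurable (mixture p : Mat q q → ℝ≥0∞) :=
  (measurable_mixture_integrand p).lintegral_prod_right'

theorem mixture_congr (p : ℕ) {B : Mat q q} (hB : B.det ≠ 0) (R : Mat q q) :
    ENNReal.ofReal ((|B.det| ^ 2) ^ p) * mixture p (Bᵀ * R * B) = mixture p R := by
  have hBu : IsUnit B.det := hB.isUnit
  have hBu' : IsUnit Bᵀ.det := by rwa [det_transpose]
  have hB' : 0 < |B.det| := abs_pos.2 hB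
  have hm : Measurable fun V : Mat q q => ENNReal.ofReal
      (Real.exp (-((Bᵀ * R * B) * V⁻¹).trace / 2) * (V.det ^ p)⁻¹) := by
    have h1 : Measurable fun V : Mat q q => ((Bᵀ * R * B) * V).trace :=
      Continuous.measurable (Continuous.matrix_trace (by fun_prop))
    have h2 : Measurable fun V : Mat q q => ((Bᵀ * R * B) * V⁻¹).trace :=
      h1.comp measurable_inv_mat
    have hd := measurable_det (q := q)
    fun_prop
  unfold mixture
  rw [← lintegral_mu_congr (A := Bᵀ) (by rwa [det_transpose]) hm,
    ← lintegral_const_mul' _ _ ENNReal.ofReal_ne_top]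
  refine lintegral_congr fun V => ?_
  rw [← ENNReal.ofReal_mul (by positivity)]
  congr 1
  have e : (Bᵀ * R * B * (Bᵀ * V.1 * Bᵀᵀ)⁻¹).trace = (R * (V.1)⁻¹).trace := by
    rw [transpose_transpose, Matrix.mul_inv_rev, Matrix.mul_inv_rev]
    have : Bᵀ * R * B * (B⁻¹ * ((V.1)⁻¹ * Bᵀ⁻¹)) =
        Bᵀ * (R * (B * B⁻¹) * (V.1)⁻¹ * Bᵀ⁻¹) := by simp only [Matrix.mul_assoc]
    rw [this, trace_mul_comm, Matrix.mul_assoc _ Bᵀ⁻¹, Matrix.nonsing_inv_mul _ hBu',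
      Matrix.mul_nonsing_inv _ hBu, Matrix.mul_one, Matrix.mul_one]
  rw [e, det_mul, det_mul, transpose_transpose, det_transpose, sq_abs]
  have hV := det_posMat_pos V
  have : (B.det * V.1.det * B.det) ^ p = (B.det ^ 2) ^ p * V.1.det ^ p := by
    rw [← mul_pow]; congr 1; ring
  rw [this, mul_inv]
  have h0 : (B.det ^ 2) ^ p ≠ 0 := by positivity
  field_simp

theorem mixture_smul (p : ℕ) {t : ℝ} (ht : 0 < t) (R : Mat q q) :
    ENNReal.ofReal ((t ^ q) ^ p) * mixture p (t • R) = mixture p R := by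
  have hs : 0 < Real.sqrt t := Real.sqrt_pos.2 ht
  have hdet : (Real.sqrt t • (1 : Mat q q)).det = Real.sqrt t ^ q := by
    rw [det_smul, det_one, mul_one, Fintype.card_fin]
  have h := mixture_congr p (B := Real.sqrt t • (1 : Mat q q))
    (by rw [hdet]; exact pow_ne_zero _ hs.ne') R
  have h2 : (Real.sqrt t ^ q) ^ 2 = t ^ q := by rw [pow_right_comm, Real.sq_sqrt ht.le]
  rw [hdet, abs_of_pos (by positivity), h2,
    transpose_smul, transpose_one, Matrix.smul_mul, Matrix.one_mul, Matrix.mul_smul,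
    Matrix.mul_one, smul_smul, Real.mul_self_sqrt ht.le] at h
  exact h

theorem trace_mul_inv_nonneg {C : Mat q q} (hC : C.PosSemidef) (V : PosMat q) :
    0 ≤ (C * (V.1)⁻¹).trace := by
  set H := sqrtMat (⟨(V.1)⁻¹, V.2.inv⟩ : PosMat q) with hH
  have h1 : H * H = (V.1)⁻¹ := sqrtMat_mul_self _
  have h2 : Hᵀ = H := transpose_sqrtMat _
  rw [← h1, ← Matrix.mul_assoc, trace_mul_comm, ← Matrix.mul_assoc]
  have h3 := hC.mul_mul_conjTranspose_same H
  rw [conjTranspose_eq_transpose_of_trivial, h2] at h3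
  exact h3.trace_nonneg

theorem mixture_anti (p : ℕ) {R R' : Mat q q} (h : (R' - R).PosSemidef) :
    mixture p R' ≤ mixture p R := by
  refine lintegral_mono fun V => ENNReal.ofReal_le_ofReal ?_
  have hV := det_posMat_pos V
  refine mul_le_mul_of_nonneg_right (Real.exp_le_exp.2 ?_) (by positivity)
  have := trace_mul_inv_nonneg h V
  rw [Matrix.sub_mul, trace_sub] at this
  linarith

end Mixture

section Proposal

variable {p q : ℕ}

theorem measurable_matrixNormalDensity_prod (U : Mat p p) :
    Measurable fun z : PosMat q × Mat p q => matrixNormalDensity U z.1.1 z.2 := by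
  have h1 : Measurable fun z : Mat q q × Mat p q => (z.1 * z.2ᵀ * U⁻¹ * z.2).trace :=
    Continuous.measurable (Continuous.matrix_trace (by fun_prop))
  have h2 : Measurable fun z : PosMat q × Mat p q => ((z.1.1)⁻¹, z.2) :=
    Measurable.prodMk (measurable_inv_posMat.comp measurable_fst) measurable_snd
  have h3 : Measurable fun z : PosMat q × Mat p q => ((z.1.1)⁻¹ * z.2ᵀ * U⁻¹ * z.2).trace :=
    Measurable.comp (g := fun z : Mat q q × Mat p q => (z.1 * z.2ᵀ * U⁻¹ * z.2).trace)
      (f := fun z : PosMat q × Mat p q => ((z.1.1)⁻¹, z.2)) h1 h2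
  have hd := measurable_det (q := q)
  have h4 : Measurable fun z : PosMat q × Mat p q => z.1.1.det := by fun_prop
  unfold matrixNormalDensity
  fun_prop

theorem measurable_matrixNormal (U : Mat p p) :
    Measurable fun V : PosMat q => matrixNormal (0 : Mat p q) U V.1 := by
  refine Measure.measurable_of_measurable_coe _ fun s hs => ?_
  simp only [matrixNormal_zero_eq, withDensity_apply _ hs]
  exact (measurable_matrixNormalDensity_prod U).lintegral_prod_right'

theorem measurable_invWishartDensity (T : Mat q q) :
    Measurable fun V : PosMat q => invWishartDensity p T V.1 := by
  have h1 : Measurable fun V : Mat q q => (T * V).trace :=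
    Continuous.measurable (Continuous.matrix_trace (by fun_prop))
  have h2 : Measurable fun V : PosMat q => (T * (V.1)⁻¹).trace := h1.comp measurable_inv_posMat
  have hd := measurable_det (q := q)
  have h4 : Measurable fun V : PosMat q => V.1.det := by fun_prop
  unfold invWishartDensity
  fun_prop

theorem measurable_affine (a b : ℝ) (x : Mat p q) : Measurable fun w : Mat p q => a • x + b • w :=
  Continuous.measurable (by fun_prop)

theorem lintegral_proposal (U : Mat p p) (ρ : ℝ) (x : Mat p q) {F : Mat p q → ℝ≥0∞}
    (hF : Measurable F) :
    ∫⁻ y, F y ∂(proposal U ρ x) =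
      ∫⁻ V : PosMat q, ∫⁻ w : Mat p q, F (Real.sqrt ρ • x + Real.sqrt (1 - ρ) • w)
        ∂(matrixNormal 0 U V.1) ∂(invWishart p (xᵀ * U⁻¹ * x)) := by
  have hm := measurable_affine (Real.sqrt ρ) (Real.sqrt (1 - ρ)) x
  unfold proposal
  rw [Measure.lintegral_bind _ hF.aemeasurable]
  · exact lintegral_congr fun V => lintegral_map hF hm
  · exact ((Measure.measurable_map _ hm).comp (measurable_matrixNormal U)).aemeasurable

/-- The normalising constant of the mixture of matrix-normal laws. -/
noncomputable def mixtureConst (q : ℕ) (U : Mat p p) : ℝ :=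
  (2 ^ ((p : ℝ) * q / 2) * multiGamma q ((p : ℝ) / 2) *
    ((2 * Real.pi) ^ ((p : ℝ) * q / 2) * U.det ^ ((q : ℝ) / 2)))⁻¹

theorem mixtureConst_pos (h : multiGamma q ((p : ℝ) / 2) ≠ 0) {U : Mat p p} (hU : U.PosDef) :
    0 < mixtureConst q U := by
  have := wishartConst_pos h
  have := hU.det_pos
  unfold mixtureConst
  positivity

theorem invWishartDensity_mul_matrixNormalDensity (h : multiGamma q ((p : ℝ) / 2) ≠ 0)
    {U : Mat p p} (hU : U.PosDef) {T : Mat q q} (hT : T.PosSemidef) (V : PosMat q) (w : Mat p q) :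
    invWishartDensity p T V.1 * matrixNormalDensity U V.1 w =
      ENNReal.ofReal (mixtureConst q U * T.det ^ ((p : ℝ) / 2)) *
        ENNReal.ofReal (Real.exp (-((T + wᵀ * U⁻¹ * w) * (V.1)⁻¹).trace / 2) *
          (V.1.det ^ p)⁻¹) := by
  have hV := det_posMat_pos V
  have hUd := hU.det_pos
  have hΓ := multiGamma_nonneg q ((p : ℝ) / 2)
  have hTd := hT.det_nonneg
  have hc := mixtureConst_pos h hU
  unfold invWishartDensity matrixNormalDensity
  rw [← ENNReal.ofReal_mul (by positivity), ← ENNReal.ofReal_mul (by positivity)]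
  congr 1
  have e1 : ((T + wᵀ * U⁻¹ * w) * (V.1)⁻¹).trace =
      (T * (V.1)⁻¹).trace + ((V.1)⁻¹ * wᵀ * U⁻¹ * w).trace := by
    rw [Matrix.add_mul, trace_add, trace_mul_comm (wᵀ * U⁻¹ * w)]
    simp only [Matrix.mul_assoc]
  have e2 : V.1.det ^ p = V.1.det ^ ((p : ℝ) / 2) * V.1.det ^ ((p : ℝ) / 2) := by
    rw [← Real.rpow_add hV, add_halves, Real.rpow_natCast]
  have e3 : Real.exp (-((T + wᵀ * U⁻¹ * w) * (V.1)⁻¹).trace / 2) =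
      Real.exp (-(T * (V.1)⁻¹).trace / 2) *
        Real.exp (-((V.1)⁻¹ * wᵀ * U⁻¹ * w).trace / 2) := by
    rw [← Real.exp_add, e1]; congr 1; ring
  rw [e2, e3, mixtureConst]
  have h1 : V.1.det ^ ((p : ℝ) / 2) ≠ 0 := by positivity
  have h2 : U.det ^ ((q : ℝ) / 2) ≠ 0 := by positivity
  have h3 : (2 : ℝ) ^ ((p : ℝ) * q / 2) ≠ 0 := by positivity
  have h4 : (2 * Real.pi) ^ ((p : ℝ) * q / 2) ≠ 0 := by positivity
  field_simp

/-- Change of variables `y = z + b w`. -/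
theorem lintegral_leb_affine {b : ℝ} (hb : 0 < b) (z : Mat p q) {F : Mat p q → ℝ≥0∞}
    (hF : Measurable F) :
    ∫⁻ w, F (z + b • w) ∂(leb p q) = ENNReal.ofReal ((b ^ p) ^ q)⁻¹ * ∫⁻ y, F y ∂(leb p q) := by
  have hdet : (b • (1 : Mat p p)).det = b ^ p := by
    rw [det_smul, det_one, mul_one, Fintype.card_fin]
  have hFz : Measurable fun y : Mat p q => F (z + y) := hF.comp (measurable_const_add z)
  have h1 := lintegral_leb_mul_left (A := b • (1 : Mat p p)) (q := q)
    (by rw [hdet]; positivity) hFz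
  rw [lintegral_add_left_eq_self, hdet, abs_of_pos (by positivity)] at h1
  rw [← h1, ← mul_assoc, ← ENNReal.ofReal_mul (by positivity), inv_mul_cancel₀ (by positivity),
    ENNReal.ofReal_one, one_mul]
  simp

/-- The symmetric quadratic form `xᵀ W x + yᵀ W y - √ρ (xᵀ W y + yᵀ W x)`. -/
noncomputable def crossForm (W : Mat p p) (ρ : ℝ) (x y : Mat p q) : Mat q q :=
  xᵀ * W * x + yᵀ * W * y - Real.sqrt ρ • (xᵀ * W * y + yᵀ * W * x)

theorem crossForm_comm (W : Mat p p) (ρ : ℝ) (x y : Mat p q) :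
    crossForm W ρ x y = crossForm W ρ y x := by
  unfold crossForm
  rw [add_comm (xᵀ * W * x), add_comm (xᵀ * W * y)]

theorem crossForm_eq (W : Mat p p) {ρ : ℝ} (h0 : 0 ≤ ρ) (h1 : ρ < 1) (x y : Mat p q) :
    xᵀ * W * x + (1 - ρ)⁻¹ • ((y - Real.sqrt ρ • x)ᵀ * W * (y - Real.sqrt ρ • x)) =
      (1 - ρ)⁻¹ • crossForm W ρ x y := by
  have hne : 1 - ρ ≠ 0 := by linarith
  have e : xᵀ * W * x = (1 - ρ)⁻¹ • ((1 - ρ) • (xᵀ * W * x)) := by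
    rw [smul_smul, inv_mul_cancel₀ hne, one_smul]
  rw [e, ← smul_add]
  congr 1
  unfold crossForm
  simp only [transpose_sub, transpose_smul, Matrix.sub_mul, Matrix.mul_sub, Matrix.smul_mul,
    Matrix.mul_smul, smul_sub, smul_add, sub_smul, one_smul, smul_smul, Real.mul_self_sqrt h0]
  abel

/-- The density of the MpCN proposal with respect to Lebesgue measure. -/
noncomputable def proposalDensity (U : Mat p p) (ρ : ℝ) (x y : Mat p q) : ℝ≥0∞ :=
  ENNReal.ofReal (((Real.sqrt (1 - ρ) ^ p) ^ q)⁻¹ * mixtureConst q U *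
    (xᵀ * U⁻¹ * x).det ^ ((p : ℝ) / 2)) * mixture p ((1 - ρ)⁻¹ • crossForm U⁻¹ ρ x y)

theorem measurable_mixture_crossForm (W : Mat p p) (ρ : ℝ) :
    Measurable fun z : Mat p q × Mat p q => mixture p ((1 - ρ)⁻¹ • crossForm W ρ z.1 z.2) := by
  have h1 : Measurable fun z : Mat p q × Mat p q => (1 - ρ)⁻¹ • crossForm W ρ z.1 z.2 := by
    unfold crossForm
    exact Continuous.measurable (by fun_prop)
  exact (measurable_mixture p).comp h1

theorem measurable_proposalDensity (U : Mat p p) (ρ : ℝ) :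
    Measurable fun z : Mat p q × Mat p q => proposalDensity U ρ z.1 z.2 := by
  have h1 := measurable_det_form (q := q) U⁻¹
  have h2 : Measurable fun z : Mat p q × Mat p q => (z.1ᵀ * U⁻¹ * z.1).det :=
    h1.comp measurable_fst
  unfold proposalDensity
  exact Measurable.mul (by fun_prop) (measurable_mixture_crossForm U⁻¹ ρ)

theorem proposal_eq_withDensity (h : multiGamma q ((p : ℝ) / 2) ≠ 0) {U : Mat p p} (hU : U.PosDef)
    {ρ : ℝ} (h0 : 0 ≤ ρ) (h1 : ρ < 1) (x : Mat p q) :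
    proposal U ρ x = (leb p q).withDensity (proposalDensity U ρ x) := by
  refine Measure.ext_of_lintegral _ fun F hF => ?_
  have hT := posSemidef_form hU.inv.posSemidef x
  set T := xᵀ * U⁻¹ * x with hTdef
  set a := Real.sqrt ρ with ha
  set b := Real.sqrt (1 - ρ) with hb
  have hbpos : 0 < b := Real.sqrt_pos.2 (by linarith)
  have hb2 : b * b = 1 - ρ := Real.mul_self_sqrt (by linarith)
  have hc := mixtureConst_pos h hU
  have hTd := hT.det_nonneg
  have hpd : Measurable (proposalDensity U ρ x) :=
    Measurable.comp (f := fun y : Mat p q => (x, y)) (measurable_proposalDensity U ρ)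
      measurable_prodMk_left
  have hFa : Measurable fun w : Mat p q => F (a • x + b • w) := hF.comp (measurable_affine a b x)
  have hiw := measurable_invWishartDensity (p := p) T
  have hmn := measurable_matrixNormalDensity_prod (q := q) U
  have hinner : Measurable fun V : PosMat q =>
      ∫⁻ w : Mat p q, F (a • x + b • w) ∂(matrixNormal 0 U V.1) :=
    (Measure.measurable_lintegral hFa).comp (measurable_matrixNormal U)
  have hjoint : Measurable (Function.uncurry fun (V : PosMat q) (w : Mat p q) =>
      invWishartDensity p T V.1 * (matrixNormalDensity U V.1 w * F (a • x + b • w))) :=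
    (hiw.comp measurable_fst).mul (hmn.mul (hFa.comp measurable_snd))
  set c := mixtureConst q U * T.det ^ ((p : ℝ) / 2) with hcdef
  -- `F` times the proposal density, up to the Jacobian of `y = a x + b w`
  set Φ : Mat p q → ℝ≥0∞ := fun y =>
    ENNReal.ofReal c * mixture p ((1 - ρ)⁻¹ • crossForm U⁻¹ ρ x y) * F y with hΦ
  have hΦm : Measurable Φ := by
    have : Measurable fun y : Mat p q => mixture p ((1 - ρ)⁻¹ • crossForm U⁻¹ ρ x y) :=
      Measurable.comp (f := fun y : Mat p q => (x, y)) (measurable_mixture_crossForm U⁻¹ ρ)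
        measurable_prodMk_left
    exact (measurable_const.mul this).mul hF
  calc ∫⁻ y, F y ∂(proposal U ρ x)
      = ∫⁻ V : PosMat q, ∫⁻ w : Mat p q,
          invWishartDensity p T V.1 * (matrixNormalDensity U V.1 w * F (a • x + b • w))
            ∂(leb p q) ∂(mu q) := by
        rw [lintegral_proposal U ρ x hF, invWishart_eq,
          lintegral_withDensity_eq_lintegral_mul _ hiw hinner]
        refine lintegral_congr fun V => ?_
        have hmnV := measurable_matrixNormalDensity (q := q) U V.1
        rw [Pi.mul_apply, matrixNormal_zero_eq,
          lintegral_withDensity_eq_lintegral_mul _ hmnV hFa, ← lintegral_const_mul _ (hmnV.mul hFa)]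
        rfl
    _ = ∫⁻ w : Mat p q, ∫⁻ V : PosMat q,
          invWishartDensity p T V.1 * (matrixNormalDensity U V.1 w * F (a • x + b • w))
            ∂(mu q) ∂(leb p q) := lintegral_lintegral_swap hjoint.aemeasurable
    _ = ∫⁻ w : Mat p q, Φ (a • x + b • w) ∂(leb p q) := by
        refine lintegral_congr fun w => ?_
        have hcross : (1 - ρ)⁻¹ • crossForm U⁻¹ ρ x (a • x + b • w) = T + wᵀ * U⁻¹ * w := by
          rw [← crossForm_eq U⁻¹ h0 h1, ← ha, add_sub_cancel_left, transpose_smul, Matrix.smul_mul,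
            Matrix.smul_mul, Matrix.mul_smul, smul_smul, smul_smul, mul_assoc, hb2,
            inv_mul_cancel₀ (by linarith), one_smul]
        rw [hΦ]
        beta_reduce
        rw [hcross, mixture, ← lintegral_const_mul' _ _ ENNReal.ofReal_ne_top,
          ← lintegral_mul_const]
        · refine lintegral_congr fun V => ?_
          rw [← mul_assoc, invWishartDensity_mul_matrixNormalDensity h hU hT]
        · refine Measurable.const_mul ?_ _
          exact measurable_mixture_integrand_right p _
    _ = ENNReal.ofReal ((b ^ p) ^ q)⁻¹ * ∫⁻ y, Φ y ∂(leb p q) :=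
        lintegral_leb_affine hbpos (a • x) hΦm
    _ = ∫⁻ y, F y ∂((leb p q).withDensity (proposalDensity U ρ x)) := by
        rw [lintegral_withDensity_eq_lintegral_mul _ hpd hF,
          ← lintegral_const_mul' _ _ ENNReal.ofReal_ne_top]
        refine lintegral_congr fun y => ?_
        rw [hΦ, Pi.mul_apply, proposalDensity, mul_assoc (((b ^ p) ^ q)⁻¹), ← hTdef, ← hcdef,
          ENNReal.ofReal_mul (p := ((b ^ p) ^ q)⁻¹) (by positivity)]
        simp only [mul_assoc]

end Proposal

/-! ### Minorization and reversibility of the proposal; the gap on `M(p,q)` -/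

section ProposalKernel

variable {p q : ℕ}

theorem measurable_proposal (h : multiGamma q ((p : ℝ) / 2) ≠ 0) {U : Mat p p} (hU : U.PosDef)
    {ρ : ℝ} (h0 : 0 ≤ ρ) (h1 : ρ < 1) :
    Measurable (proposal U ρ : Mat p q → Measure (Mat p q)) := by
  refine Measure.measurable_of_measurable_coe _ fun s hs => ?_
  simp only [proposal_eq_withDensity h hU h0 h1, withDensity_apply _ hs]
  exact (measurable_proposalDensity U ρ).lintegral_prod_right'

theorem proposal_univ_le_one (hp : p ≠ 0) (h : multiGamma q ((p : ℝ) / 2) ≠ 0) {U : Mat p p}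
    (hU : U.PosDef) (ρ : ℝ) (x : Mat p q) : proposal U ρ x Set.univ ≤ 1 := by
  have hmn : ∀ V : PosMat q, matrixNormal (0 : Mat p q) U V.1 Set.univ = 1 := fun V =>
    matrixNormal_univ ⟨U, hU⟩ V
  have e := lintegral_proposal U ρ x (F := fun _ => 1) measurable_const
  simp only [lintegral_const, one_mul, hmn] at e
  rw [e]
  have hT := posSemidef_form hU.inv.posSemidef x
  by_cases hdet : (xᵀ * U⁻¹ * x).det = 0
  · -- at a rank-deficient `x` the inverse Wishart density vanishes
    have : invWishart (p : ℝ) (xᵀ * U⁻¹ * x) Set.univ = 0 := by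
      have hp2 : (p : ℝ) / 2 ≠ 0 := by positivity
      rw [invWishart_eq, withDensity_apply _ MeasurableSet.univ]
      simp [invWishartDensity, hdet, Real.zero_rpow hp2]
    rw [this]
    exact zero_le_one
  · exact (invWishart_univ h ⟨_, hT.posDef_iff_det_ne_zero.2 hdet⟩).le

theorem ae_det_form_ne_zero (hpq : q ≤ p) {W : Mat p p} (hW : W.PosDef) :
    ∀ᵐ x ∂(leb p q), (xᵀ * W * x).det ≠ 0 := by
  filter_upwards [ae_det_gram_ne_zero hpq] with x hx h0
  obtain ⟨v, hv, hxv⟩ := exists_mulVec_eq_zero_iff.2 h0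
  have h1 : x *ᵥ v = 0 := by
    have h2 := congrArg (fun u => v ⬝ᵥ u) hxv
    simp only [dotProduct_zero] at h2
    rw [Matrix.mul_assoc, ← mulVec_mulVec, ← mulVec_mulVec, dotProduct_mulVec,
      vecMul_transpose] at h2
    by_contra hne
    exact (hW.dotProduct_mulVec_pos hne).ne' (by simpa using h2)
  exact hx (exists_mulVec_eq_zero_iff.1 ⟨v, hv, by rw [← mulVec_mulVec, h1, mulVec_zero]⟩)

/-- `ν_U(dx) Q_ρ(x,dy)` has a symmetric density: the factors `(det xᵀ U⁻¹ x)^{±p/2}` cancel. -/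
theorem proposal_reversible (hpq : q ≤ p) (h : multiGamma q ((p : ℝ) / 2) ≠ 0) {U : Mat p p}
    (hU : U.PosDef) {ρ : ℝ} (h0 : 0 ≤ ρ) (h1 : ρ < 1)
    {g : Mat p q × Mat p q → ℝ≥0∞} (hg : Measurable g) :
    ∫⁻ x, ∫⁻ y, g (x, y) ∂(proposal U ρ x) ∂(nu q U) =
      ∫⁻ x, ∫⁻ y, g (y, x) ∂(proposal U ρ x) ∂(nu q U) := by
  set m : Mat p q → Mat p q → ℝ≥0∞ := fun x y => mixture p ((1 - ρ)⁻¹ • crossForm U⁻¹ ρ x y)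
    with hm
  have hmm : Measurable fun z : Mat p q × Mat p q => m z.1 z.2 :=
    measurable_mixture_crossForm U⁻¹ ρ
  have hmsymm : ∀ x y, m x y = m y x := fun x y => by rw [hm]; simp only [crossForm_comm U⁻¹ ρ x y]
  have hc := mixtureConst_pos h hU
  have hΓ := multiGamma_nonneg q ((p : ℝ) / 2)
  have hUd := hU.det_pos
  obtain ⟨C, hC⟩ : ∃ C : ℝ≥0∞, ∀ᵐ x ∂(leb p q), ∀ y,
      nuDensity U x * proposalDensity U ρ x y = C * m x y := by
    refine ⟨ENNReal.ofReal (multiGamma q ((p : ℝ) / 2) / Real.pi ^ ((p : ℝ) * q / 2) *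
      U.det ^ (-(q : ℝ) / 2) * (((Real.sqrt (1 - ρ) ^ p) ^ q)⁻¹ * mixtureConst q U)), ?_⟩
    filter_upwards [ae_det_form_ne_zero hpq hU.inv] with x hx y
    have hD : 0 < (xᵀ * U⁻¹ * x).det :=
      lt_of_le_of_ne (posSemidef_form hU.inv.posSemidef x).det_nonneg hx.symm
    rw [nuDensity, proposalDensity, ← mul_assoc, ← ENNReal.ofReal_mul (by positivity)]
    congr 2
    have : (xᵀ * U⁻¹ * x).det ^ ((p : ℝ) / 2) ≠ 0 := by positivity
    field_simp
  have key : ∀ G : Mat p q × Mat p q → ℝ≥0∞, Measurable G →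
      ∫⁻ x, ∫⁻ y, G (x, y) ∂(proposal U ρ x) ∂(nu q U) =
        ∫⁻ x, ∫⁻ y, C * m x y * G (x, y) ∂(leb p q) ∂(leb p q) := by
    intro G hG
    have hpd : ∀ x : Mat p q, Measurable (proposalDensity U ρ x) := fun x =>
      Measurable.comp (f := fun y : Mat p q => (x, y)) (measurable_proposalDensity U ρ)
        measurable_prodMk_left
    have hGx : ∀ x : Mat p q, Measurable fun y => G (x, y) := fun x =>
      hG.comp measurable_prodMk_left
    have hpG : Measurable (Function.uncurry fun x y : Mat p q =>
        proposalDensity U ρ x y * G (x, y)) := (measurable_proposalDensity U ρ).mul hG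
    have e : ∀ x, ∫⁻ y, G (x, y) ∂(proposal U ρ x) =
        ∫⁻ y, proposalDensity U ρ x y * G (x, y) ∂(leb p q) := fun x => by
      rw [proposal_eq_withDensity h hU h0 h1,
        lintegral_withDensity_eq_lintegral_mul _ (hpd x) (hGx x)]
      rfl
    simp only [e]
    have hin : Measurable fun x : Mat p q =>
        ∫⁻ y, proposalDensity U ρ x y * G (x, y) ∂(leb p q) := hpG.lintegral_prod_right'
    rw [lintegral_nu U hin]
    refine lintegral_congr_ae (hC.mono fun x hx => ?_)
    beta_reduce
    rw [← lintegral_const_mul' _ _ (by unfold nuDensity; exact ENNReal.ofReal_ne_top)]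
    refine lintegral_congr fun y => ?_
    show nuDensity U x * (proposalDensity U ρ x y * G (x, y)) = _
    rw [← mul_assoc, hx]
  have hswap : Measurable (Function.uncurry fun x y : Mat p q => C * m x y * g (x, y)) :=
    (measurable_const.mul hmm).mul hg
  have k2 : ∫⁻ x, ∫⁻ y, g (y, x) ∂(proposal U ρ x) ∂(nu q U) =
      ∫⁻ x, ∫⁻ y, C * m x y * g (y, x) ∂(leb p q) ∂(leb p q) :=
    key (fun z => g z.swap) (hg.comp measurable_swap)
  rw [key g hg, k2, lintegral_lintegral_swap hswap.aemeasurable]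
  refine lintegral_congr fun x => lintegral_congr fun y => ?_
  rw [hmsymm]

/-- `(1 + √ρ)(xᵀ W x + yᵀ W y)` dominates the cross form, because their difference is
`√ρ (x + y)ᵀ W (x + y)`. -/
theorem posSemidef_smul_crossForm_sub {W : Mat p p} (hW : W.PosSemidef) (ρ : ℝ) (x y : Mat p q) :
    ((1 + Real.sqrt ρ) • crossForm W 0 x y - crossForm W ρ x y).PosSemidef := by
  have e : (1 + Real.sqrt ρ) • crossForm W 0 x y - crossForm W ρ x y =
      Real.sqrt ρ • ((x + y)ᵀ * W * (x + y)) := by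
    unfold crossForm
    simp only [Real.sqrt_zero, transpose_add, Matrix.add_mul, Matrix.mul_add]
    module
  rw [e]
  exact (posSemidef_form hW (x + y)).smul (Real.sqrt_nonneg ρ)

/-- The proposals with parameter `ρ` dominate a multiple of the independent-increment proposal. -/
theorem exists_smul_proposal_le (h : multiGamma q ((p : ℝ) / 2) ≠ 0) {U : Mat p p} (hU : U.PosDef)
    {ρ : ℝ} (h0 : 0 ≤ ρ) (h1 : ρ < 1) :
    ∃ c : ℝ, 0 < c ∧ ∀ x : Mat p q, ENNReal.ofReal c • proposal U 0 x ≤ proposal U ρ x := by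
  have hρ : 0 < 1 - ρ := by linarith
  have hc := mixtureConst_pos h hU
  set t : ℝ := (1 - ρ)⁻¹ * (1 + Real.sqrt ρ) with ht
  have htpos : 0 < t := by positivity
  set s : ℝ := ((Real.sqrt (1 - ρ) ^ p) ^ q)⁻¹ with hs
  have hspos : 0 < s := by
    have := Real.sqrt_pos.2 hρ
    positivity
  refine ⟨s * ((t ^ q) ^ p)⁻¹, by positivity, fun x => ?_⟩
  have hpd : Measurable (proposalDensity U 0 x) :=
    Measurable.comp (f := fun y : Mat p q => (x, y)) (measurable_proposalDensity U 0)
      measurable_prodMk_left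
  rw [proposal_eq_withDensity h hU h0 h1, proposal_eq_withDensity h hU le_rfl one_pos,
    ← withDensity_smul _ hpd]
  refine withDensity_mono (Filter.Eventually.of_forall fun y => ?_)
  have hD := (posSemidef_form hU.inv.posSemidef x).det_nonneg
  rw [Pi.smul_apply, smul_eq_mul, proposalDensity, proposalDensity]
  simp only [sub_zero, Real.sqrt_one, one_pow, inv_one, one_mul, one_smul]
  have hanti : mixture p (t • crossForm U⁻¹ 0 x y) ≤
      mixture p ((1 - ρ)⁻¹ • crossForm U⁻¹ ρ x y) := by
    refine mixture_anti p ?_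
    rw [ht, mul_smul, ← smul_sub]
    exact (posSemidef_smul_crossForm_sub hU.inv.posSemidef ρ x y).smul (by positivity)
  rw [← mixture_smul p htpos (crossForm U⁻¹ 0 x y), ← mul_assoc, ← mul_assoc,
    ← ENNReal.ofReal_mul (by positivity), ← ENNReal.ofReal_mul (by positivity)]
  have e : s * ((t ^ q) ^ p)⁻¹ * (mixtureConst q U * (xᵀ * U⁻¹ * x).det ^ ((p : ℝ) / 2)) *
      (t ^ q) ^ p = s * mixtureConst q U * (xᵀ * U⁻¹ * x).det ^ ((p : ℝ) / 2) := by
    field_simp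
  rw [e]
  gcongr

/-- The MpCN proposal as a kernel. -/
noncomputable def proposalKernel (h : multiGamma q ((p : ℝ) / 2) ≠ 0) {U : Mat p p}
    (hU : U.PosDef) {ρ : ℝ} (h0 : 0 ≤ ρ) (h1 : ρ < 1) : Kernel (Mat p q) (Mat p q) where
  toFun := proposal U ρ
  measurable' := measurable_proposal h hU h0 h1

instance instNullSingletonLeb [NeZero p] [NeZero q] : NullSingletonClass (leb p q) := by
  have : NullSingletonClass (volume : Measure (Fin q → ℝ)) := inferInstance
  exact Measure.pi_nullSingletonClass (μ := fun _ : Fin p => (volume : Measure (Fin q → ℝ))) 0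

theorem nullSingletonClass_of_absolutelyContinuous {E : Type*} [MeasurableSpace E]
    {m ν : Measure E} (hν : NullSingletonClass ν) (h : m ≪ ν) : NullSingletonClass m :=
  ⟨fun x => h (measure_singleton x)⟩

theorem hasSpectralGap_kernel (hq : 1 ≤ q) (hpq : q ≤ p) {U : Mat p p} (hU : U.PosDef)
    (target : Measure (Mat p q)) [IsProbabilityMeasure target] {dens : Mat p q → ℝ}
    (hdens : Measurable dens) (hdens0 : ∀ x, 0 ≤ dens x)
    (htarget : target = (nu q U).withDensity fun x => ENNReal.ofReal (dens x))
    (hgap : HasSpectralGap (kernel U dens 0) target) {ρ : ℝ} (h0 : 0 ≤ ρ) (h1 : ρ < 1) :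
    HasSpectralGap (kernel U dens ρ) target := by
  have h := multiGamma_ne_zero hpq
  have : NeZero q := ⟨by omega⟩
  have hp : p ≠ 0 := by omega
  have : NeZero p := ⟨hp⟩
  obtain ⟨c, hc, hle⟩ := exists_smul_proposal_le (q := q) h hU h0 h1
  have hmass : ∀ ρ (x : Mat p q), proposal U ρ x Set.univ ≤ 1 := proposal_univ_le_one hp h hU
  set Q₀ : Kernel (Mat p q) (Mat p q) := proposalKernel h hU le_rfl one_pos
  set Q : Kernel (Mat p q) (Mat p q) := proposalKernel h hU h0 h1
  have : IsFiniteKernel Q₀ := ⟨1, ENNReal.one_lt_top, hmass 0⟩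
  have : IsFiniteKernel Q := ⟨1, ENNReal.one_lt_top, hmass ρ⟩
  have hnull : NullSingletonClass target := by
    refine nullSingletonClass_of_absolutelyContinuous (instNullSingletonLeb (p := p) (q := q)) ?_
    rw [htarget]
    exact (withDensity_absolutelyContinuous _ _).trans (withDensity_absolutelyContinuous _ _)
  obtain ⟨A, hA, hA0, hA1⟩ := exists_measurableSet_measure_lt_half target
  exact hasSpectralGap_metropolis_of_smul_le hdens hdens0 Q₀ Q (hmass 0) (hmass ρ)
    (fun g hg => proposal_reversible hpq h hU le_rfl one_pos hg)
    (fun g hg => proposal_reversible hpq h hU h0 h1 hg) htarget hc hle hA hA0 hA1 hgap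

end ProposalKernel

/-! ### The induced proposal and the gap on `P⁺(q)` -/

section Equivariance

variable {p q : ℕ}

/-- `O(p)` acts transitively on the full-rank matrices with a given Gram matrix. -/
theorem exists_orthogonal_mul_eq {x z : Mat p q} (h : xᵀ * x = zᵀ * z) (hz : (zᵀ * z).det ≠ 0) :
    ∃ O : Mat p p, Oᵀ * O = 1 ∧ O * z = x := by
  set E := EuclideanSpace ℝ (Fin p)
  -- the map `z c ↦ x c` is an isometry from the column space of `z`
  set M : Mat p p := x * (zᵀ * z)⁻¹ * zᵀ with hM
  have hMz : M * z = x := by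
    rw [hM, Matrix.mul_assoc, Matrix.mul_assoc, Matrix.nonsing_inv_mul _ hz.isUnit, Matrix.mul_one]
  set e : (Fin p → ℝ) ≃ₗ[ℝ] E := (WithLp.linearEquiv 2 ℝ (Fin p → ℝ)).symm with he
  set N : E →ₗ[ℝ] E := e.toLinearMap ∘ₗ M.mulVecLin ∘ₗ e.symm.toLinearMap with hN
  set V : Submodule ℝ E := LinearMap.range (e.toLinearMap ∘ₗ z.mulVecLin) with hV
  have hnorm : ∀ (y : Mat p q) (c : Fin q → ℝ), ‖e (y *ᵥ c)‖ ^ 2 = c ⬝ᵥ ((yᵀ * y) *ᵥ c) := by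
    intro y c
    rw [EuclideanSpace.real_norm_sq_eq, ← mulVec_mulVec, dotProduct_mulVec, vecMul_transpose,
      dotProduct]
    refine Finset.sum_congr rfl fun i _ => ?_
    rw [sq]; rfl
  set L : V →ₗᵢ[ℝ] E :=
    { toLinearMap := N ∘ₗ V.subtype
      norm_map' := by
        rintro ⟨_, c, rfl⟩
        have h1 : N (e (z *ᵥ c)) = e (x *ᵥ c) := by
          simp only [hN, LinearMap.comp_apply, LinearEquiv.coe_coe, LinearEquiv.symm_apply_apply,
            mulVecLin_apply, mulVec_mulVec, hMz]
        show ‖N (e (z *ᵥ c))‖ = ‖e (z *ᵥ c)‖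
        rw [h1, ← sq_eq_sq₀ (norm_nonneg _) (norm_nonneg _), hnorm, hnorm, h] } with hL
  have hLz : ∀ c, L.extend (e (z *ᵥ c)) = e (x *ᵥ c) := by
    intro c
    have := L.extend_apply ⟨e (z *ᵥ c), c, rfl⟩
    rw [this]
    show N (e (z *ᵥ c)) = _
    simp only [hN, LinearMap.comp_apply, LinearEquiv.coe_coe, LinearEquiv.symm_apply_apply,
      mulVecLin_apply, mulVec_mulVec, hMz]
  set K : (Fin p → ℝ) →ₗ[ℝ] (Fin p → ℝ) :=
    e.symm.toLinearMap ∘ₗ L.extend.toLinearMap ∘ₗ e.toLinearMap with hK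
  refine ⟨LinearMap.toMatrix' K, ?_, ?_⟩
  · have hdot : ∀ u v, K u ⬝ᵥ K v = u ⬝ᵥ v := by
      intro u v
      have h1 : ∀ a b : Fin p → ℝ, inner ℝ (e a) (e b) = b ⬝ᵥ a := fun a b => by
        rw [EuclideanSpace.inner_eq_star_dotProduct]; rfl
      have h2 : ∀ a, e (K a) = L.extend (e a) := fun a => by simp [hK]
      rw [← h1, ← h1, h2, h2, LinearIsometry.inner_map_map]
    ext i j
    have h3 := hdot (Pi.single i 1) (Pi.single j 1)
    have h4 : Pi.single i (1 : ℝ) ⬝ᵥ Pi.single j 1 = (1 : Mat p p) i j := by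
      rw [single_one_dotProduct, one_apply, Pi.single_apply]
    rw [← h4, ← h3, Matrix.mul_apply, dotProduct]
    refine Finset.sum_congr rfl fun k _ => ?_
    rw [transpose_apply, LinearMap.toMatrix'_apply, LinearMap.toMatrix'_apply]
  · refine Matrix.ext_of_mulVec_single fun j => ?_
    rw [← mulVec_mulVec, LinearMap.toMatrix'_mulVec]
    show e.symm (L.extend (e _)) = _
    rw [hLz, LinearEquiv.symm_apply_apply]

theorem crossForm_one_equivariant {O : Mat p p} (hO : Oᵀ * O = 1) (B : Mat q q) (ρ : ℝ)
    (x y : Mat p q) :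
    crossForm (1 : Mat p p) ρ (O * x * B) (O * y * B) = Bᵀ * crossForm (1 : Mat p p) ρ x y * B := by
  have e : ∀ a b : Mat p q, (O * a * B)ᵀ * (1 : Mat p p) * (O * b * B) =
      Bᵀ * (aᵀ * (1 : Mat p p) * b) * B := by
    intro a b
    calc (O * a * B)ᵀ * (1 : Mat p p) * (O * b * B) = Bᵀ * (aᵀ * (Oᵀ * O) * b) * B := by
          simp only [transpose_mul, Matrix.mul_one, Matrix.mul_assoc]
      _ = _ := by rw [hO]
  unfold crossForm
  rw [e, e, e, e]
  simp only [Matrix.mul_sub, Matrix.mul_add, Matrix.sub_mul, Matrix.add_mul, Matrix.mul_smul,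
    Matrix.smul_mul]

theorem proposalDensity_equivariant {O : Mat p p} (hO : Oᵀ * O = 1) {B : Mat q q} (hB : B.det ≠ 0)
    (ρ : ℝ) (x y : Mat p q) :
    ENNReal.ofReal (|B.det| ^ p) * proposalDensity (1 : Mat p p) ρ (O * x * B) (O * y * B) =
      proposalDensity (1 : Mat p p) ρ x y := by
  have hB' : 0 < |B.det| := abs_pos.2 hB
  have hD : ((O * x * B)ᵀ * (1 : Mat p p)⁻¹ * (O * x * B)).det =
      |B.det| ^ 2 * (xᵀ * (1 : Mat p p)⁻¹ * x).det := by
    have : (O * x * B)ᵀ * (1 : Mat p p)⁻¹ * (O * x * B) = Bᵀ * (xᵀ * (Oᵀ * O) * x) * B := by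
      simp only [inv_one, transpose_mul, Matrix.mul_one, Matrix.mul_assoc]
    rw [this, hO, inv_one, det_mul, det_mul, det_transpose, sq_abs]
    ring
  have hD0 := (posSemidef_form (PosDef.one (n := Fin p) (R := ℝ)).inv.posSemidef x).det_nonneg
  have hpow : (|B.det| ^ 2 * (xᵀ * (1 : Mat p p)⁻¹ * x).det) ^ ((p : ℝ) / 2) =
      |B.det| ^ p * (xᵀ * (1 : Mat p p)⁻¹ * x).det ^ ((p : ℝ) / 2) := by
    rw [Real.mul_rpow (by positivity) hD0, ← Real.rpow_natCast |B.det| 2,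
      ← Real.rpow_mul hB'.le, ← Real.rpow_natCast |B.det| p]
    congr 2
    push_cast; ring
  have hcross : (1 - ρ)⁻¹ • crossForm (1 : Mat p p)⁻¹ ρ (O * x * B) (O * y * B) =
      Bᵀ * ((1 - ρ)⁻¹ • crossForm (1 : Mat p p)⁻¹ ρ x y) * B := by
    rw [inv_one, crossForm_one_equivariant hO, Matrix.mul_smul, Matrix.smul_mul]
  rw [proposalDensity, proposalDensity, hD, hpow, hcross,
    ← mixture_congr p hB ((1 - ρ)⁻¹ • crossForm (1 : Mat p p)⁻¹ ρ x y), ← mul_assoc,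
    ← ENNReal.ofReal_mul (by positivity),
    ← mul_assoc (ENNReal.ofReal _) (ENNReal.ofReal ((|B.det| ^ 2) ^ p)),
    ← ENNReal.ofReal_mul' (by positivity)]
  congr 2
  ring

theorem lintegral_proposal_equivariant (h : multiGamma q ((p : ℝ) / 2) ≠ 0) {O : Mat p p}
    (hO : Oᵀ * O = 1) {B : Mat q q} (hB : B.det ≠ 0) {ρ : ℝ} (h0 : 0 ≤ ρ) (h1 : ρ < 1)
    (x : Mat p q) {F : Mat p q → ℝ≥0∞} (hF : Measurable F) :
    ∫⁻ y, F y ∂(proposal (1 : Mat p p) ρ (O * x * B)) =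
      ∫⁻ y, F (O * y * B) ∂(proposal (1 : Mat p p) ρ x) := by
  have hOdet : O.det * O.det = 1 := by
    have := congrArg det hO
    rwa [det_mul, det_transpose, det_one] at this
  have hOabs : |O.det| = 1 := by
    rcases mul_self_eq_one_iff.1 hOdet with h | h <;> simp [h]
  have hO0 : O.det ≠ 0 := fun h => by simp [h] at hOdet
  have hpd : ∀ x : Mat p q, Measurable (proposalDensity (1 : Mat p p) ρ x) := fun x =>
    Measurable.comp (f := fun y : Mat p q => (x, y)) (measurable_proposalDensity (1 : Mat p p) ρ)
      measurable_prodMk_left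
  have hc : Measurable fun y : Mat p q => O * y * B := Continuous.measurable (by fun_prop)
  have hFc : Measurable fun y : Mat p q => F (O * y * B) := hF.comp hc
  set H : Mat p q → ℝ≥0∞ := fun y => proposalDensity (1 : Mat p p) ρ (O * x * B) y * F y with hH
  have hHm : Measurable H := (hpd _).mul hF
  have hHc : Measurable fun y : Mat p q => H (y * B) :=
    hHm.comp (Continuous.measurable (by fun_prop) : Measurable fun y : Mat p q => y * B)
  rw [proposal_eq_withDensity h PosDef.one h0 h1, proposal_eq_withDensity h PosDef.one h0 h1,
    lintegral_withDensity_eq_lintegral_mul _ (hpd _) hF,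
    lintegral_withDensity_eq_lintegral_mul _ (hpd _) hFc]
  show ∫⁻ y, H y ∂(leb p q) = _
  have e2 := lintegral_leb_mul_left hO0 (F := fun y : Mat p q => H (y * B)) hHc
  rw [← lintegral_leb_mul_right hB hHm, ← e2, hOabs, one_pow,
    ENNReal.ofReal_one, one_mul, ← lintegral_const_mul' _ _ ENNReal.ofReal_ne_top]
  refine lintegral_congr fun y => ?_
  rw [hH, Pi.mul_apply, ← proposalDensity_equivariant hO hB, mul_assoc]

end Equivariance

section SquareRoot

variable {q : ℕ}

instance instStandardBorelPosMat : StandardBorelSpace (PosMat q) :=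
  measurableSet_posDef.standardBorel

open scoped MatrixOrder in
/-- The square root is measurable, as the inverse of an injective measurable map between standard
Borel spaces. -/
theorem measurable_sqrtMat : Measurable (sqrtMat : PosMat q → Mat q q) := by
  set sq : PosMat q → PosMat q := fun S => toPosMat (S.1 * S.1) with hsq
  have hpd : ∀ S : PosMat q, (S.1 * S.1).PosDef := fun S => by
    have := posDef_gram (x := S.1) (by
      rw [det_mul, det_transpose]
      exact (mul_pos (det_posMat_pos S) (det_posMat_pos S)).ne')
    rwa [transpose_posMat] at this
  have hsqm : Measurable sq := by
    have hc : Measurable fun A : Mat q q => A * A := Continuous.measurable (by fun_prop)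
    exact measurable_toPosMat.comp (hc.comp measurable_subtype_coe)
  have hcoe : ∀ S, (sq S).1 = S.1 * S.1 := fun S => coe_toPosMat (hpd S)
  have hsqrt : ∀ S, sqrtMat (sq S) = S.1 := fun S => by
    unfold sqrtMat
    rw [hcoe]
    exact CFC.sqrt_mul_self _ (Matrix.nonneg_iff_posSemidef.2 S.2.posSemidef)
  have hinj : Function.Injective sq := fun S T hST => by
    rw [← Subtype.coe_inj, ← hsqrt S, ← hsqrt T, hST]
  have hemb := hsqm.measurableEmbedding hinj
  set r : PosMat q → PosMat q := fun S => ⟨sqrtMat S, posDef_sqrtMat S⟩ with hr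
  have hrsq : ∀ S, sq (r S) = S := fun S => by
    rw [← Subtype.coe_inj, hcoe]
    exact sqrtMat_mul_self S
  have hrm : Measurable r := by
    intro A hA
    have : r ⁻¹' A = sq '' A := by
      ext S
      constructor
      · exact fun hS => ⟨r S, hS, hrsq S⟩
      · rintro ⟨T, hT, rfl⟩
        rwa [Set.mem_preimage, hinj (hrsq (sq T))]
    rw [this]
    exact hemb.measurableSet_image.2 hA
  exact measurable_subtype_coe.comp hrm

end SquareRoot

section Induced

variable {p q : ℕ}

theorem transpose_frame_mul_frame (hpq : q ≤ p) : (frame p q)ᵀ * frame p q = 1 := by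
  ext i j
  rw [Matrix.mul_apply, Finset.sum_eq_single (Fin.castLE hpq i)]
  · simp [frame, one_apply, Fin.ext_iff]
  · intro k _ hk
    have : ¬ (k : ℕ) = i := fun h => hk (Fin.ext h)
    simp [frame, this]
  · simp

theorem gram_frame_mul_sqrtMat (hpq : q ≤ p) (S : PosMat q) :
    (frame p q * sqrtMat S)ᵀ * (frame p q * sqrtMat S) = S.1 := by
  rw [transpose_mul, transpose_sqrtMat, Matrix.mul_assoc, ← Matrix.mul_assoc _ _ (sqrtMat S),
    transpose_frame_mul_frame hpq, Matrix.one_mul, sqrtMat_mul_self]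

theorem ae_proposal_det_gram_ne_zero (hpq : q ≤ p) (h : multiGamma q ((p : ℝ) / 2) ≠ 0)
    {U : Mat p p} (hU : U.PosDef) {ρ : ℝ} (h0 : 0 ≤ ρ) (h1 : ρ < 1) (x : Mat p q) :
    ∀ᵐ y ∂(proposal U ρ x), (yᵀ * y).det ≠ 0 := by
  rw [proposal_eq_withDensity h hU h0 h1]
  exact (withDensity_absolutelyContinuous _ _).ae_le (ae_det_gram_ne_zero hpq)

theorem noise_eq_map_gram (hpq : q ≤ p) (h : multiGamma q ((p : ℝ) / 2) ≠ 0) {ρ : ℝ} (h0 : 0 ≤ ρ)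
    (h1 : ρ < 1) : noise p q ρ = (proposal (1 : Mat p p) ρ (frame p q)).map gram := by
  ext s hs
  rw [noise, measurableEmbedding_posMat.comap_apply,
    Measure.map_apply measurable_gram (measurableEmbedding_posMat.measurableSet_image.2 hs),
    Measure.map_apply measurable_gramPos hs]
  refine measure_congr ?_
  filter_upwards [ae_proposal_det_gram_ne_zero hpq h PosDef.one h0 h1 (frame p q)] with y hy
  refine propext ⟨?_, fun hg => ⟨gram y, hg, coe_gram hy⟩⟩
  rintro ⟨T, hT, hTy⟩
  have : gram y = T := Subtype.ext ((coe_gram hy).trans hTy.symm)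
  show gram y ∈ s
  rwa [this]

theorem measurable_circ_left (S : PosMat q) : Measurable fun e : PosMat q => circ e S := by
  have hc : Measurable fun A : Mat q q => sqrtMat S * A * sqrtMat S :=
    Continuous.measurable (by fun_prop)
  exact (hc.comp measurable_subtype_coe).subtype_mk

/-- The induced proposal from `S` is the image under `x ↦ xᵀ x` of the proposal from any `x` with
`xᵀ x = S`. This is the equivariance of the proposal under `x ↦ O x S^{1/2}`, `O ∈ O(p)`. -/
theorem proposalPos_eq_map_gram (hpq : q ≤ p) (h : multiGamma q ((p : ℝ) / 2) ≠ 0) {ρ : ℝ}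
    (h0 : 0 ≤ ρ) (h1 : ρ < 1) {x : Mat p q} {S : PosMat q} (hx : xᵀ * x = S.1) :
    proposalPos p ρ S = (proposal (1 : Mat p p) ρ x).map gram := by
  have hz := gram_frame_mul_sqrtMat hpq S
  obtain ⟨O, hO, hOx⟩ := exists_orthogonal_mul_eq (hx.trans hz.symm)
    (by rw [hz]; exact (det_posMat_pos S).ne')
  rw [← Matrix.mul_assoc] at hOx
  refine Measure.ext_of_lintegral _ fun F hF => ?_
  have hFc : Measurable fun e => F (circ e S) := hF.comp (measurable_circ_left S)
  have hFg : Measurable fun y : Mat p q => F (gram y) := hF.comp measurable_gramPos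
  rw [proposalPos, lintegral_map hF (measurable_circ_left S), noise_eq_map_gram hpq h h0 h1,
    lintegral_map hFc measurable_gramPos, lintegral_map hF measurable_gramPos, ← hOx,
    lintegral_proposal_equivariant h hO (det_sqrtMat_pos S).ne' h0 h1 _ hFg]
  refine lintegral_congr_ae ?_
  filter_upwards [ae_proposal_det_gram_ne_zero hpq h PosDef.one h0 h1 (frame p q)] with y hy
  have e : (O * y * sqrtMat S)ᵀ * (O * y * sqrtMat S) = (circ (gram y) S).1 := by
    rw [circ_coe, coe_gram hy]
    calc (O * y * sqrtMat S)ᵀ * (O * y * sqrtMat S)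
        = (sqrtMat S)ᵀ * (yᵀ * (Oᵀ * O) * y) * sqrtMat S := by
          simp only [transpose_mul, Matrix.mul_assoc]
      _ = _ := by rw [hO, Matrix.mul_one, transpose_sqrtMat]
  have : gram (O * y * sqrtMat S) = circ (gram y) S := by
    rw [gram, e, toPosMat_coe]
  rw [this]

theorem measurable_proposalPos (hpq : q ≤ p) (h : multiGamma q ((p : ℝ) / 2) ≠ 0) {ρ : ℝ}
    (h0 : 0 ≤ ρ) (h1 : ρ < 1) :
    Measurable (proposalPos p ρ : PosMat q → Measure (PosMat q)) := by
  have e : (proposalPos p ρ : PosMat q → Measure (PosMat q)) =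
      fun S => (proposal (1 : Mat p p) ρ (frame p q * sqrtMat S)).map gram :=
    funext fun S => proposalPos_eq_map_gram hpq h h0 h1 (gram_frame_mul_sqrtMat hpq S)
  have hc : Measurable fun A : Mat q q => frame p q * A := Continuous.measurable (by fun_prop)
  have hx : Measurable fun S : PosMat q => frame p q * sqrtMat S := hc.comp measurable_sqrtMat
  have hp : Measurable fun S : PosMat q => proposal (1 : Mat p p) ρ (frame p q * sqrtMat S) :=
    (measurable_proposal h PosDef.one h0 h1).comp hx
  rw [e]
  exact (Measure.measurable_map _ measurable_gramPos).comp hp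

/-- The induced proposal as a kernel. -/
noncomputable def proposalPosKernel (hpq : q ≤ p) (h : multiGamma q ((p : ℝ) / 2) ≠ 0) {ρ : ℝ}
    (h0 : 0 ≤ ρ) (h1 : ρ < 1) : Kernel (PosMat q) (PosMat q) where
  toFun := proposalPos p ρ
  measurable' := measurable_proposalPos hpq h h0 h1

theorem proposalPos_univ_le_one (hpq : q ≤ p) (hp : p ≠ 0) (h : multiGamma q ((p : ℝ) / 2) ≠ 0)
    {ρ : ℝ} (h0 : 0 ≤ ρ) (h1 : ρ < 1) (S : PosMat q) : proposalPos p ρ S Set.univ ≤ 1 := by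
  rw [proposalPos_eq_map_gram hpq h h0 h1 (gram_frame_mul_sqrtMat hpq S),
    Measure.map_apply measurable_gramPos MeasurableSet.univ]
  exact proposal_univ_le_one hp h PosDef.one ρ _

theorem exists_smul_proposalPos_le (hpq : q ≤ p) (h : multiGamma q ((p : ℝ) / 2) ≠ 0) {ρ : ℝ}
    (h0 : 0 ≤ ρ) (h1 : ρ < 1) : ∃ c : ℝ, 0 < c ∧
      ∀ S : PosMat q, ENNReal.ofReal c • proposalPos p 0 S ≤ proposalPos p ρ S := by
  obtain ⟨c, hc, hle⟩ := exists_smul_proposal_le (q := q) h (PosDef.one (n := Fin p)) h0 h1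
  refine ⟨c, hc, fun S => ?_⟩
  rw [proposalPos_eq_map_gram hpq h h0 h1 (gram_frame_mul_sqrtMat hpq S),
    proposalPos_eq_map_gram hpq h le_rfl one_pos (gram_frame_mul_sqrtMat hpq S),
    ← Measure.map_smul]
  exact Measure.map_mono (hle _) measurable_gramPos

/-- Reversibility with respect to `μ` descends from `ν_I` along `x ↦ xᵀ x`. -/
theorem proposalPos_reversible (hpq : q ≤ p) (hp : p ≠ 0) (h : multiGamma q ((p : ℝ) / 2) ≠ 0)
    {ρ : ℝ} (h0 : 0 ≤ ρ) (h1 : ρ < 1) {g : PosMat q × PosMat q → ℝ≥0∞} (hg : Measurable g) :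
    ∫⁻ S, ∫⁻ T, g (S, T) ∂(proposalPos p ρ S) ∂(mu q) =
      ∫⁻ S, ∫⁻ T, g (T, S) ∂(proposalPos p ρ S) ∂(mu q) := by
  set κ := proposalPosKernel hpq h h0 h1
  have : IsFiniteKernel κ := ⟨1, ENNReal.one_lt_top, proposalPos_univ_le_one hpq hp h h0 h1⟩
  have key : ∀ G : PosMat q × PosMat q → ℝ≥0∞, Measurable G →
      ∫⁻ S, ∫⁻ T, G (S, T) ∂(proposalPos p ρ S) ∂(mu q) =
        ∫⁻ x, ∫⁻ y, G (gram x, gram y) ∂(proposal (1 : Mat p p) ρ x) ∂(nu q (1 : Mat p p)) := by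
    intro G hG
    have hin : Measurable fun S => ∫⁻ T, G (S, T) ∂(κ S) := hG.lintegral_kernel_prod_right'
    have e := lintegral_nu_gram hpq h hin
    refine e.symm.trans (lintegral_congr_ae ?_)
    filter_upwards [ae_nu_det_gram_ne_zero hpq (1 : Mat p p)] with x hx
    show ∫⁻ T, G (gram x, T) ∂(proposalPos p ρ (gram x)) = _
    have hGx : Measurable fun T => G (gram x, T) := hG.comp measurable_prodMk_left
    rw [proposalPos_eq_map_gram hpq h h0 h1 (coe_gram hx).symm,
      lintegral_map hGx measurable_gramPos]
  have hg2 : Measurable fun z : PosMat q × PosMat q => g z.swap := hg.comp measurable_swap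
  have k2 := key _ hg2
  simp only [Prod.swap_prod_mk] at k2
  rw [key g hg, k2]
  have hgg : Measurable fun z : Mat p q × Mat p q => g (gram z.1, gram z.2) :=
    hg.comp ((measurable_gramPos.comp measurable_fst).prodMk
      (measurable_gramPos.comp measurable_snd))
  exact proposal_reversible hpq h PosDef.one h0 h1 hgg

instance instNullSingletonLebPos [NeZero q] : NullSingletonClass (lebPos q) := by
  refine ⟨fun S => ?_⟩
  have : Nonempty (Upper q) := ⟨⟨(0, 0), le_rfl⟩⟩
  rw [lebPos, measurableEmbedding_posMat.comap_apply, Set.image_singleton,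
    Measure.map_apply measurable_symOfUpper (measurableSet_singleton _)]
  refine Set.Subsingleton.measure_zero ?_ _
  intro v hv w hw
  rw [← upperOf_symOfUpper v, ← upperOf_symOfUpper w, Set.mem_singleton_iff.1 hv,
    Set.mem_singleton_iff.1 hw]

theorem hasSpectralGap_kernelPos (hq : 1 ≤ q) (hpq : q ≤ p)
    (target : Measure (PosMat q)) [IsProbabilityMeasure target] {dens : PosMat q → ℝ}
    (hdens : Measurable dens) (hdens0 : ∀ S, 0 ≤ dens S)
    (htarget : target = (mu q).withDensity fun S => ENNReal.ofReal (dens S))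
    (hgap : HasSpectralGap (kernelPos p dens 0) target) {ρ : ℝ} (h0 : 0 ≤ ρ) (h1 : ρ < 1) :
    HasSpectralGap (kernelPos p dens ρ) target := by
  have h := multiGamma_ne_zero hpq
  have : NeZero q := ⟨by omega⟩
  have hp : p ≠ 0 := by omega
  obtain ⟨c, hc, hle⟩ := exists_smul_proposalPos_le (q := q) hpq h h0 h1
  have hmass₀ : ∀ S : PosMat q, proposalPos p 0 S Set.univ ≤ 1 :=
    proposalPos_univ_le_one hpq hp h le_rfl one_pos
  have hmass : ∀ S : PosMat q, proposalPos p ρ S Set.univ ≤ 1 :=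
    proposalPos_univ_le_one hpq hp h h0 h1
  set Q₀ : Kernel (PosMat q) (PosMat q) := proposalPosKernel hpq h le_rfl one_pos
  set Q : Kernel (PosMat q) (PosMat q) := proposalPosKernel hpq h h0 h1
  have : IsFiniteKernel Q₀ := ⟨1, ENNReal.one_lt_top, hmass₀⟩
  have : IsFiniteKernel Q := ⟨1, ENNReal.one_lt_top, hmass⟩
  have hnull : NullSingletonClass target := by
    refine nullSingletonClass_of_absolutelyContinuous (instNullSingletonLebPos (q := q)) ?_
    rw [htarget]
    exact (withDensity_absolutelyContinuous _ _).trans (withDensity_absolutelyContinuous _ _)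
  have : SecondCountableTopology (PosMat q) := TopologicalSpace.Subtype.secondCountableTopology _
  obtain ⟨A, hA, hA0, hA1⟩ := exists_measurableSet_measure_lt_half target
  exact hasSpectralGap_metropolis_of_smul_le hdens hdens0 Q₀ Q hmass₀ hmass
    (fun g hg => proposalPos_reversible hpq hp h le_rfl one_pos hg)
    (fun g hg => proposalPos_reversible hpq hp h h0 h1 hg) htarget hc hle hA hA0 hA1 hgap

end Induced

end MpCN

theorem mainTheorem10 (p q : ℕ) (hq : 1 ≤ q) (hpq : q ≤ p) :
    (∀ (U : MpCN.Mat p p), U.PosDef →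
      ∀ (target : Measure (MpCN.Mat p q)) [IsProbabilityMeasure target]
        (dens : MpCN.Mat p q → ℝ), Measurable dens → (∀ x, 0 ≤ dens x) →
        target = (MpCN.nu q U).withDensity (fun x => ENNReal.ofReal (dens x)) →
        MpCN.HasSpectralGap (MpCN.kernel U dens 0) target →
        ∀ ρ : ℝ, 0 ≤ ρ → ρ < 1 → MpCN.HasSpectralGap (MpCN.kernel U dens ρ) target) ∧
    (∀ (target : Measure (MpCN.PosMat q)) [IsProbabilityMeasure target]
        (dens : MpCN.PosMat q → ℝ), Measurable dens → (∀ S, 0 ≤ dens S) →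
        target = (MpCN.mu q).withDensity (fun S => ENNReal.ofReal (dens S)) →
        MpCN.HasSpectralGap (MpCN.kernelPos p dens 0) target →
        ∀ ρ : ℝ, 0 ≤ ρ → ρ < 1 → MpCN.HasSpectralGap (MpCN.kernelPos p dens ρ) target) :=
  ⟨fun _ hU target _ _ hdens hdens0 htarget hgap _ h0 h1 =>
    MpCN.hasSpectralGap_kernel hq hpq hU target hdens hdens0 htarget hgap h0 h1,
  fun target _ _ hdens hdens0 htarget hgap _ h0 h1 =>
    MpCN.hasSpectralGap_kernelPos hq hpq target hdens hdens0 htarget hgap h0 h1⟩
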